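/- **Setting.** Let $(X,\Sigma_X,\mu_X)$ and $(Y,\Sigma_Y,\mu_Y)$ be $\sigma$-finite measure spaces that are separable (there is a countable family of measurable sets such that every measurable set $B$ of finite measure is approximated by members $A$ of the family, $\mu(A\triangle B)<\varepsilon$). Let $\varphi:Y\to X$ be measurable with $\varphi_*\mu_Y=\mu_X$, let $p,q\in(1,\infty)$ with $\frac1p+\frac1q=1$, and let $\mathscr M$ be an $L^p(\mu_X)$-normed module: an $L^\infty(\mu_X)$-module with a pointwise norm $|\cdot|:\mathscr M\to L^p(\mu_X)$, $|v|\ge 0$, $|fv|=|f||v|$, such that $\|v\|=\||v|\|_{L^p}$ is a complete norm. Let $(\varphi^*\mathscr M,\varphi^*)$ be the pullback of $\mathscr M$, i.e. the $L^p(\mu_Y)$-normed module $\varphi^*\mathscr M$ with a linear map $\varphi^*:\mathscr M\to\varphi^*\mathscr M$ such that $|\varphi^*v|=|v|\circ\varphi$ and the $L^\infty(\mu_Y)$-linear span of $\varphi^*(\mathscr M)$ is dense. Its dual $(\varphi^*\mathscr M)^*$ is the space of $L^\infty(\mu_Y)$-linear continuous maps $L:\varphi^*\mathscr M\to L^1(\mu_Y)$,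 with the operator norm and the pointwise norm $|L|=\operatorname{ess\,sup}\{L(V):|V|\le1\}$; it is an $L^q(\mu_Y)$-normed module. **Fibres.** Fix a sequence $(A_n)$ of measurable subsets of $X$ that is dense in the above sense. Let $E_k(x)$ be the cell containing $x$ of the partition generated by the first $k$ of the sets $A_n$, and let $P_kf(x)$ be the mean of $f$ over $E_k(x)$, read as $0$ if $\mu_X(E_k(x))\in\{0,\infty\}$. Let $\mathrm{Leb}(f)$ be the set of $x$ where $\lim_kP_kf(x)$ exists in $\mathbb R$, and let $\mathrm{Rep}(f)(x)$ be this limit if $x\in\mathrm{Leb}(f)$, and $0$ otherwise. Put $\mathscr M_x=\{v\in\mathscr M:x\in\mathrm{Leb}(|v|^p)\}$ and, on its linear span, $\|v\|_x=\inf\sum_i\mathrm{Rep}(|v_i|^p)(x)^{1/p}$, the infimum being over all finite decompositions $v=\sum_iv_i$ with $v_i\in\mathscr M_x$. Let $\hat{\mathscr M}_x$ be the Banach space obtained from this seminormed span by quotient and completion. For $v\in\mathscr M$ let $\mathrm{Rep}(v)(x)\in\hat{\mathscr M}_x$ be the image of $v$ if $v\in\mathscr M_x$, and $0$ otherwise.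 **Sections.** The spaces $\hat{\mathscr M}_{\varphi(y)}$, $y\in Y$, with the test vectors $\mathrm{Rep}(v)\circ\varphi$, $v\in\mathscr M$, form a weak Banach bundle: up to $\mu_Y$-null sets, linear combinations of test vectors are test vectors. A section $\omega$ assigns to each $y$ some $\omega(y)\in(\hat{\mathscr M}_{\varphi(y)})'$. It is weakly measurable if $\langle\omega,\mathrm{Rep}(v)\circ\varphi\rangle$ is measurable off a $\mu_Y$-null set for every $v\in\mathscr M$. Its pointwise norm $|\omega|$ is the $\mu_Y$-essential supremum of $\langle\omega,s\rangle$ over all finite sums $s=\sum_if_i\,\mathrm{Rep}(v_i)\circ\varphi$ with measurable $f_i:Y\to\mathbb R$, $v_i\in\mathscr M$ and $\|s(y)\|\le1$ for all $y$. Two sections are equivalent if for each $v\in\mathscr M$ their pairings with $\mathrm{Rep}(v)\circ\varphi$ agree $\mu_Y$-a.e. Let $L^q_{\sf weak}(\hat{\mathscr M}'_{\varphi(\star)};\mu_Y)$ be the space of equivalence classes of weakly measurable sections with $|\omega|\in L^q(\mu_Y)$. **Theorem.** With the pointwise operations and the pointwise norm $|\cdot|$, the space $L^q_{\sf weak}(\hat{\mathscr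 M}'_{\varphi(\star)};\mu_Y)$ is an $L^q(\mu_Y)$-normed module. For each $\omega$ in it there is exactly one $\mathcal I(\omega)\in(\varphi^*\mathscr M)^*$ with $$\mathcal I(\omega)(\varphi^*v)=\langle\omega,\mathrm{Rep}(v)\circ\varphi\rangle\quad\mu_Y\text{-a.e., for all }v\in\mathscr M,$$ and $\mathcal I:L^q_{\sf weak}(\hat{\mathscr M}'_{\varphi(\star)};\mu_Y)\to(\varphi^*\mathscr M)^*$ is an isomorphism of $L^q(\mu_Y)$-normed modules: it is $L^\infty(\mu_Y)$-linear, bijective, and $|\mathcal I(\omega)|=|\omega|$ $\mu_Y$-a.e. -/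

import Mathlib

open MeasureTheory Set Filter Topology
open scoped ENNReal NNReal

namespace NormedModules
section Linf
variable {X : Type*} [MeasurableSpace X] (μ : Measure X)

noncomputable instance : NatCast (X →ₘ[μ] ℝ) := ⟨fun n => AEEqFun.const X (n : ℝ)⟩
noncomputable instance : IntCast (X →ₘ[μ] ℝ) := ⟨fun n => AEEqFun.const X (n : ℝ)⟩

/-- Almost-everywhere classes of measurable real functions form a commutative ring. -/
noncomputable instance : CommRing (X →ₘ[μ] ℝ) :=
  AEEqFun.toGerm_injective.commRing AEEqFun.toGerm AEEqFun.zero_toGerm AEEqFun.one_toGerm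
    AEEqFun.add_toGerm AEEqFun.mul_toGerm AEEqFun.neg_toGerm AEEqFun.sub_toGerm
    (fun _ _ => AEEqFun.smul_toGerm _ _) (fun _ _ => AEEqFun.smul_toGerm _ _)
    AEEqFun.pow_toGerm (fun _ => rfl) (fun _ => rfl)

noncomputable instance : Algebra ℝ (X →ₘ[μ] ℝ) :=
  Algebra.ofModule
    (fun c f g => by
      apply AEEqFun.ext
      filter_upwards [AEEqFun.coeFn_mul (c • f) g, AEEqFun.coeFn_smul c f,
        AEEqFun.coeFn_smul c (f * g), AEEqFun.coeFn_mul f g] with x h1 h2 h3 h4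
      simp [h1, h2, h3, h4, mul_assoc])
    (fun c f g => by
      apply AEEqFun.ext
      filter_upwards [AEEqFun.coeFn_mul f (c • g), AEEqFun.coeFn_smul c g,
        AEEqFun.coeFn_smul c (f * g), AEEqFun.coeFn_mul f g] with x h1 h2 h3 h4
      simp [h1, h2, h3, h4, mul_left_comm])

/-- The algebra `L^∞(μ)`: classes of essentially bounded measurable functions. -/
noncomputable def Linf : Subalgebra ℝ (X →ₘ[μ] ℝ) where
  carrier := {f | eLpNorm f ∞ μ < ∞}
  mul_mem' {f g} hf hg := by
    have h := MemLp.mul (r := ∞) (μ := μ) ⟨g.aestronglyMeasurable, hg⟩ ⟨f.aestronglyMeasurable, hf⟩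
    exact (eLpNorm_congr_ae (AEEqFun.coeFn_mul f g)).trans_lt h.2
  add_mem' {f g} hf hg := by
    have h := MemLp.add (p := ∞) (μ := μ) ⟨f.aestronglyMeasurable, hf⟩ ⟨g.aestronglyMeasurable, hg⟩
    exact (eLpNorm_congr_ae (AEEqFun.coeFn_add f g)).trans_lt h.2
  algebraMap_mem' c := by
    have e : (algebraMap ℝ (X →ₘ[μ] ℝ) c : X → ℝ) =ᵐ[μ] fun _ => c := by
      rw [Algebra.algebraMap_eq_smul_one]
      filter_upwards [AEEqFun.coeFn_smul c (1 : X →ₘ[μ] ℝ), AEEqFun.coeFn_one (α := X) (β := ℝ) (μ := μ)]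
        with x h1 h2
      simp [h1, h2]
    exact (eLpNorm_congr_ae e).trans_lt (memLp_top_const c).2
end Linf

section EssSup
variable {Y : Type*} [MeasurableSpace Y]

/-- `g` is a `μ`-essential supremum of the family `F`: the least measurable function, up to null
sets, that dominates every member of `F` almost everywhere. -/
structure IsEssSup (μ : Measure Y) (F : Set (Y → ℝ≥0∞)) (g : Y → ℝ≥0∞) : Prop where
  measurable : Measurable g
  le : ∀ f ∈ F, f ≤ᵐ[μ] g
  least : ∀ h : Y → ℝ≥0∞, Measurable h → (∀ f ∈ F, f ≤ᵐ[μ] h) → g ≤ᵐ[μ] h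

theorem exists_isEssSup (μ : Measure Y) [SFinite μ] (F : Set (Y → ℝ≥0∞)) :
    ∃ g, IsEssSup μ F g := by
  set ν := μ.toFinite with hν
  have hae : ae ν = ae μ := ae_toFinite
  set J : (Y → ℝ≥0∞) → ℝ≥0∞ := fun h => ∫⁻ y, (1 + h y)⁻¹ ∂ν with hJ
  set G : Set (Y → ℝ≥0∞) := {h | Measurable h ∧ ∀ f ∈ F, f ≤ᵐ[μ] h} with hG
  have hJle : ∀ h, J h ≤ ν univ := fun h => by
    calc J h ≤ ∫⁻ _, 1 ∂ν := lintegral_mono fun y => ENNReal.inv_le_one.2 le_self_add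
      _ = ν univ := by simp
  have hne : (J '' G).Nonempty :=
    ⟨_, fun _ => ∞, ⟨measurable_const, fun f _ => Eventually.of_forall fun y => le_top⟩, rfl⟩
  obtain ⟨u, -, hu, huG⟩ := exists_seq_tendsto_sSup hne (OrderTop.bddAbove _)
  choose h hhG hhu using huG
  set g : Y → ℝ≥0∞ := fun y => ⨅ n, h n y with hg
  have hgm : Measurable g := .iInf fun n => (hhG n).1
  have hgle : ∀ f ∈ F, f ≤ᵐ[μ] g := fun f hf => by
    filter_upwards [ae_all_iff.2 fun n => (hhG n).2 f hf] with y hy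
    exact le_iInf hy
  have hsup : sSup (J '' G) ≤ J g := le_of_tendsto' hu fun n => by
    rw [← hhu n]
    exact lintegral_mono fun y => ENNReal.inv_le_inv.2 (by gcongr; exact iInf_le _ n)
  refine ⟨g, hgm, hgle, fun k hk hkF => ?_⟩
  have hmin : (fun y => min (g y) (k y)) ∈ G := ⟨hgm.min hk, fun f hf => by
    filter_upwards [hgle f hf, hkF f hf] with y h1 h2 using le_min h1 h2⟩
  have h1 : (fun y => (1 + g y)⁻¹) ≤ᵐ[ν] fun y => (1 + min (g y) (k y))⁻¹ :=
    Eventually.of_forall fun y => ENNReal.inv_le_inv.2 (by gcongr; exact min_le_left _ _)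
  have h2 := ae_eq_of_ae_le_of_lintegral_le h1 ((hJle g).trans_lt (measure_lt_top _ _)).ne
    (by fun_prop) ((le_sSup (mem_image_of_mem J hmin)).trans hsup)
  rw [Filter.EventuallyEq, hae] at h2
  filter_upwards [h2] with y hy
  have h3 := (ENNReal.add_right_inj ENNReal.one_ne_top).1 (inv_injective hy)
  rw [h3]; exact min_le_right _ _

/-- A representative of the essential supremum of `F`, unique up to null sets. -/
noncomputable def familyEssSup (μ : Measure Y) [SFinite μ] (F : Set (Y → ℝ≥0∞)) : Y → ℝ≥0∞ :=
  Classical.choose (exists_isEssSup μ F)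

theorem isEssSup_familyEssSup (μ : Measure Y) [SFinite μ] (F : Set (Y → ℝ≥0∞)) :
    IsEssSup μ F (familyEssSup μ F) :=
  Classical.choose_spec (exists_isEssSup μ F)
end EssSup

section Rep
variable {X : Type*} [MeasurableSpace X]

/-- The cell containing `x` of the finite partition generated by `A 0, …, A (k - 1)`. -/
def cell (A : ℕ → Set X) (k : ℕ) (x : X) : Set X := {z | ∀ i < k, (z ∈ A i ↔ x ∈ A i)}

/-- The mean of `f` over the `k`-th cell of `x`; it is `0` if that cell has measure `0` or `∞`. -/
noncomputable def cellAverage (μ : Measure X) (A : ℕ → Set X) (k : ℕ) (f : X → ℝ) (x : X) : ℝ :=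
  ⨍ z in cell A k x, f z ∂μ

/-- The points where the means over the shrinking cells converge to a real number. -/
def Leb (μ : Measure X) (A : ℕ → Set X) (f : X → ℝ) : Set X :=
  {x | ∃ l : ℝ, Tendsto (fun k => cellAverage μ A k f x) atTop (𝓝 l)}

open Classical in
/-- The pointwise representative: the limit of the cell means where it exists, and `0` elsewhere. -/
noncomputable def Rep (μ : Measure X) (A : ℕ → Set X) (f : X → ℝ) (x : X) : ℝ :=
  if x ∈ Leb μ A f then limUnder atTop (fun k => cellAverage μ A k f x) else 0

theorem cellAverage_congr {μ : Measure X} (A : ℕ → Set X) (k : ℕ) {f g : X → ℝ}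
    (h : f =ᵐ[μ] g) (x : X) : cellAverage μ A k f x = cellAverage μ A k g x :=
  average_congr (ae_restrict_of_ae h)

theorem Leb_congr {μ : Measure X} (A : ℕ → Set X) {f g : X → ℝ} (h : f =ᵐ[μ] g) :
    Leb μ A f = Leb μ A g := by
  ext x; simp only [Leb, mem_ofPred_eq, cellAverage_congr A _ h]

theorem Rep_congr {μ : Measure X} (A : ℕ → Set X) {f g : X → ℝ} (h : f =ᵐ[μ] g) (x : X) :
    Rep μ A f x = Rep μ A g x := by
  by_cases hx : x ∈ Leb μ A g
  · rw [Rep, Rep, if_pos hx, if_pos (by rwa [Leb_congr A h])]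
    simp only [cellAverage_congr A _ h]
  · rw [Rep, Rep, if_neg hx, if_neg (by rwa [Leb_congr A h])]

theorem tendsto_Rep {μ : Measure X} {A : ℕ → Set X} {f : X → ℝ} {x : X} (hx : x ∈ Leb μ A f) :
    Tendsto (fun k => cellAverage μ A k f x) atTop (𝓝 (Rep μ A f x)) := by
  rw [Rep, if_pos hx]; exact tendsto_nhds_limUnder hx

theorem Rep_nonneg {μ : Measure X} (A : ℕ → Set X) {f : X → ℝ} (hf : 0 ≤ᵐ[μ] f) (x : X) :
    0 ≤ Rep μ A f x := by
  by_cases hx : x ∈ Leb μ A f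
  · refine ge_of_tendsto' (tendsto_Rep hx) fun k => ?_
    rw [cellAverage, setAverage_eq]
    exact smul_nonneg (by positivity) (integral_nonneg_of_ae (ae_restrict_of_ae hf))
  · rw [Rep, if_neg hx]

theorem cellAverage_const_mul {μ : Measure X} (A : ℕ → Set X) (k : ℕ) (f : X → ℝ) (c : ℝ) (x : X) :
    cellAverage μ A k (fun z => c * f z) x = c * cellAverage μ A k f x := by
  simp only [cellAverage, setAverage_eq, integral_const_mul, smul_eq_mul]; ring

theorem mem_Leb_const_mul {μ : Measure X} {A : ℕ → Set X} {f : X → ℝ} {x : X} (c : ℝ)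
    (hx : x ∈ Leb μ A f) : x ∈ Leb μ A (fun z => c * f z) :=
  ⟨c * Rep μ A f x, by simpa only [cellAverage_const_mul] using (tendsto_Rep hx).const_mul c⟩

theorem Rep_const_mul {μ : Measure X} {A : ℕ → Set X} {f : X → ℝ} {x : X} (c : ℝ)
    (hx : x ∈ Leb μ A f) : Rep μ A (fun z => c * f z) x = c * Rep μ A f x :=
  tendsto_nhds_unique (tendsto_Rep (mem_Leb_const_mul c hx))
    (by simpa only [cellAverage_const_mul] using (tendsto_Rep hx).const_mul c)
end Rep

section Modules
variable {X : Type*} [MeasurableSpace X]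

/-- An `L^p(μ)`-normed `L^∞(μ)`-module structure on the `L^∞(μ)`-module `M`: a pointwise norm
`|·| : M → L^p(μ)`, nonnegative, with `|f v| = |f| |v|`, such that `v ↦ ‖|v|‖_{L^p}` is a complete
norm on `M`. This norm is the norm of the module. -/
structure LpNormedModule (p : ℝ≥0∞) (μ : Measure X) (M : Type*) [AddCommGroup M] [Module ℝ M]
    [Module (Linf μ) M] [IsScalarTower ℝ (Linf μ) M] where
  ptNorm : M → Lp ℝ p μ
  ptNorm_nonneg : ∀ v, 0 ≤ ptNorm v
  ptNorm_smul : ∀ (f : Linf μ) (v : M),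
    (ptNorm (f • v) : X →ₘ[μ] ℝ) = |(f : X →ₘ[μ] ℝ)| * (ptNorm v : X →ₘ[μ] ℝ)
  norm_add_le : ∀ v w, ‖ptNorm (v + w)‖ ≤ ‖ptNorm v‖ + ‖ptNorm w‖
  eq_zero_of_norm : ∀ v, ‖ptNorm v‖ = 0 → v = 0
  complete : ∀ u : ℕ → M,
    (∀ ε : ℝ, 0 < ε → ∃ n₀, ∀ m ≥ n₀, ∀ n ≥ n₀, ‖ptNorm (u m - u n)‖ < ε) →
    ∃ v, Tendsto (fun n => ‖ptNorm (u n - v)‖) atTop (𝓝 0)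

variable {μ : Measure X} {M : Type*} [AddCommGroup M] [Module ℝ M] [Module (Linf μ) M]
  [IsScalarTower ℝ (Linf μ) M]

theorem LpNormedModule.ptNorm_real_smul {p : ℝ≥0∞} (𝓜 : LpNormedModule p μ M) (c : ℝ) (v : M) :
    (𝓜.ptNorm (c • v) : X → ℝ) =ᵐ[μ] fun z => |c| * 𝓜.ptNorm v z := by
  have h := 𝓜.ptNorm_smul (algebraMap ℝ (Linf μ) c) v
  rw [algebraMap_smul] at h
  rw [h]
  have e : ((algebraMap ℝ (Linf μ) c : Linf μ) : X →ₘ[μ] ℝ) = c • (1 : X →ₘ[μ] ℝ) :=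
    Algebra.algebraMap_eq_smul_one c
  rw [e]
  filter_upwards [AEEqFun.coeFn_mul |c • (1 : X →ₘ[μ] ℝ)| (𝓜.ptNorm v : X →ₘ[μ] ℝ),
    AEEqFun.coeFn_abs (c • (1 : X →ₘ[μ] ℝ)), AEEqFun.coeFn_smul c (1 : X →ₘ[μ] ℝ),
    AEEqFun.coeFn_one (α := X) (β := ℝ) (μ := μ)] with z h1 h2 h3 h4
  simp [h1, h2, h3, h4]

variable {p : ℝ} (𝓜 : LpNormedModule (ENNReal.ofReal p) μ M) (A : ℕ → Set X)

/-- The function `|v|^p`. -/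
noncomputable def LpNormedModule.ptNormPow (v : M) : X → ℝ := fun z => 𝓜.ptNorm v z ^ p

/-- The set `M_x` of the `v` in `M` with `x` in `Leb(|v|^p)`. -/
def LpNormedModule.lebSet (x : X) : Set M := {v | x ∈ Leb μ A (𝓜.ptNormPow v)}

/-- `Rep(|v|^p)(x)^{1/p}`. -/
noncomputable def LpNormedModule.repNorm (x : X) (v : M) : ℝ :=
  Rep μ A (𝓜.ptNormPow v) x ^ (1 / p)

/-- The seminorm `‖v‖_x`: the infimum of `∑ Rep_p(|v_i|)(x)` over the finite decompositions
`v = ∑ v_i` with all `v_i` in `M_x`. -/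
noncomputable def LpNormedModule.fiberNorm (x : X) (v : M) : ℝ :=
  sInf {r | ∃ l : List M, (∀ u ∈ l, u ∈ 𝓜.lebSet A x) ∧ l.sum = v ∧
    (l.map (𝓜.repNorm A x)).sum = r}

/-- The linear span of `M_x`, with the seminorm `‖·‖_x`. -/
def LpNormedModule.PreFiber (x : X) : Type _ := Submodule.span ℝ (𝓜.lebSet A x)

noncomputable instance (x : X) : AddCommGroup (𝓜.PreFiber A x) :=
  inferInstanceAs (AddCommGroup (Submodule.span ℝ (𝓜.lebSet A x)))

noncomputable instance (x : X) : Module ℝ (𝓜.PreFiber A x) :=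
  inferInstanceAs (Module ℝ (Submodule.span ℝ (𝓜.lebSet A x)))

namespace LpNormedModule

theorem ptNormPow_nonneg (v : M) : 0 ≤ᵐ[μ] 𝓜.ptNormPow v := by
  have h : (0 : X → ℝ) ≤ᵐ[μ] 𝓜.ptNorm v := by
    have h1 := (Lp.coeFn_le _ _).2 (𝓜.ptNorm_nonneg v)
    filter_upwards [h1, Lp.coeFn_zero ℝ (ENNReal.ofReal p) μ] with z h2 h3
    rwa [h3] at h2
  filter_upwards [h] with z hz using Real.rpow_nonneg hz p

theorem ptNormPow_smul (c : ℝ) (v : M) :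
    𝓜.ptNormPow (c • v) =ᵐ[μ] fun z => |c| ^ p * 𝓜.ptNormPow v z := by
  have h : (0 : X → ℝ) ≤ᵐ[μ] 𝓜.ptNorm v := by
    have h1 := (Lp.coeFn_le _ _).2 (𝓜.ptNorm_nonneg v)
    filter_upwards [h1, Lp.coeFn_zero ℝ (ENNReal.ofReal p) μ] with z h2 h3
    rwa [h3] at h2
  filter_upwards [𝓜.ptNorm_real_smul c v, h] with z h1 h2
  simp only [ptNormPow, h1]
  exact Real.mul_rpow (abs_nonneg c) h2

theorem smul_mem_lebSet {x : X} (c : ℝ) {v : M} (hv : v ∈ 𝓜.lebSet A x) :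
    c • v ∈ 𝓜.lebSet A x := by
  simp only [lebSet, mem_ofPred_eq, Leb_congr A (𝓜.ptNormPow_smul c v)]
  exact mem_Leb_const_mul _ hv

theorem repNorm_nonneg (x : X) (v : M) : 0 ≤ 𝓜.repNorm A x v :=
  Real.rpow_nonneg (Rep_nonneg A (𝓜.ptNormPow_nonneg v) x) _

theorem repNorm_smul (hp : p ≠ 0) {x : X} (c : ℝ) {v : M} (hv : v ∈ 𝓜.lebSet A x) :
    𝓜.repNorm A x (c • v) = |c| * 𝓜.repNorm A x v := by
  rw [repNorm, Rep_congr A (𝓜.ptNormPow_smul c v), Rep_const_mul _ hv,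
    Real.mul_rpow (by positivity) (Rep_nonneg A (𝓜.ptNormPow_nonneg v) x),
    ← Real.rpow_mul (abs_nonneg c), mul_one_div_cancel hp, Real.rpow_one, repNorm]

theorem sum_repNorm_nonneg (x : X) (l : List M) : 0 ≤ (l.map (𝓜.repNorm A x)).sum :=
  List.sum_nonneg fun r hr => by
    obtain ⟨u, -, rfl⟩ := List.mem_map.1 hr
    exact 𝓜.repNorm_nonneg A x u

theorem fiberNorm_le {x : X} {v : M} (l : List M) (hl : ∀ u ∈ l, u ∈ 𝓜.lebSet A x)
    (hs : l.sum = v) : 𝓜.fiberNorm A x v ≤ (l.map (𝓜.repNorm A x)).sum :=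
  csInf_le ⟨0, fun _ ⟨l, _, _, h⟩ => h ▸ 𝓜.sum_repNorm_nonneg A x l⟩ ⟨l, hl, hs, rfl⟩

theorem exists_list {x : X} {v : M} (hv : v ∈ Submodule.span ℝ (𝓜.lebSet A x)) :
    ∃ l : List M, (∀ u ∈ l, u ∈ 𝓜.lebSet A x) ∧ l.sum = v := by
  induction hv using Submodule.span_induction with
  | mem v hv => exact ⟨[v], by simpa using hv, by simp⟩
  | zero => exact ⟨[], by simp, by simp⟩
  | add v w _ _ h1 h2 =>
    obtain ⟨l, hl, rfl⟩ := h1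
    obtain ⟨k, hk, rfl⟩ := h2
    exact ⟨l ++ k, fun u hu => (List.mem_append.1 hu).elim (hl u) (hk u), by simp⟩
  | smul c v _ h =>
    obtain ⟨l, hl, rfl⟩ := h
    refine ⟨l.map (c • ·), fun u hu => ?_, (List.smul_sum).symm⟩
    obtain ⟨w, hw, rfl⟩ := List.mem_map.1 hu
    exact 𝓜.smul_mem_lebSet A c (hl w hw)

theorem le_fiberNorm {x : X} {v : M} (hv : v ∈ Submodule.span ℝ (𝓜.lebSet A x)) {r : ℝ}
    (h : ∀ l : List M, (∀ u ∈ l, u ∈ 𝓜.lebSet A x) → l.sum = v →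
      r ≤ (l.map (𝓜.repNorm A x)).sum) : r ≤ 𝓜.fiberNorm A x v := by
  obtain ⟨l, hl, hs⟩ := 𝓜.exists_list A hv
  refine le_csInf ⟨_, l, hl, hs, rfl⟩ ?_
  rintro _ ⟨k, hk, hs, rfl⟩
  exact h k hk hs

theorem fiberNorm_nonneg (x : X) (v : M) : 0 ≤ 𝓜.fiberNorm A x v :=
  Real.sInf_nonneg fun _ ⟨l, _, _, h⟩ => h ▸ 𝓜.sum_repNorm_nonneg A x l

theorem fiberNorm_smul_le (hp : p ≠ 0) {x : X} (c : ℝ) {v : M}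
    (hv : v ∈ Submodule.span ℝ (𝓜.lebSet A x)) :
    𝓜.fiberNorm A x (c • v) ≤ |c| * 𝓜.fiberNorm A x v := by
  have key : ∀ l : List M, (∀ u ∈ l, u ∈ 𝓜.lebSet A x) → l.sum = v →
      𝓜.fiberNorm A x (c • v) ≤ |c| * (l.map (𝓜.repNorm A x)).sum := by
    intro l hl hs
    have h := 𝓜.fiberNorm_le A (x := x) (v := c • v) (l.map (c • ·)) (fun u hu => by
      obtain ⟨w, hw, rfl⟩ := List.mem_map.1 hu
      exact 𝓜.smul_mem_lebSet A c (hl w hw)) (by rw [← hs, List.smul_sum])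
    refine h.trans (le_of_eq ?_)
    rw [List.map_map, ← List.sum_map_mul_left]
    exact congrArg List.sum (List.map_congr_left fun u hu => 𝓜.repNorm_smul A hp c (hl u hu))
  rcases eq_or_ne c 0 with rfl | hc
  · obtain ⟨l, hl, hs⟩ := 𝓜.exists_list A hv
    simpa using key l hl hs
  · have hc' : 0 < |c| := abs_pos.2 hc
    rw [← div_le_iff₀' hc']
    exact 𝓜.le_fiberNorm A hv fun l hl hs => (div_le_iff₀' hc').2 (key l hl hs)

theorem fiberNorm_smul (hp : p ≠ 0) {x : X} (c : ℝ) {v : M}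
    (hv : v ∈ Submodule.span ℝ (𝓜.lebSet A x)) :
    𝓜.fiberNorm A x (c • v) = |c| * 𝓜.fiberNorm A x v := by
  refine le_antisymm (𝓜.fiberNorm_smul_le A hp c hv) ?_
  rcases eq_or_ne c 0 with rfl | hc
  · simpa using 𝓜.fiberNorm_nonneg A x _
  · have h := 𝓜.fiberNorm_smul_le A hp c⁻¹ (Submodule.smul_mem _ c hv)
    rw [inv_smul_smul₀ hc, abs_inv] at h
    have hc' : 0 < |c| := abs_pos.2 hc
    calc |c| * 𝓜.fiberNorm A x v ≤ |c| * (|c|⁻¹ * 𝓜.fiberNorm A x (c • v)) := by gcongr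
      _ = _ := by field_simp

theorem fiberNorm_add_le {x : X} {v w : M} (hv : v ∈ Submodule.span ℝ (𝓜.lebSet A x))
    (hw : w ∈ Submodule.span ℝ (𝓜.lebSet A x)) :
    𝓜.fiberNorm A x (v + w) ≤ 𝓜.fiberNorm A x v + 𝓜.fiberNorm A x w := by
  rw [← sub_le_iff_le_add]
  refine 𝓜.le_fiberNorm A hv fun l hl hls => ?_
  rw [sub_le_comm]
  refine 𝓜.le_fiberNorm A hw fun k hk hks => ?_
  rw [sub_le_iff_le_add']
  refine (𝓜.fiberNorm_le A (l ++ k) (fun u hu => (List.mem_append.1 hu).elim (hl u) (hk u))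
    (by simp [hls, hks])).trans (le_of_eq ?_)
  simp

noncomputable instance (x : X) : Norm (𝓜.PreFiber A x) := ⟨fun v => 𝓜.fiberNorm A x v.1⟩

variable [Fact (1 < p)]

theorem preFiber_core (x : X) : SeminormedSpace.Core ℝ (𝓜.PreFiber A x) where
  norm_nonneg v := 𝓜.fiberNorm_nonneg A x v.1
  norm_smul c v := 𝓜.fiberNorm_smul A (zero_lt_one.trans (Fact.out : 1 < p)).ne' c v.2
  norm_triangle v w := 𝓜.fiberNorm_add_le A v.2 w.2

noncomputable instance (x : X) : SeminormedAddCommGroup (𝓜.PreFiber A x) :=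
  SeminormedAddCommGroup.ofCore (𝓜.preFiber_core A x)

noncomputable instance (x : X) : NormedSpace ℝ (𝓜.PreFiber A x) where
  norm_smul_le c v := (𝓜.fiberNorm_smul A (zero_lt_one.trans (Fact.out : 1 < p)).ne' c v.2).le

/-- The fibre at `x`: the (Hausdorff) completion of the span of `M_x` for the seminorm `‖·‖_x`,
that is, the completion of its quotient by the null vectors. -/
abbrev Fiber (x : X) : Type _ := UniformSpace.Completion (𝓜.PreFiber A x)

open Classical in
/-- The section `Rep(v)`: the image of `v` in the fibre at `x` if `v ∈ M_x`, and `0` otherwise. -/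
noncomputable def repSection (v : M) (x : X) : 𝓜.Fiber A x :=
  if h : v ∈ 𝓜.lebSet A x then
    UniformSpace.Completion.coe' (α := 𝓜.PreFiber A x) ⟨v, Submodule.subset_span h⟩
  else 0

end LpNormedModule

section Pullback
variable {Y : Type*} [MeasurableSpace Y] {μY : Measure Y} {q : ℝ≥0∞}
  {E : Type*} [AddCommGroup E] [Module ℝ E] [Module (Linf μY) E] [IsScalarTower ℝ (Linf μY) E]

/-- `(E, T)` is the pullback of the module `M` under `φ`: `T` is linear, `|T v| = |v| ∘ φ`, and the
`L^∞`-linear combinations of the `T v` are dense in `E`. -/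
structure IsPullback (φ : Y → X) {p : ℝ≥0∞} (𝓜 : LpNormedModule p μ M)
    (𝓔 : LpNormedModule p μY E) (T : M →ₗ[ℝ] E) : Prop where
  ptNorm_map : ∀ v, (𝓔.ptNorm (T v) : Y → ℝ) =ᵐ[μY] fun y => 𝓜.ptNorm v (φ y)
  generates : ∀ V : E, ∀ ε : ℝ, 0 < ε →
    ∃ W ∈ Submodule.span (Linf μY) (range T), ‖𝓔.ptNorm (V - W)‖ < ε
end Pullback

/-- The module dual: the `L^∞(μ)`-linear continuous maps from `M` to `L^1(μ)`, the latter viewed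
inside the space of all classes of measurable functions. -/
def LpNormedModule.Dual {p : ℝ≥0∞} (𝓜 : LpNormedModule p μ M) :
    Submodule (Linf μ) (M →ₗ[Linf μ] (X →ₘ[μ] ℝ)) where
  carrier := {L | ∃ C : ℝ, 0 ≤ C ∧ ∀ v, eLpNorm (L v) 1 μ ≤ ENNReal.ofReal (C * ‖𝓜.ptNorm v‖)}
  zero_mem' := ⟨0, le_rfl, fun v => by
    have h : eLpNorm ((0 : M →ₗ[Linf μ] (X →ₘ[μ] ℝ)) v) 1 μ = 0 :=
      (eLpNorm_congr_ae AEEqFun.coeFn_zero).trans (eLpNorm_zero)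
    rw [h]; exact zero_le⟩
  add_mem' := by
    rintro L K ⟨C, hC, hL⟩ ⟨D, hD, hK⟩
    refine ⟨C + D, by positivity, fun v => ?_⟩
    calc eLpNorm ((L + K) v) 1 μ = eLpNorm (⇑(L v) + ⇑(K v)) 1 μ :=
          eLpNorm_congr_ae (AEEqFun.coeFn_add _ _)
      _ ≤ eLpNorm (L v) 1 μ + eLpNorm (K v) 1 μ :=
          eLpNorm_add_le (L v).aestronglyMeasurable (K v).aestronglyMeasurable le_rfl
      _ ≤ ENNReal.ofReal (C * ‖𝓜.ptNorm v‖) + ENNReal.ofReal (D * ‖𝓜.ptNorm v‖) :=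
          add_le_add (hL v) (hK v)
      _ = ENNReal.ofReal ((C + D) * ‖𝓜.ptNorm v‖) := by
          rw [← ENNReal.ofReal_add (mul_nonneg hC (show 0 ≤ ‖𝓜.ptNorm v‖ from ENNReal.toReal_nonneg))
            (mul_nonneg hD (show 0 ≤ ‖𝓜.ptNorm v‖ from ENNReal.toReal_nonneg)), add_mul]
  smul_mem' := by
    rintro f L ⟨C, hC, hL⟩
    refine ⟨(eLpNorm (f : X →ₘ[μ] ℝ) ∞ μ).toReal * C, by positivity, fun v => ?_⟩
    have hf : eLpNorm (f : X →ₘ[μ] ℝ) ∞ μ ≠ ∞ := ne_of_lt f.2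
    calc eLpNorm ((f • L) v) 1 μ = eLpNorm (⇑(f : X →ₘ[μ] ℝ) • ⇑(L v)) 1 μ :=
          eLpNorm_congr_ae (AEEqFun.coeFn_mul _ _)
      _ ≤ eLpNorm (f : X →ₘ[μ] ℝ) ∞ μ * eLpNorm (L v) 1 μ :=
          eLpNorm_smul_le_mul_eLpNorm (L v).aestronglyMeasurable
            (f : X →ₘ[μ] ℝ).aestronglyMeasurable
      _ ≤ eLpNorm (f : X →ₘ[μ] ℝ) ∞ μ * ENNReal.ofReal (C * ‖𝓜.ptNorm v‖) := by
          gcongr; exact hL v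
      _ = _ := by
          rw [mul_assoc, ENNReal.ofReal_mul ENNReal.toReal_nonneg, ENNReal.ofReal_toReal hf]

/-- The pointwise norm of `L` in the dual: the essential supremum of the `L v` with `|v| ≤ 1`.
The family contains `0`, so passing to positive parts changes nothing. -/
noncomputable def LpNormedModule.dualPtNorm {p : ℝ≥0∞} [SFinite μ] (𝓜 : LpNormedModule p μ M)
    (L : 𝓜.Dual) : X → ℝ≥0∞ :=
  familyEssSup μ {g | ∃ v : M, (∀ᵐ x ∂μ, 𝓜.ptNorm v x ≤ 1) ∧
    g = fun x => ENNReal.ofReal ((L : M →ₗ[Linf μ] (X →ₘ[μ] ℝ)) v x)}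

/-- The operator norm of `L : M → L^1(μ)`. -/
noncomputable def LpNormedModule.dualOpNorm {p : ℝ≥0∞} (𝓜 : LpNormedModule p μ M)
    (L : 𝓜.Dual) : ℝ :=
  sInf {C : ℝ | 0 ≤ C ∧ ∀ v, eLpNorm ((L : M →ₗ[Linf μ] (X →ₘ[μ] ℝ)) v) 1 μ ≤
    ENNReal.ofReal (C * ‖𝓜.ptNorm v‖)}
end Modules

section WeakBundle
/-- The sections of the collection of the topological duals of the spaces `V y`. -/
def DualSection {Y : Type*} (V : Y → Type*) [∀ y, NormedAddCommGroup (V y)]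
    [∀ y, NormedSpace ℝ (V y)] : Type _ := ∀ y, StrongDual ℝ (V y)

variable {Y : Type*} {V : Y → Type*} [∀ y, NormedAddCommGroup (V y)] [∀ y, NormedSpace ℝ (V y)]

noncomputable instance : AddCommGroup (DualSection V) :=
  inferInstanceAs (AddCommGroup (∀ y, StrongDual ℝ (V y)))

noncomputable instance : Module ℝ (DualSection V) :=
  inferInstanceAs (Module ℝ (∀ y, StrongDual ℝ (V y)))

@[simp] theorem DualSection.zero_apply (y : Y) (v : V y) : (0 : DualSection V) y v = 0 := rfl

@[simp] theorem DualSection.add_apply (w₁ w₂ : DualSection V) (y : Y) :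
    (w₁ + w₂) y = w₁ y + w₂ y := rfl

@[simp] theorem DualSection.sub_apply (w₁ w₂ : DualSection V) (y : Y) :
    (w₁ - w₂) y = w₁ y - w₂ y := rfl

@[simp] theorem DualSection.smul_apply (c : ℝ) (w : DualSection V) (y : Y) :
    (c • w) y = c • w y := rfl

variable [MeasurableSpace Y] (μ : Measure Y) (Test : Set (∀ y, V y))

/-- The collection `V` with the test vectors `Test` is a weak Banach bundle for the ideal of
`μ`-null measurable sets. -/
structure IsWeakBanachBundle : Prop where
  complete : ∀ y, CompleteSpace (V y)
  combination : ∀ v₁ ∈ Test, ∀ v₂ ∈ Test, ∀ α₁ α₂ : ℝ, ∃ v ∈ Test,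
    ∀ᵐ y ∂μ, α₁ • v₁ y + α₂ • v₂ y = v y

/-- Weak measurability: `⟨w, v⟩` is measurable off a measurable null set, for each test vector `v`. -/
def IsWeaklyMeasurable (w : DualSection V) : Prop :=
  ∀ v ∈ Test, AEMeasurable (fun y => w y (v y)) μ

/-- The finite combinations of test vectors with measurable functions as coefficients. -/
def testSpan : Set (∀ y, V y) :=
  {v | ∃ (n : ℕ) (f : Fin n → Y → ℝ) (u : Fin n → ∀ y, V y),
    (∀ i, Measurable (f i)) ∧ (∀ i, u i ∈ Test) ∧ v = fun y => ∑ i, f i y • u i y}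

/-- The pointwise norm `|w|`: the essential supremum of `⟨w, v⟩` over the combinations `v` of test
vectors with `‖v y‖ ≤ 1`. The family contains `0`, so passing to positive parts changes nothing. -/
noncomputable def weakPtNorm [SFinite μ] (w : DualSection V) : Y → ℝ≥0∞ :=
  familyEssSup μ {g | ∃ v ∈ testSpan Test, (∀ y, ‖v y‖ ≤ 1) ∧
    g = fun y => ENNReal.ofReal (w y (v y))}

variable {μ Test}

theorem smul_mem_testSpan {v : ∀ y, V y} (hv : v ∈ testSpan Test) {s : Y → ℝ}
    (hs : Measurable s) : (fun y => s y • v y) ∈ testSpan Test := by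
  obtain ⟨n, f, u, hf, hu, rfl⟩ := hv
  exact ⟨n, fun i y => s y * f i y, u, fun i => hs.mul (hf i), hu, by
    funext y; simp [Finset.smul_sum, mul_smul]⟩

theorem weakPtNorm_add_le [SFinite μ] (w₁ w₂ : DualSection V) :
    weakPtNorm μ Test (w₁ + w₂) ≤ᵐ[μ] weakPtNorm μ Test w₁ + weakPtNorm μ Test w₂ := by
  have h₁ := isEssSup_familyEssSup μ {g | ∃ v ∈ testSpan Test, (∀ y, ‖v y‖ ≤ 1) ∧
    g = fun y => ENNReal.ofReal (w₁ y (v y))}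
  have h₂ := isEssSup_familyEssSup μ {g | ∃ v ∈ testSpan Test, (∀ y, ‖v y‖ ≤ 1) ∧
    g = fun y => ENNReal.ofReal (w₂ y (v y))}
  refine (isEssSup_familyEssSup μ _).least _ (h₁.measurable.add h₂.measurable) ?_
  rintro _ ⟨v, hv, hv1, rfl⟩
  filter_upwards [h₁.le _ ⟨v, hv, hv1, rfl⟩, h₂.le _ ⟨v, hv, hv1, rfl⟩] with y h3 h4
  exact ENNReal.ofReal_add_le.trans (add_le_add h3 h4)

theorem weakPtNorm_smul_le [SFinite μ] (w : DualSection V) {g : Y → ℝ}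
    (hg : Measurable g) {C : ℝ≥0} (hC : 0 < C) (hgC : ∀ᵐ y ∂μ, |g y| ≤ C) :
    weakPtNorm μ Test (fun y => g y • w y) ≤ᵐ[μ] fun y => C * weakPtNorm μ Test w y := by
  have h := isEssSup_familyEssSup μ {g | ∃ v ∈ testSpan Test, (∀ y, ‖v y‖ ≤ 1) ∧
    g = fun y => ENNReal.ofReal (w y (v y))}
  refine (isEssSup_familyEssSup μ _).least _ (h.measurable.const_mul _) ?_
  rintro _ ⟨v, hv, hv1, rfl⟩
  have hs : Measurable fun y => max (-1) (min 1 (g y / C)) := by fun_prop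
  have h1 := h.le _ ⟨_, smul_mem_testSpan hv hs, fun y => ?_, rfl⟩
  · filter_upwards [h1, hgC] with y h2 h3
    have hC' : (0 : ℝ) < C := hC
    have h4 : max (-1) (min 1 (g y / C)) = g y / C := by
      rw [abs_le] at h3
      rw [min_eq_right ((div_le_one hC').2 h3.2), max_eq_right]
      rw [le_div_iff₀ hC']; linarith
    rw [h4] at h2
    have h5 : (g y • w y) (v y) = C * (w y ((g y / C) • v y)) := by
      simp only [smul_apply, map_smul, smul_eq_mul]; field_simp
    simp only [h5]
    rw [ENNReal.ofReal_mul hC'.le, ENNReal.ofReal_coe_nnreal]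
    gcongr
    exact h2
  · have : ‖max (-1) (min 1 (g y / C))‖ ≤ 1 := by
      rw [Real.norm_eq_abs, abs_le]; exact ⟨le_max_left _ _, max_le (by norm_num) (min_le_left _ _)⟩
    rw [norm_smul]
    exact mul_le_one₀ this (norm_nonneg _) (hv1 y)

theorem weakPtNorm_memLp_smul [SFinite μ] {q : ℝ≥0∞} {w : DualSection V}
    (hw : MemLp (weakPtNorm μ Test w) q μ) {g : Y → ℝ}
    (hg : Measurable g) {C : ℝ≥0} (hC : 0 < C) (hgC : ∀ᵐ y ∂μ, |g y| ≤ C) :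
    MemLp (weakPtNorm μ Test fun y => g y • w y) q μ :=
  hw.of_enorm_le_mul (isEssSup_familyEssSup μ _).measurable.aestronglyMeasurable (c := C)
    (weakPtNorm_smul_le w hg hC hgC)

variable (μ Test)

/-- The weakly measurable sections `w` with `|w| ∈ L^q(μ)`. -/
def weakLpSections [SFinite μ] (q : ℝ≥0∞) : Submodule ℝ (DualSection V) where
  carrier := {w | IsWeaklyMeasurable μ Test w ∧ MemLp (weakPtNorm μ Test w) q μ}
  zero_mem' := by
    refine ⟨fun v _ => by simp, ?_⟩
    have h : weakPtNorm μ Test (0 : DualSection V) ≤ᵐ[μ] fun _ => 0 := by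
      refine (isEssSup_familyEssSup μ _).least _ measurable_const ?_
      rintro _ ⟨v, -, -, rfl⟩
      exact Eventually.of_forall fun y => by simp
    exact (MemLp.zero (ε := ℝ≥0∞)).of_le_enorm
      (isEssSup_familyEssSup μ _).measurable.aestronglyMeasurable h
  add_mem' := fun {w₁ w₂} h₁ h₂ =>
    ⟨fun v hv => (h₁.1 v hv).add (h₂.1 v hv), (h₁.2.add h₂.2).of_le_enorm
      (isEssSup_familyEssSup μ _).measurable.aestronglyMeasurable (weakPtNorm_add_le w₁ w₂)⟩
  smul_mem' := fun c w h =>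
    ⟨fun v hv => (h.1 v hv).const_mul c, weakPtNorm_memLp_smul h.2 (g := fun _ => c)
      measurable_const (C := ‖c‖₊ + 1) (by positivity) (Eventually.of_forall fun y => by simp)⟩

/-- The sections equivalent to `0`: those with `⟨w, v⟩ = 0` a.e. for each test vector `v`. -/
def weakNull [SFinite μ] (q : ℝ≥0∞) : Submodule ℝ (weakLpSections μ Test q) where
  carrier := {w | ∀ v ∈ Test, ∀ᵐ y ∂μ, w.1 y (v y) = 0}
  zero_mem' := fun v _ => Eventually.of_forall fun y => by simp
  add_mem' := fun {w₁ w₂} h₁ h₂ v hv => by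
    filter_upwards [h₁ v hv, h₂ v hv] with y h3 h4
    simp [h3, h4]
  smul_mem' := fun c w h v hv => by
    filter_upwards [h v hv] with y h3
    simp [h3]

/-- The space `L^q_weak` of classes of weakly measurable, `L^q`-integrable sections. -/
abbrev WeakLp [SFinite μ] (q : ℝ≥0∞) : Type _ := weakLpSections μ Test q ⧸ weakNull μ Test q

theorem Linf_bound (f : Linf μ) : ∃ C : ℝ≥0, 0 < C ∧ ∀ᵐ y ∂μ, |(f : Y →ₘ[μ] ℝ) y| ≤ C := by
  refine ⟨(eLpNormEssSup (f : Y →ₘ[μ] ℝ) μ).toNNReal + 1, by positivity, ?_⟩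
  have hf : eLpNormEssSup (f : Y →ₘ[μ] ℝ) μ ≠ ∞ := by
    have := f.2; exact ne_of_lt (by simpa [Linf, eLpNorm_exponent_top] using this)
  filter_upwards [enorm_ae_le_eLpNormEssSup (f : Y →ₘ[μ] ℝ) μ] with y hy
  rw [← ENNReal.coe_toNNReal hf, enorm_eq_nnnorm, ENNReal.coe_le_coe] at hy
  have : (‖(f : Y →ₘ[μ] ℝ) y‖₊ : ℝ) ≤ (eLpNormEssSup (f : Y →ₘ[μ] ℝ) μ).toNNReal := hy
  rw [coe_nnnorm, Real.norm_eq_abs] at this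
  exact this.trans (by simp)

variable [SFinite μ] (q : ℝ≥0∞)

/-- The pointwise product of a section with a function in `L^∞`. -/
noncomputable def weakMul (f : Linf μ) : weakLpSections μ Test q →ₗ[ℝ] weakLpSections μ Test q where
  toFun w := ⟨fun y => (f : Y →ₘ[μ] ℝ) y • w.1 y,
    fun v hv => (f : Y →ₘ[μ] ℝ).measurable.aemeasurable.mul (w.2.1 v hv), by
      obtain ⟨C, hC, h⟩ := Linf_bound μ f
      exact weakPtNorm_memLp_smul w.2.2 (f : Y →ₘ[μ] ℝ).measurable hC h⟩
  map_add' w₁ w₂ := Subtype.ext (funext fun y => smul_add _ (w₁.1 y) (w₂.1 y))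
  map_smul' c w := Subtype.ext (funext fun y => smul_comm _ c (w.1 y))

theorem weakNull_le_comap (f : Linf μ) :
    weakNull μ Test q ≤ (weakNull μ Test q).comap (weakMul μ Test q f) := fun w hw v hv => by
  filter_upwards [hw v hv] with y hy
  simp [weakMul, hy]

noncomputable instance : SMul (Linf μ) (WeakLp μ Test q) :=
  ⟨fun f => Submodule.mapQ _ _ (weakMul μ Test q f) (weakNull_le_comap μ Test q f)⟩

variable {μ Test q}

theorem smul_mk (f : Linf μ) (w : weakLpSections μ Test q) :
    f • (Submodule.Quotient.mk w : WeakLp μ Test q) =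
      Submodule.Quotient.mk (weakMul μ Test q f w) := rfl

theorem mk_eq_mk {w₁ w₂ : weakLpSections μ Test q}
    (h : ∀ᵐ y ∂μ, w₁.1 y = w₂.1 y) :
    (Submodule.Quotient.mk w₁ : WeakLp μ Test q) = Submodule.Quotient.mk w₂ := by
  rw [Submodule.Quotient.eq]
  intro v hv
  filter_upwards [h] with y hy
  simp [hy]

noncomputable instance : Module (Linf μ) (WeakLp μ Test q) where
  one_smul := by
    rintro ⟨w⟩
    refine mk_eq_mk ?_
    filter_upwards [AEEqFun.coeFn_one (α := Y) (β := ℝ) (μ := μ)] with y hy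
    simp [weakMul, hy]
  mul_smul := by
    rintro f g ⟨w⟩
    refine mk_eq_mk ?_
    filter_upwards [AEEqFun.coeFn_mul (f : Y →ₘ[μ] ℝ) (g : Y →ₘ[μ] ℝ)] with y hy
    simp [weakMul, hy, mul_smul]
  smul_zero f := map_zero (Submodule.mapQ _ _ (weakMul μ Test q f) (weakNull_le_comap μ Test q f))
  smul_add f := map_add (Submodule.mapQ _ _ (weakMul μ Test q f) (weakNull_le_comap μ Test q f))
  add_smul := by
    rintro f g ⟨w⟩
    refine mk_eq_mk (w₂ := weakMul μ Test q f w + weakMul μ Test q g w) ?_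
    filter_upwards [AEEqFun.coeFn_add (f : Y →ₘ[μ] ℝ) (g : Y →ₘ[μ] ℝ)] with y hy
    simp [weakMul, hy, add_smul]
    rfl
  zero_smul := by
    rintro ⟨w⟩
    refine mk_eq_mk (w₂ := 0) ?_
    filter_upwards [AEEqFun.coeFn_zero (α := Y) (β := ℝ) (μ := μ)] with y hy
    simp [weakMul, hy]
    rfl

instance : IsScalarTower ℝ (Linf μ) (WeakLp μ Test q) where
  smul_assoc := by
    rintro c f ⟨w⟩
    refine mk_eq_mk (w₂ := c • weakMul μ Test q f w) ?_
    filter_upwards [AEEqFun.coeFn_smul c (f : Y →ₘ[μ] ℝ)] with y hy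
    simp [weakMul, hy, mul_smul]
    rfl
end WeakBundle

section PullbackBundle
variable {X : Type*} [MeasurableSpace X] {μ : Measure X} {M : Type*} [AddCommGroup M] [Module ℝ M]
  [Module (Linf μ) M] [IsScalarTower ℝ (Linf μ) M] {p : ℝ} [Fact (1 < p)] {Y : Type*}

/-- The test vectors `Rep(v) ∘ φ`, for `v` in `M`, of the bundle with fibre at `φ y` over `y`. -/
def pullbackTest (𝓜 : LpNormedModule (ENNReal.ofReal p) μ M) (A : ℕ → Set X) (φ : Y → X) :
    Set (∀ y, 𝓜.Fiber A (φ y)) :=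
  range fun v : M => fun y => 𝓜.repSection A v (φ y)
end PullbackBundle

end NormedModules
open NormedModules

/-!
The isomorphism sends a section `w` to the functional determined by `T v ↦ ⟨w, Rep(v) ∘ φ⟩`.

*From sections to functionals.* On `M_x` the seminorm of the fibre is attained by the trivial
decomposition, because Minkowski's inequality holds for the `L^p`-means over each cell
(`fiberNorm_eq_repNorm`). With the differentiation theorem along the cells
(`ae_tendsto_cellAverage`, an instance of Lévy's upward theorem) this gives `‖Rep(v)(x)‖ = |v|(x)`
almost everywhere, so that the pointwise norm of `∑ fᵢ T uᵢ` is the fibre norm of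
`∑ fᵢ Rep(uᵢ) ∘ φ` (`ae_norm_sum_repSection`). Hence the pairing with `w` is bounded by `|w|` times
the pointwise norm on the span of the image of `T`, and extends to the pullback by density
(`exists_dual_of_section`). The two pointwise norms dominate each other.

*From functionals to sections.* Since `M` need not be separable, the functionals on the fibres have
to be found for all `v` at once, off one null set. In the case `φ = id`, an operator `Γ` from `M` to
functions with `|Γ v| ≤ C |v|` is represented at every `x` by the limit of the means of `Γ v` over
the cells of `x`: this limit is linear in `v` and bounded by `C` times the seminorm of the fibre
where it exists, and extends by the Hahn–Banach theorem (`exists_fiber_functional`). In general,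
let `ℱ m` be generated by `φ` and the first `m` sets of a dense sequence in `Y`. On each cell of
these sets, the conditional expectation of `L (T v)` given `ℱ m` is a function of `φ`, hence comes
from an operator `Γ` on `M` as before, bounded by the conditional expectation of `|L|`
(`exists_linear_descent`). As `m → ∞` the conditional expectations converge almost everywhere, to
`L (T v)` and to `|L|`; a limit of the bounded functionals so obtained, again by the Hahn–Banach
theorem, is the section (`exists_section_of_dual`).

The dual of a normed module is normed by the essential supremum `|L|`: this is the limit of an
increasing sequence of functions `L V` with `|V| ≤ 1`, and testing the operator bound on
`(L V)^{q-1} V` shows that its `L^q`-norm is the operator norm (`eLpNorm_dualPtNorm_le`). The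
structure of `L^q_weak` is transported from it.
-/

namespace NormedModules

/-! ### Pointwise norms of modules -/

section Basics
variable {Y : Type*} [MeasurableSpace Y] {μ : Measure Y}

theorem exists_linf_ae_eq {g : Y → ℝ} (hg : AEStronglyMeasurable g μ) (C : ℝ)
    (hC : ∀ᵐ y ∂μ, |g y| ≤ C) : ∃ f : Linf μ, ((f : Y →ₘ[μ] ℝ) : Y → ℝ) =ᵐ[μ] g :=
  ⟨⟨AEEqFun.mk g hg, (eLpNorm_congr_ae (AEEqFun.coeFn_mk g hg)).trans_lt
    (memLp_top_of_bound hg C hC).2⟩, AEEqFun.coeFn_mk g hg⟩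

theorem exists_linf_indicator {B : Set Y} (hB : MeasurableSet B) :
    ∃ f : Linf μ, ((f : Y →ₘ[μ] ℝ) : Y → ℝ) =ᵐ[μ] B.indicator 1 :=
  exists_linf_ae_eq (stronglyMeasurable_one.indicator hB).aestronglyMeasurable 1
    (Eventually.of_forall fun y => by by_cases h : y ∈ B <;> simp [h])

theorem Linf.coeFn_smul (f : Linf μ) (g : Y →ₘ[μ] ℝ) :
    ((f • g : Y →ₘ[μ] ℝ) : Y → ℝ) =ᵐ[μ] fun y => (f : Y →ₘ[μ] ℝ) y * g y :=
  AEEqFun.coeFn_mul _ _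

variable {E : Type*} [AddCommGroup E] [Module ℝ E] [Module (Linf μ) E] [IsScalarTower ℝ (Linf μ) E]

namespace LpNormedModule
variable {p : ℝ≥0∞} (𝓔 : LpNormedModule p μ E)

theorem ptNorm_nonneg_ae (v : E) : ∀ᵐ y ∂μ, 0 ≤ 𝓔.ptNorm v y := by
  filter_upwards [(Lp.coeFn_le _ _).2 (𝓔.ptNorm_nonneg v), Lp.coeFn_zero ℝ p μ] with z h2 h3
  rwa [h3] at h2

theorem ptNorm_smul_ae (f : Linf μ) (v : E) :
    (𝓔.ptNorm (f • v) : Y → ℝ) =ᵐ[μ] fun y => |(f : Y →ₘ[μ] ℝ) y| * 𝓔.ptNorm v y := by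
  rw [𝓔.ptNorm_smul]
  filter_upwards [AEEqFun.coeFn_mul |(f : Y →ₘ[μ] ℝ)| (𝓔.ptNorm v : Y →ₘ[μ] ℝ),
    AEEqFun.coeFn_abs (f : Y →ₘ[μ] ℝ)] with y h1 h2
  rw [h1, Pi.mul_apply, h2]

theorem norm_ptNorm (v : E) : ‖𝓔.ptNorm v‖ = (eLpNorm (𝓔.ptNorm v) p μ).toReal := Lp.norm_def _

theorem ofReal_norm_ptNorm (v : E) : ENNReal.ofReal ‖𝓔.ptNorm v‖ = eLpNorm (𝓔.ptNorm v) p μ := by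
  rw [norm_ptNorm, ENNReal.ofReal_toReal (Lp.memLp _).2.ne]

theorem norm_ptNorm_real_smul (c : ℝ) (v : E) : ‖𝓔.ptNorm (c • v)‖ = |c| * ‖𝓔.ptNorm v‖ := by
  have h := 𝓔.ptNorm_real_smul c v
  rw [norm_ptNorm, norm_ptNorm, eLpNorm_congr_ae h]
  have : (fun z => |c| * 𝓔.ptNorm v z) = |c| • (𝓔.ptNorm v : Y → ℝ) := rfl
  rw [this, eLpNorm_const_smul, ENNReal.toReal_mul]
  simp

/-- The localized triangle inequality `‖1_B (v + w)‖ ≤ ‖1_B v‖ + ‖1_B w‖`. -/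
theorem eLpNorm_indicator_add_le {B : Set Y} (hB : MeasurableSet B) (v w : E) :
    eLpNorm (B.indicator (𝓔.ptNorm (v + w))) p μ ≤
      eLpNorm (B.indicator (𝓔.ptNorm v)) p μ + eLpNorm (B.indicator (𝓔.ptNorm w)) p μ := by
  obtain ⟨χ, hχ⟩ := exists_linf_indicator (μ := μ) hB
  have key : ∀ u : E, eLpNorm (B.indicator (𝓔.ptNorm u)) p μ =
      ENNReal.ofReal ‖𝓔.ptNorm (χ • u)‖ := fun u => by
    rw [ofReal_norm_ptNorm]
    refine eLpNorm_congr_ae ?_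
    filter_upwards [𝓔.ptNorm_smul_ae χ u, hχ] with y h1 h2
    rw [h1, h2]
    by_cases h : y ∈ B <;> simp [h]
  rw [key, key, key, smul_add, ← ENNReal.ofReal_add (by exact ENNReal.toReal_nonneg)
    (by exact ENNReal.toReal_nonneg)]
  exact ENNReal.ofReal_le_ofReal (𝓔.norm_add_le _ _)

/-- The pointwise triangle inequality. If it failed, there would be a set of positive finite
measure on which `|v| ≤ a`, `|w| ≤ b` and `|v + w| ≥ c > a + b`, against the triangle inequality
for the norms of the restrictions to that set. -/
theorem ptNorm_add_le_ae [SigmaFinite μ] (hp0 : p ≠ 0) (hp : p ≠ ∞) (v w : E) :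
    ∀ᵐ y ∂μ, 𝓔.ptNorm (v + w) y ≤ 𝓔.ptNorm v y + 𝓔.ptNorm w y := by
  have hm : ∀ u : E, Measurable (𝓔.ptNorm u) := fun u => (Lp.stronglyMeasurable _).measurable
  have key : ∀ a b c : ℚ, 0 ≤ a → 0 ≤ b → a + b < c →
      ∀ᵐ y ∂μ, ¬ (𝓔.ptNorm v y ≤ a ∧ 𝓔.ptNorm w y ≤ b ∧ (c : ℝ) ≤ 𝓔.ptNorm (v + w) y) := by
    intro a b c ha hb hc
    rw [ae_iff]
    simp only [not_not]
    by_contra hne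
    have hms : MeasurableSet {y | 𝓔.ptNorm v y ≤ a ∧ 𝓔.ptNorm w y ≤ b ∧
        (c : ℝ) ≤ 𝓔.ptNorm (v + w) y} :=
      (measurableSet_le (hm v) measurable_const).inter ((measurableSet_le (hm w)
        measurable_const).inter (measurableSet_le measurable_const (hm _)))
    obtain ⟨B, hB, hBs, hB0, hBt⟩ := Measure.exists_subset_measure_lt_top hms (pos_iff_ne_zero.2 hne)
    have hle : ∀ (u : E) (d : ℚ), 0 ≤ d → (∀ y ∈ B, 𝓔.ptNorm u y ≤ d) →
        eLpNorm (B.indicator (𝓔.ptNorm u)) p μ ≤ ENNReal.ofReal d * μ B ^ (1 / p.toReal) := by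
      intro u d hd hu
      have e : ENNReal.ofReal d = ‖(d : ℝ)‖ₑ := by
        rw [Real.enorm_eq_ofReal (by exact_mod_cast hd)]
      rw [e, ← eLpNorm_indicator_const hB hp0 hp]
      refine eLpNorm_mono_ae ?_
      filter_upwards [𝓔.ptNorm_nonneg_ae u] with y hy
      by_cases h : y ∈ B
      · simp only [indicator_of_mem h, Real.norm_eq_abs]
        exact abs_le_abs_of_nonneg hy (hu y h)
      · simp [h]
    have hge : ENNReal.ofReal c * μ B ^ (1 / p.toReal) ≤
        eLpNorm (B.indicator (𝓔.ptNorm (v + w))) p μ := by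
      have hc0 : (0 : ℚ) ≤ c := by linarith
      have e : ENNReal.ofReal c = ‖(c : ℝ)‖ₑ := by
        rw [Real.enorm_eq_ofReal (by exact_mod_cast hc0)]
      rw [e, ← eLpNorm_indicator_const hB hp0 hp]
      refine eLpNorm_mono fun y => ?_
      by_cases h : y ∈ B
      · simp only [indicator_of_mem h, Real.norm_eq_abs]
        exact abs_le_abs_of_nonneg (by exact_mod_cast hc0) (hBs h).2.2
      · simp [h]
    have h1 := (hge.trans (𝓔.eLpNorm_indicator_add_le hB v w)).trans
      (add_le_add (hle v a ha fun y hy => (hBs hy).1) (hle w b hb fun y hy => (hBs hy).2.1))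
    rw [← add_mul, ← ENNReal.ofReal_add (by exact_mod_cast ha) (by exact_mod_cast hb)] at h1
    have hpos : μ B ^ (1 / p.toReal) ≠ 0 := by
      simp only [ne_eq, ENNReal.rpow_eq_zero_iff, not_or, not_and]
      exact ⟨fun h => absurd h hB0.ne', fun h => absurd h hBt.ne⟩
    have htop : μ B ^ (1 / p.toReal) ≠ ∞ := ENNReal.rpow_ne_top_of_nonneg (by positivity) hBt.ne
    rw [ENNReal.mul_le_mul_iff_left hpos htop, ENNReal.ofReal_le_ofReal_iff (by positivity)] at h1
    have : c ≤ a + b := by exact_mod_cast h1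
    linarith
  have hall : ∀ᵐ y ∂μ, ∀ a b c : ℚ, 0 ≤ a → 0 ≤ b → a + b < c →
      ¬ (𝓔.ptNorm v y ≤ a ∧ 𝓔.ptNorm w y ≤ b ∧ (c : ℝ) ≤ 𝓔.ptNorm (v + w) y) := by
    simpa only [ae_all_iff] using key
  filter_upwards [hall, 𝓔.ptNorm_nonneg_ae v, 𝓔.ptNorm_nonneg_ae w] with y hy hv hw
  by_contra! hlt
  set δ := 𝓔.ptNorm (v + w) y - (𝓔.ptNorm v y + 𝓔.ptNorm w y) with hδ
  obtain ⟨a, ha1, ha2⟩ := exists_rat_btwn (show 𝓔.ptNorm v y < 𝓔.ptNorm v y + δ / 3 by linarith)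
  obtain ⟨b, hb1, hb2⟩ := exists_rat_btwn (show 𝓔.ptNorm w y < 𝓔.ptNorm w y + δ / 3 by linarith)
  obtain ⟨c, hc1, hc2⟩ := exists_rat_btwn (show (a : ℝ) + b < 𝓔.ptNorm (v + w) y by linarith)
  refine hy a b c ?_ ?_ (by exact_mod_cast hc1) ⟨ha1.le, hb1.le, hc2.le⟩
  · exact_mod_cast (hv.trans ha1.le)
  · exact_mod_cast (hw.trans hb1.le)

theorem ptNorm_zero_ae : ∀ᵐ y ∂μ, 𝓔.ptNorm (0 : E) y = 0 := by
  filter_upwards [𝓔.ptNorm_real_smul 0 (0 : E)] with y h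
  simpa using h

theorem ptNorm_neg_ae (v : E) : ∀ᵐ y ∂μ, 𝓔.ptNorm (-v) y = 𝓔.ptNorm v y := by
  filter_upwards [𝓔.ptNorm_real_smul (-1) v] with y h
  simpa using h

theorem abs_ptNorm_sub_le_ae [SigmaFinite μ] (hp0 : p ≠ 0) (hp : p ≠ ∞) (v w : E) :
    ∀ᵐ y ∂μ, |𝓔.ptNorm v y - 𝓔.ptNorm w y| ≤ 𝓔.ptNorm (v - w) y := by
  have h1 := 𝓔.ptNorm_add_le_ae hp0 hp (v - w) w
  have h2 := 𝓔.ptNorm_add_le_ae hp0 hp (w - v) v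
  have h3 := 𝓔.ptNorm_neg_ae (v - w)
  rw [neg_sub] at h3
  rw [sub_add_cancel] at h1 h2
  filter_upwards [h1, h2, h3] with y h1 h2 h3
  rw [abs_le]; constructor <;> linarith

theorem ptNorm_sum_le_ae [SigmaFinite μ] (hp0 : p ≠ 0) (hp : p ≠ ∞) {ι : Type*} (s : Finset ι)
    (u : ι → E) : ∀ᵐ y ∂μ, 𝓔.ptNorm (∑ i ∈ s, u i) y ≤ ∑ i ∈ s, 𝓔.ptNorm (u i) y := by
  classical
  induction s using Finset.induction_on with
  | empty => filter_upwards [𝓔.ptNorm_zero_ae] with y h; simp [h]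
  | insert i s hi ih =>
    filter_upwards [ih, 𝓔.ptNorm_add_le_ae hp0 hp (u i) (∑ j ∈ s, u j)] with y h1 h2
    rw [Finset.sum_insert hi, Finset.sum_insert hi]
    linarith

theorem norm_ptNorm_zero : ‖𝓔.ptNorm (0 : E)‖ = 0 := by
  simpa using 𝓔.norm_ptNorm_real_smul 0 (0 : E)

/-- An element vanishes where a function `f ∈ L^∞` is supported as soon as its norm does. -/
theorem smul_eq_zero_of_ae (f : Linf μ) (v : E)
    (h : ∀ᵐ y ∂μ, (f : Y →ₘ[μ] ℝ) y ≠ 0 → 𝓔.ptNorm v y = 0) : f • v = 0 := by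
  refine 𝓔.eq_zero_of_norm _ ?_
  have : (𝓔.ptNorm (f • v) : Y → ℝ) =ᵐ[μ] 0 := by
    filter_upwards [𝓔.ptNorm_smul_ae f v, h] with y h1 h2
    rw [h1]
    by_cases h3 : (f : Y →ₘ[μ] ℝ) y = 0
    · simp [h3]
    · simp [h2 h3]
  rw [norm_ptNorm, eLpNorm_congr_ae this]; simp

end LpNormedModule
end Basics

/-! ### Essential suprema of directed families -/

section EssSup
variable {Y : Type*} [MeasurableSpace Y] {μ : Measure Y}

/-- The essential supremum of a directed family is the limit of an increasing sequence of members.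
The sequence is chosen to minimize the integral of `(1 + f)⁻¹` with respect to a finite measure. -/
theorem IsEssSup.exists_seq_tendsto [SFinite μ] {F : Set (Y → ℝ≥0∞)} {g : Y → ℝ≥0∞}
    (hg : IsEssSup μ F g) (hne : F.Nonempty) (hm : ∀ f ∈ F, Measurable f)
    (hdir : ∀ f₁ ∈ F, ∀ f₂ ∈ F, ∃ f ∈ F, f₁ ≤ᵐ[μ] f ∧ f₂ ≤ᵐ[μ] f) :
    ∃ f : ℕ → Y → ℝ≥0∞, (∀ n, f n ∈ F) ∧ ∀ᵐ y ∂μ, Tendsto (fun n => f n y) atTop (𝓝 (g y)) := by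
  set ν := μ.toFinite with hν
  have hae : ae ν = ae μ := ae_toFinite
  set J : (Y → ℝ≥0∞) → ℝ≥0∞ := fun h => ∫⁻ y, (1 + h y)⁻¹ ∂ν with hJ
  have hJle : ∀ h, J h ≤ ν univ := fun h => by
    calc J h ≤ ∫⁻ _, 1 ∂ν := lintegral_mono fun y => ENNReal.inv_le_one.2 le_self_add
      _ = ν univ := by simp
  have hJanti : ∀ {h k : Y → ℝ≥0∞}, h ≤ᵐ[μ] k → J k ≤ J h := fun {h k} hk => by
    refine lintegral_mono_ae ?_
    rw [hae]
    filter_upwards [hk] with y hy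
    exact ENNReal.inv_le_inv.2 (by gcongr)
  obtain ⟨u, -, hu, huF⟩ := exists_seq_tendsto_sInf (hne.image J) (OrderBot.bddBelow _)
  choose v hvF hvu using huF
  choose! D hDF hD1 hD2 using hdir
  set f : ℕ → Y → ℝ≥0∞ := fun n => Nat.rec (v 0) (fun n w => D w (v (n + 1))) n with hf
  have hfF : ∀ n, f n ∈ F := fun n => by
    induction n with
    | zero => exact hvF 0
    | succ n ih => exact hDF _ ih _ (hvF _)
  have hmono : ∀ n, f n ≤ᵐ[μ] f (n + 1) := fun n => hD1 _ (hfF n) _ (hvF _)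
  have hvf : ∀ n, v n ≤ᵐ[μ] f n := fun n => by
    cases n with
    | zero => exact Eventually.of_forall fun y => le_rfl
    | succ n => exact hD2 _ (hfF n) _ (hvF _)
  have hmono' : ∀ᵐ y ∂μ, Monotone fun n => f n y := by
    filter_upwards [ae_all_iff.2 hmono] with y hy using monotone_nat_of_le_succ hy
  have hsm : Measurable fun y => ⨆ n, f n y := .iSup fun n => hm _ (hfF n)
  have key : ∀ h ∈ F, h ≤ᵐ[μ] fun y => ⨆ n, f n y := by
    intro h hh
    have hlow : sInf (J '' F) ≤ J fun y => max (h y) (⨆ n, f n y) := by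
      have e : J (fun y => max (h y) (⨆ n, f n y)) = ⨅ n, J fun y => max (h y) (f n y) := by
        rw [hJ]
        simp only
        rw [← lintegral_iInf_ae (f := fun n y => (1 + max (h y) (f n y))⁻¹)]
        · refine lintegral_congr fun y => ?_
          rw [← ENNReal.inv_iSup, ← ENNReal.add_iSup, sup_iSup]
        · exact fun n => (measurable_const.add ((hm h hh).max (hm _ (hfF n)))).inv
        · intro n
          rw [hae]
          filter_upwards [hmono n] with y hy
          exact ENNReal.inv_le_inv.2 (by gcongr)
        · exact ((hJle _).trans_lt (measure_lt_top _ _)).ne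
      rw [e]
      refine le_iInf fun n => (sInf_le (mem_image_of_mem J (hDF h hh _ (hfF n)))).trans
        (hJanti ?_)
      filter_upwards [hD1 h hh _ (hfF n), hD2 h hh _ (hfF n)] with y h1 h2 using max_le h1 h2
    have hup : J (fun y => ⨆ n, f n y) ≤ sInf (J '' F) := ge_of_tendsto' hu fun n => by
      rw [← hvu n]
      refine hJanti ?_
      filter_upwards [hvf n] with y hy
      exact hy.trans (le_iSup (fun n => f n y) n)
    have h1 : (fun y => (1 + max (h y) (⨆ n, f n y))⁻¹) ≤ᵐ[ν] fun y => (1 + ⨆ n, f n y)⁻¹ :=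
      Eventually.of_forall fun y => ENNReal.inv_le_inv.2 (by gcongr; exact le_max_right _ _)
    have h2 := ae_eq_of_ae_le_of_lintegral_le h1 ((hJle _).trans_lt (measure_lt_top _ _)).ne
      (measurable_const.add hsm).inv.aemeasurable (hup.trans hlow)
    rw [Filter.EventuallyEq, hae] at h2
    filter_upwards [h2] with y hy
    have h3 := (ENNReal.add_right_inj ENNReal.one_ne_top).1 (inv_injective hy)
    rw [← h3]; exact le_max_left _ _
  refine ⟨f, hfF, ?_⟩
  filter_upwards [hmono', hg.least _ hsm key, ae_all_iff.2 fun n => hg.le _ (hfF n)] with y h1 h2 h3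
  rw [le_antisymm h2 (iSup_le h3)]
  exact tendsto_atTop_iSup h1

end EssSup

/-! ### Duals of normed modules -/

section L1
variable {Y : Type*} [MeasurableSpace Y] {μ : Measure Y}

theorem eLpNorm_coe_add_le {p : ℝ≥0∞} (hp : 1 ≤ p) (a b : Y →ₘ[μ] ℝ) :
    eLpNorm ⇑(a + b) p μ ≤ eLpNorm a p μ + eLpNorm b p μ :=
  (eLpNorm_congr_ae (AEEqFun.coeFn_add a b)).trans_le
    (eLpNorm_add_le a.aestronglyMeasurable b.aestronglyMeasurable hp)

theorem eLpNorm_coe_sub_comm {p : ℝ≥0∞} (a b : Y →ₘ[μ] ℝ) :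
    eLpNorm ⇑(a - b) p μ = eLpNorm ⇑(b - a) p μ := by
  rw [eLpNorm_congr_ae (AEEqFun.coeFn_sub a b), eLpNorm_congr_ae (AEEqFun.coeFn_sub b a)]
  exact eLpNorm_sub_comm _ _ _ _

theorem eLpNorm_coe_sub_le {p : ℝ≥0∞} (hp : 1 ≤ p) (a b c : Y →ₘ[μ] ℝ) :
    eLpNorm ⇑(a - c) p μ ≤ eLpNorm ⇑(a - b) p μ + eLpNorm ⇑(b - c) p μ := by
  rw [← sub_add_sub_cancel a b c]; exact eLpNorm_coe_add_le hp _ _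

theorem eLpNorm_linf_smul_le (f : Linf μ) (a : Y →ₘ[μ] ℝ) :
    eLpNorm ⇑(f • a : Y →ₘ[μ] ℝ) 1 μ ≤ eLpNorm (f : Y →ₘ[μ] ℝ) ∞ μ * eLpNorm a 1 μ :=
  (eLpNorm_congr_ae (Linf.coeFn_smul f a)).trans_le
    (eLpNorm_smul_le_mul_eLpNorm (φ := (f : Y →ₘ[μ] ℝ)) a.aestronglyMeasurable
      (f : Y →ₘ[μ] ℝ).aestronglyMeasurable)

theorem aeEqFun_eq_of_tendsto {a b : Y →ₘ[μ] ℝ} {u : ℕ → Y →ₘ[μ] ℝ}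
    (ha : Tendsto (fun n => eLpNorm ⇑(u n - a) 1 μ) atTop (𝓝 0))
    (hb : Tendsto (fun n => eLpNorm ⇑(u n - b) 1 μ) atTop (𝓝 0)) : a = b := by
  have h0 : eLpNorm ⇑(a - b) 1 μ = 0 := by
    have h := ha.add hb
    rw [add_zero] at h
    refine le_antisymm (ge_of_tendsto' h fun n => ?_) zero_le
    rw [eLpNorm_coe_sub_comm (u n) a]
    exact eLpNorm_coe_sub_le le_rfl _ _ _
  rw [eLpNorm_eq_zero_iff (AEEqFun.aestronglyMeasurable _) one_ne_zero] at h0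
  refine sub_eq_zero.1 (AEEqFun.ext (h0.trans AEEqFun.coeFn_zero.symm))

end L1

namespace LpNormedModule
variable {Y : Type*} [MeasurableSpace Y] {μ : Measure Y} {E : Type*} [AddCommGroup E] [Module ℝ E]
  [Module (Linf μ) E] [IsScalarTower ℝ (Linf μ) E]

section Pointwise
variable {p : ℝ≥0∞} {𝓔 : LpNormedModule p μ E}

/-- The action of `L^∞` on the dual, as a shortcut for instance search. -/
noncomputable abbrev dualSMul (𝓔 : LpNormedModule p μ E) : SMul (Linf μ) 𝓔.Dual :=
  (inferInstance : Module (Linf μ) 𝓔.Dual).toSMul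

attribute [local instance] dualSMul

theorem isEssSup_dualPtNorm [SFinite μ] (L : 𝓔.Dual) :
    IsEssSup μ {g | ∃ v : E, (∀ᵐ x ∂μ, 𝓔.ptNorm v x ≤ 1) ∧
      g = fun x => ENNReal.ofReal (L.1 v x)} (𝓔.dualPtNorm L) :=
  isEssSup_familyEssSup μ _

theorem dual_smul_ae (L : 𝓔.Dual) (f : Linf μ) (V : E) :
    ∀ᵐ y ∂μ, L.1 (f • V) y = (f : Y →ₘ[μ] ℝ) y * L.1 V y := by
  rw [map_smul]; exact Linf.coeFn_smul f _

/-- The pointwise bound `|L V| ≤ |L| |V|`, obtained by normalizing `V` where `|V|` is bounded below.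
Where `|V|` vanishes, so does `L V`. -/
theorem abs_dual_apply_le [SFinite μ] (L : 𝓔.Dual) (V : E) :
    ∀ᵐ y ∂μ, ENNReal.ofReal |L.1 V y| ≤ 𝓔.dualPtNorm L y * ENNReal.ofReal (𝓔.ptNorm V y) := by
  have hn : Measurable (𝓔.ptNorm V) := (Lp.stronglyMeasurable _).measurable
  have hl : Measurable (L.1 V) := (L.1 V).measurable
  have hzero : ∀ᵐ y ∂μ, 𝓔.ptNorm V y = 0 → L.1 V y = 0 := by
    obtain ⟨χ, hχ⟩ := exists_linf_indicator (μ := μ) (hn (measurableSet_singleton (0 : ℝ)))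
    have h0 : χ • V = 0 := by
      refine 𝓔.smul_eq_zero_of_ae χ V ?_
      filter_upwards [hχ] with y hy hne
      rw [hy] at hne
      have hmem := mem_of_indicator_ne_zero hne
      exact hmem
    have h1 := dual_smul_ae L χ V
    rw [h0, map_zero] at h1
    filter_upwards [h1, hχ, AEEqFun.coeFn_zero (α := Y) (β := ℝ) (μ := μ)] with y h2 h3 h4 h5
    rw [h3, h4, indicator_of_mem (by exact h5)] at h2
    simpa using h2.symm
  have hpos : ∀ᵐ y ∂μ, ∀ j : ℕ, 1 / ((j : ℝ) + 1) < 𝓔.ptNorm V y →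
      ENNReal.ofReal (|L.1 V y| / 𝓔.ptNorm V y) ≤ 𝓔.dualPtNorm L y := by
    rw [ae_all_iff]
    intro j
    set g : Y → ℝ := fun y => if 1 / ((j : ℝ) + 1) < 𝓔.ptNorm V y then
      (if 0 ≤ L.1 V y then 1 else -1) / 𝓔.ptNorm V y else 0 with hgdef
    have hgm : Measurable g := Measurable.ite (measurableSet_lt measurable_const hn)
      ((Measurable.ite (measurableSet_le measurable_const hl) measurable_const
        measurable_const).div hn) measurable_const
    have hjpos : (0 : ℝ) < 1 / ((j : ℝ) + 1) := by positivity
    have habs : ∀ y, 1 / ((j : ℝ) + 1) < 𝓔.ptNorm V y → |g y| = 1 / 𝓔.ptNorm V y := by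
      intro y hy
      simp only [hgdef, if_pos hy, abs_div, abs_of_pos (hjpos.trans hy)]
      split_ifs <;> simp
    obtain ⟨f, hf⟩ := exists_linf_ae_eq (μ := μ) hgm.aestronglyMeasurable ((j : ℝ) + 1)
      (Eventually.of_forall fun y => by
        by_cases hy : 1 / ((j : ℝ) + 1) < 𝓔.ptNorm V y
        · rw [habs y hy, one_div_le (hjpos.trans hy) (by positivity)]
          exact hy.le
        · simp only [hgdef, if_neg hy, abs_zero]; positivity)
    have hmem := (isEssSup_dualPtNorm L).le _ ⟨f • V, ?_, rfl⟩
    · filter_upwards [hmem, dual_smul_ae L f V, hf] with y h1 h2 h3 hy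
      refine le_trans (le_of_eq ?_) h1
      rw [h2, h3]
      simp only [hgdef, if_pos hy]
      congr 1
      split_ifs with h0
      · rw [abs_of_nonneg h0]; ring
      · rw [abs_of_neg (not_le.1 h0)]; ring
    · filter_upwards [𝓔.ptNorm_smul_ae f V, hf] with y h1 h2
      rw [h1, h2]
      by_cases hy : 1 / ((j : ℝ) + 1) < 𝓔.ptNorm V y
      · rw [habs y hy, one_div_mul_cancel (hjpos.trans hy).ne']
      · simp only [hgdef, if_neg hy]; simp
  filter_upwards [hzero, hpos, 𝓔.ptNorm_nonneg_ae V] with y h1 h2 h3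
  rcases h3.eq_or_lt with h0 | h0
  · rw [h1 h0.symm]; simp
  · obtain ⟨j, hj⟩ := exists_nat_one_div_lt h0
    calc ENNReal.ofReal |L.1 V y|
        = ENNReal.ofReal (|L.1 V y| / 𝓔.ptNorm V y) * ENNReal.ofReal (𝓔.ptNorm V y) := by
          rw [← ENNReal.ofReal_mul (by positivity), div_mul_cancel₀ _ h0.ne']
      _ ≤ _ := by gcongr; exact h2 j hj

theorem dualPtNorm_le_of_forall [SFinite μ] (L : 𝓔.Dual) {h : Y → ℝ≥0∞} (hm : Measurable h)
    (hle : ∀ V : E, ∀ᵐ y ∂μ, ENNReal.ofReal |L.1 V y| ≤ h y * ENNReal.ofReal (𝓔.ptNorm V y)) :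
    𝓔.dualPtNorm L ≤ᵐ[μ] h := by
  refine (isEssSup_dualPtNorm L).least _ hm ?_
  rintro _ ⟨V, hV, rfl⟩
  filter_upwards [hV, hle V] with y h1 h2
  calc ENNReal.ofReal (L.1 V y) ≤ ENNReal.ofReal |L.1 V y| :=
        ENNReal.ofReal_le_ofReal (le_abs_self _)
    _ ≤ h y * ENNReal.ofReal (𝓔.ptNorm V y) := h2
    _ ≤ h y * 1 := by gcongr; simpa using h1
    _ = h y := mul_one _

theorem measurable_dualPtNorm [SFinite μ] (L : 𝓔.Dual) : Measurable (𝓔.dualPtNorm L) :=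
  (isEssSup_dualPtNorm L).measurable

theorem dualPtNorm_add_le [SFinite μ] (L K : 𝓔.Dual) :
    𝓔.dualPtNorm (L + K) ≤ᵐ[μ] fun y => 𝓔.dualPtNorm L y + 𝓔.dualPtNorm K y := by
  refine dualPtNorm_le_of_forall _ ((measurable_dualPtNorm L).add (measurable_dualPtNorm K))
    fun V => ?_
  filter_upwards [abs_dual_apply_le L V, abs_dual_apply_le K V,
    AEEqFun.coeFn_add (L.1 V) (K.1 V)] with y h1 h2 h3
  have : (L + K).1 V y = L.1 V y + K.1 V y := h3
  rw [this, add_mul]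
  exact (ENNReal.ofReal_le_ofReal (abs_add_le _ _)).trans
    (ENNReal.ofReal_add_le.trans (add_le_add h1 h2))

theorem dualPtNorm_smul [SFinite μ] (f : Linf μ) (L : 𝓔.Dual) :
    𝓔.dualPtNorm (f • L) =ᵐ[μ]
      fun y => ENNReal.ofReal |(f : Y →ₘ[μ] ℝ) y| * 𝓔.dualPtNorm L y := by
  have hfm : Measurable fun y => ENNReal.ofReal |(f : Y →ₘ[μ] ℝ) y| :=
    ((f : Y →ₘ[μ] ℝ).measurable.abs).ennreal_ofReal
  have hsm : ∀ V, ∀ᵐ y ∂μ, (f • L).1 V y = (f : Y →ₘ[μ] ℝ) y * L.1 V y :=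
    fun V => Linf.coeFn_smul f (L.1 V)
  have h1 : 𝓔.dualPtNorm (f • L) ≤ᵐ[μ]
      fun y => ENNReal.ofReal |(f : Y →ₘ[μ] ℝ) y| * 𝓔.dualPtNorm L y := by
    refine dualPtNorm_le_of_forall _ (hfm.mul (measurable_dualPtNorm L)) fun V => ?_
    filter_upwards [hsm V, abs_dual_apply_le L V] with y h1 h2
    rw [h1, abs_mul, ENNReal.ofReal_mul (abs_nonneg _), mul_assoc]
    gcongr
  have hset : MeasurableSet {y | (f : Y →ₘ[μ] ℝ) y = 0} :=
    (f : Y →ₘ[μ] ℝ).measurable (measurableSet_singleton 0)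
  have h2 := dualPtNorm_le_of_forall L (h := fun y => if (f : Y →ₘ[μ] ℝ) y = 0 then ∞ else
      (ENNReal.ofReal |(f : Y →ₘ[μ] ℝ) y|)⁻¹ * 𝓔.dualPtNorm (f • L) y)
    (Measurable.ite hset measurable_const (hfm.inv.mul (measurable_dualPtNorm _))) (fun V => by
      filter_upwards [hsm V, abs_dual_apply_le (f • L) V, abs_dual_apply_le L V] with y h1 h2 h3
      by_cases h0 : (f : Y →ₘ[μ] ℝ) y = 0
      · rw [if_pos h0]
        exact h3.trans (by gcongr; exact le_top)
      · have hne : ENNReal.ofReal |(f : Y →ₘ[μ] ℝ) y| ≠ 0 := by simpa using h0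
        rw [if_neg h0, mul_assoc, ← ENNReal.mul_le_iff_le_inv hne ENNReal.ofReal_ne_top,
          ← ENNReal.ofReal_mul (abs_nonneg _), ← abs_mul, ← h1]
        exact h2)
  filter_upwards [h1, h2] with y h3 h4
  refine le_antisymm h3 ?_
  by_cases h0 : (f : Y →ₘ[μ] ℝ) y = 0
  · simp [h0]
  · have hne : ENNReal.ofReal |(f : Y →ₘ[μ] ℝ) y| ≠ 0 := by simpa using h0
    rw [if_neg h0] at h4
    rwa [ENNReal.mul_le_iff_le_inv hne ENNReal.ofReal_ne_top]

/-- The pointwise norm of `L` is a limit of the functions `L V` with `|V| ≤ 1`: the family of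
these functions is directed, since two elements `V` can be glued along a measurable set. -/
theorem exists_seq_tendsto_dualPtNorm [SigmaFinite μ] (hp0 : p ≠ 0) (hp : p ≠ ∞) (L : 𝓔.Dual) :
    ∃ V : ℕ → E, (∀ n, ∀ᵐ y ∂μ, 𝓔.ptNorm (V n) y ≤ 1) ∧
      ∀ᵐ y ∂μ, Tendsto (fun n => ENNReal.ofReal (L.1 (V n) y)) atTop (𝓝 (𝓔.dualPtNorm L y)) := by
  obtain ⟨f, hf, hlim⟩ := (isEssSup_dualPtNorm L).exists_seq_tendsto
    ⟨_, 0, by filter_upwards [𝓔.ptNorm_zero_ae] with y hy; simp [hy], rfl⟩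
    (by
      rintro _ ⟨v, -, rfl⟩
      exact (L.1 v).measurable.ennreal_ofReal)
    (by
      rintro _ ⟨v, hv, rfl⟩ _ ⟨w, hw, rfl⟩
      have hB : MeasurableSet {y | L.1 w y ≤ L.1 v y} :=
        measurableSet_le (L.1 w).measurable (L.1 v).measurable
      obtain ⟨χ, hχ⟩ := exists_linf_indicator (μ := μ) hB
      obtain ⟨χ', hχ'⟩ := exists_linf_indicator (μ := μ) hB.compl
      have hval : ∀ᵐ y ∂μ, L.1 (χ • v + χ' • w) y = max (L.1 v y) (L.1 w y) := by
        rw [map_add]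
        filter_upwards [AEEqFun.coeFn_add (L.1 (χ • v)) (L.1 (χ' • w)), dual_smul_ae L χ v,
          dual_smul_ae L χ' w, hχ, hχ'] with y h1 h2 h3 h4 h5
        rw [h1, Pi.add_apply, h2, h3, h4, h5]
        by_cases h : L.1 w y ≤ L.1 v y
        · simp [indicator, h]
        · simp [indicator, h, (not_le.1 h).le]
      refine ⟨_, ⟨χ • v + χ' • w, ?_, rfl⟩, ?_, ?_⟩
      · filter_upwards [𝓔.ptNorm_add_le_ae hp0 hp (χ • v) (χ' • w), 𝓔.ptNorm_smul_ae χ v,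
          𝓔.ptNorm_smul_ae χ' w, hχ, hχ', hv, hw] with y h1 h2 h3 h4 h5 h6 h7
        rw [h2, h3, h4, h5] at h1
        refine h1.trans ?_
        by_cases h : L.1 w y ≤ L.1 v y
        · simpa [indicator, h] using h6
        · simpa [indicator, h] using h7
      · filter_upwards [hval] with y hy
        rw [hy]; exact ENNReal.ofReal_le_ofReal (le_max_left _ _)
      · filter_upwards [hval] with y hy
        rw [hy]; exact ENNReal.ofReal_le_ofReal (le_max_right _ _))
  choose V hV1 hV2 using hf
  refine ⟨V, hV1, ?_⟩
  simp only [hV2] at hlim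
  exact hlim

end Pointwise
end LpNormedModule

namespace LpNormedModule
variable {Y : Type*} [MeasurableSpace Y] {μ : Measure Y} {E : Type*} [AddCommGroup E] [Module ℝ E]
  [Module (Linf μ) E] [IsScalarTower ℝ (Linf μ) E]

section DualNorm
variable {p q : ℝ} {𝓔 : LpNormedModule (ENNReal.ofReal p) μ E}

attribute [local instance] dualSMul

/-- The test of the bound `‖L W‖₁ ≤ C ‖W‖` on `W = g^{q-1} V`, where `|V| ≤ 1` and
`g` is a truncation of the positive part of `L V`. -/
theorem lintegral_rpow_truncation_le (hpq : p.HolderConjugate q) (L : 𝓔.Dual) {C : ℝ} (hC : 0 ≤ C)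
    (hL : ∀ v, eLpNorm (L.1 v) 1 μ ≤ ENNReal.ofReal (C * ‖𝓔.ptNorm v‖)) {V : E}
    (hV : ∀ᵐ y ∂μ, 𝓔.ptNorm V y ≤ 1) {Z : Set Y} (hZ : MeasurableSet Z) (hZμ : μ Z ≠ ∞) (n : ℕ) :
    ∫⁻ y, (Z.indicator (fun y => min (ENNReal.ofReal (L.1 V y)) n) y) ^ q ∂μ ≤
      ENNReal.ofReal C ^ q := by
  have hp := hpq.pos
  have hq := hpq.symm.pos
  have hq1 := hpq.symm.sub_one_pos
  set g : Y → ℝ := Z.indicator fun y => max 0 (min (L.1 V y) n) with hg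
  have hgm : Measurable g :=
    (measurable_const.max ((L.1 V).measurable.min measurable_const)).indicator hZ
  have hg0 : ∀ y, 0 ≤ g y := fun y => indicator_nonneg (fun y _ => le_max_left _ _) y
  have hgn : ∀ y, g y ≤ n := fun y => by
    by_cases h : y ∈ Z
    · simp only [hg, indicator_of_mem h]
      exact max_le (Nat.cast_nonneg _) (min_le_right _ _)
    · simp [hg, h]
  have hgof : ∀ y, Z.indicator (fun y => min (ENNReal.ofReal (L.1 V y)) n) y =
      ENNReal.ofReal (g y) := fun y => by
    by_cases h : y ∈ Z
    · simp only [hg, indicator_of_mem h]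
      rw [ENNReal.ofReal_max, ENNReal.ofReal_min]; simp
    · simp [hg, h]
  simp only [hgof]
  obtain ⟨f, hf⟩ := exists_linf_ae_eq (μ := μ) (g := fun y => g y ^ (q - 1))
    (hgm.pow_const _).aestronglyMeasurable ((n : ℝ) ^ (q - 1)) (Eventually.of_forall fun y => by
      rw [abs_of_nonneg (Real.rpow_nonneg (hg0 y) _)]
      exact Real.rpow_le_rpow (hg0 y) (hgn y) hq1.le)
  set I : ℝ≥0∞ := ∫⁻ y, ENNReal.ofReal (g y) ^ q ∂μ with hI
  have hlow : I ≤ eLpNorm (L.1 (f • V)) 1 μ := by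
    rw [eLpNorm_one_eq_lintegral_enorm]
    refine lintegral_mono_ae ?_
    filter_upwards [dual_smul_ae L f V, hf] with y h1 h2
    rw [h1, h2, Real.enorm_eq_ofReal_abs, ENNReal.ofReal_rpow_of_nonneg (hg0 y) hq.le]
    refine ENNReal.ofReal_le_ofReal ?_
    rw [abs_mul, abs_of_nonneg (Real.rpow_nonneg (hg0 y) _)]
    rcases (hg0 y).eq_or_lt with h0 | h0
    · rw [← h0, Real.zero_rpow hq.ne']; positivity
    · have h3 : g y ≤ |L.1 V y| := by
        by_cases h : y ∈ Z
        · simp only [hg, indicator_of_mem h]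
          exact max_le (abs_nonneg _) ((min_le_left _ _).trans (le_abs_self _))
        · simp [hg, h]
      calc g y ^ q = g y ^ (q - 1) * g y := by
            rw [← Real.rpow_add_one h0.ne', sub_add_cancel]
        _ ≤ _ := by gcongr
  have hup : eLpNorm (𝓔.ptNorm (f • V)) (ENNReal.ofReal p) μ ≤ I ^ (1 / p) := by
    rw [eLpNorm_eq_lintegral_rpow_enorm_toReal (by simpa using hp) ENNReal.ofReal_ne_top,
      ENNReal.toReal_ofReal hp.le]
    gcongr ?_ ^ (1 / p)
    refine lintegral_mono_ae ?_
    filter_upwards [𝓔.ptNorm_smul_ae f V, hf, hV, 𝓔.ptNorm_nonneg_ae V] with y h1 h2 h3 h4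
    rw [h1, h2, abs_of_nonneg (Real.rpow_nonneg (hg0 y) _), Real.enorm_eq_ofReal
      (mul_nonneg (Real.rpow_nonneg (hg0 y) _) h4), ENNReal.ofReal_rpow_of_nonneg
      (mul_nonneg (Real.rpow_nonneg (hg0 y) _) h4) hp.le, ENNReal.ofReal_rpow_of_nonneg (hg0 y) hq.le]
    refine ENNReal.ofReal_le_ofReal ?_
    calc (g y ^ (q - 1) * 𝓔.ptNorm V y) ^ p ≤ (g y ^ (q - 1)) ^ p := by
          refine Real.rpow_le_rpow (mul_nonneg (Real.rpow_nonneg (hg0 y) _) h4) ?_ hp.le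
          exact mul_le_of_le_one_right (Real.rpow_nonneg (hg0 y) _) h3
      _ = g y ^ q := by
          rw [← Real.rpow_mul (hg0 y), hpq.symm.sub_one_mul_conj]
  have hIt : I ≠ ∞ := by
    refine ne_top_of_le_ne_top (b := (n : ℝ≥0∞) ^ q * μ Z) (ENNReal.mul_ne_top
      (ENNReal.rpow_ne_top_of_nonneg hq.le (ENNReal.natCast_ne_top n)) hZμ) ?_
    rw [← setLIntegral_const, ← lintegral_indicator hZ]
    refine lintegral_mono fun y => ?_
    by_cases h : y ∈ Z
    · rw [indicator_of_mem h]
      gcongr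
      exact ENNReal.ofReal_le_of_le_toReal (by simpa using hgn y)
    · simp [hg, h, hq]
  have hmain : I ≤ ENNReal.ofReal C * I ^ (1 / p) := by
    refine (hlow.trans (hL _)).trans ?_
    rw [ENNReal.ofReal_mul hC, ofReal_norm_ptNorm]
    gcongr
  rcases eq_or_ne I 0 with h0 | h0
  · rw [h0]; exact zero_le
  have hsplit : I = I ^ (1 / q) * I ^ (1 / p) := by
    rw [← ENNReal.rpow_add _ _ h0 hIt, add_comm, one_div, one_div, hpq.inv_add_inv_eq_one,
      ENNReal.rpow_one]
  have hpne : I ^ (1 / p) ≠ 0 := by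
    simp [ENNReal.rpow_eq_zero_iff, h0, hIt]
  have hpt : I ^ (1 / p) ≠ ∞ := ENNReal.rpow_ne_top_of_nonneg (by positivity) hIt
  have h1 : I ^ (1 / q) ≤ ENNReal.ofReal C := by
    rw [← ENNReal.mul_le_mul_iff_left hpne hpt, ← hsplit]
    exact hmain
  calc I = (I ^ (1 / q)) ^ q := by rw [← ENNReal.rpow_mul, one_div_mul_cancel hq.ne',
        ENNReal.rpow_one]
    _ ≤ _ := by gcongr

theorem ae_ne_top_of_memLp {N : Y → ℝ≥0∞} (hq : 0 < q) (hN : MemLp N (ENNReal.ofReal q) μ) :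
    ∀ᵐ y ∂μ, N y ≠ ∞ := by
  have h := hN.2
  rw [eLpNorm_lt_top_iff_lintegral_rpow_enorm_lt_top (by simpa using hq) ENNReal.ofReal_ne_top,
    ENNReal.toReal_ofReal hq.le] at h
  simp only [enorm_eq_self] at h
  filter_upwards [ae_lt_top' (hN.1.aemeasurable.pow_const q) h.ne] with y hy htop
  rw [htop, ENNReal.top_rpow_of_pos hq] at hy
  exact lt_irrefl _ hy

theorem memLp_toReal {N : Y → ℝ≥0∞} (hq : 0 < q) (hN : MemLp N (ENNReal.ofReal q) μ) :
    MemLp (fun y => (N y).toReal) (ENNReal.ofReal q) μ := by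
  refine ⟨hN.1.aemeasurable.ennreal_toReal.aestronglyMeasurable, lt_of_eq_of_lt ?_ hN.2⟩
  refine eLpNorm_congr_enorm_ae ?_
  filter_upwards [ae_ne_top_of_memLp hq hN] with y hy
  rw [Real.enorm_eq_ofReal ENNReal.toReal_nonneg, ENNReal.ofReal_toReal hy, enorm_eq_self]

/-- Hölder's inequality for a function controlled by a pointwise norm. -/
theorem eLpNorm_one_le_of_abs_le (hpq : p.HolderConjugate q) {a : Y →ₘ[μ] ℝ} {N : Y → ℝ≥0∞}
    (hN : Measurable N) {V : E}
    (h : ∀ᵐ y ∂μ, ENNReal.ofReal |a y| ≤ N y * ENNReal.ofReal (𝓔.ptNorm V y)) :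
    eLpNorm a 1 μ ≤ eLpNorm N (ENNReal.ofReal q) μ * eLpNorm (𝓔.ptNorm V) (ENNReal.ofReal p) μ := by
  have hp := hpq.pos
  have hq := hpq.symm.pos
  have hh := ENNReal.lintegral_mul_le_Lp_mul_Lq μ hpq.symm (f := N)
    (g := fun y => ‖𝓔.ptNorm V y‖ₑ) hN.aemeasurable (Lp.aestronglyMeasurable _).enorm
  rw [eLpNorm_one_eq_lintegral_enorm,
    eLpNorm_eq_lintegral_rpow_enorm_toReal (by simpa using hq) ENNReal.ofReal_ne_top,
    eLpNorm_eq_lintegral_rpow_enorm_toReal (by simpa using hp) ENNReal.ofReal_ne_top,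
    ENNReal.toReal_ofReal hp.le, ENNReal.toReal_ofReal hq.le]
  simp only [enorm_eq_self]
  refine le_trans (lintegral_mono_ae ?_) hh
  filter_upwards [h, 𝓔.ptNorm_nonneg_ae V] with y h1 h2
  rwa [Pi.mul_apply, Real.enorm_eq_ofReal_abs, Real.enorm_eq_ofReal h2]

variable [SigmaFinite μ]

theorem eLpNorm_dualPtNorm_le (hpq : p.HolderConjugate q) (L : 𝓔.Dual) {C : ℝ} (hC : 0 ≤ C)
    (hL : ∀ v, eLpNorm (L.1 v) 1 μ ≤ ENNReal.ofReal (C * ‖𝓔.ptNorm v‖)) :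
    eLpNorm (𝓔.dualPtNorm L) (ENNReal.ofReal q) μ ≤ ENNReal.ofReal C := by
  have hp := hpq.pos
  have hq := hpq.symm.pos
  obtain ⟨V, hV, hlim⟩ := exists_seq_tendsto_dualPtNorm (by simpa using hp) ENNReal.ofReal_ne_top L
  set G : ℕ → Y → ℝ≥0∞ := fun n y => ((spanningSets μ n).indicator
    (fun y => min (ENNReal.ofReal (L.1 (V n) y)) n) y) ^ q with hG
  have hGm : ∀ n, Measurable (G n) := fun n =>
    (((L.1 (V n)).measurable.ennreal_ofReal.min measurable_const).indicator
      (measurableSet_spanningSets μ n)).pow_const _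
  have hGlim : ∀ᵐ y ∂μ, Tendsto (fun n => G n y) atTop (𝓝 (𝓔.dualPtNorm L y ^ q)) := by
    filter_upwards [hlim] with y hy
    refine Tendsto.ennrpow_const q ?_
    have h1 := hy.min ENNReal.tendsto_nat_nhds_top
    rw [min_eq_left le_top] at h1
    refine h1.congr' ?_
    filter_upwards [eventually_ge_atTop (spanningSetsIndex μ y)] with n hn
    rw [indicator_of_mem (mem_spanningSets_of_index_le μ y hn)]
  have hle : ∫⁻ y, 𝓔.dualPtNorm L y ^ q ∂μ ≤ ENNReal.ofReal C ^ q := by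
    calc ∫⁻ y, 𝓔.dualPtNorm L y ^ q ∂μ = ∫⁻ y, liminf (fun n => G n y) atTop ∂μ := by
          refine lintegral_congr_ae ?_
          filter_upwards [hGlim] with y hy using hy.liminf_eq.symm
      _ ≤ liminf (fun n => ∫⁻ y, G n y ∂μ) atTop := lintegral_liminf_le hGm
      _ ≤ ENNReal.ofReal C ^ q := by
          refine liminf_le_of_le (by isBoundedDefault) fun b hb => ?_
          obtain ⟨n, hn⟩ := hb.exists
          exact hn.trans (lintegral_rpow_truncation_le hpq L hC hL (hV n)
            (measurableSet_spanningSets μ n) (measure_spanningSets_lt_top μ n).ne n)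
  rw [eLpNorm_eq_lintegral_rpow_enorm_toReal (by simpa using hq) ENNReal.ofReal_ne_top,
    ENNReal.toReal_ofReal hq.le]
  simp only [enorm_eq_self]
  calc (∫⁻ y, 𝓔.dualPtNorm L y ^ q ∂μ) ^ (1 / q) ≤ (ENNReal.ofReal C ^ q) ^ (1 / q) := by gcongr
    _ = _ := by rw [← ENNReal.rpow_mul, mul_one_div_cancel hq.ne', ENNReal.rpow_one]

theorem memLp_dualPtNorm (hpq : p.HolderConjugate q) (L : 𝓔.Dual) :
    MemLp (𝓔.dualPtNorm L) (ENNReal.ofReal q) μ := by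
  obtain ⟨C, hC, hL⟩ := L.2
  exact ⟨(measurable_dualPtNorm L).aestronglyMeasurable,
    (eLpNorm_dualPtNorm_le hpq L hC hL).trans_lt ENNReal.ofReal_lt_top⟩

theorem dualOpNorm_eq (hpq : p.HolderConjugate q) (L : 𝓔.Dual) :
    𝓔.dualOpNorm L = (eLpNorm (𝓔.dualPtNorm L) (ENNReal.ofReal q) μ).toReal := by
  refine IsLeast.csInf_eq ⟨⟨ENNReal.toReal_nonneg, fun v => ?_⟩, ?_⟩
  · rw [ENNReal.ofReal_mul ENNReal.toReal_nonneg, ENNReal.ofReal_toReal (memLp_dualPtNorm hpq L).2.ne,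
      ofReal_norm_ptNorm]
    exact eLpNorm_one_le_of_abs_le hpq (measurable_dualPtNorm L) (abs_dual_apply_le L v)
  · rintro C ⟨hC, hL⟩
    exact ENNReal.toReal_le_of_le_ofReal hC (eLpNorm_dualPtNorm_le hpq L hC hL)

/-- The pointwise norm of an element of the dual, as an element of `L^q`. -/
noncomputable def dualLpNorm (hpq : p.HolderConjugate q) (L : 𝓔.Dual) : Lp ℝ (ENNReal.ofReal q) μ :=
  (memLp_toReal hpq.symm.pos (memLp_dualPtNorm hpq L)).toLp _

theorem coeFn_dualLpNorm (hpq : p.HolderConjugate q) (L : 𝓔.Dual) :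
    dualLpNorm hpq L =ᵐ[μ] fun y => (𝓔.dualPtNorm L y).toReal :=
  MemLp.coeFn_toLp _

theorem ofReal_dualLpNorm (hpq : p.HolderConjugate q) (L : 𝓔.Dual) :
    (fun y => ENNReal.ofReal (dualLpNorm hpq L y)) =ᵐ[μ] 𝓔.dualPtNorm L := by
  filter_upwards [coeFn_dualLpNorm hpq L,
    ae_ne_top_of_memLp hpq.symm.pos (memLp_dualPtNorm hpq L)] with y h1 h2
  rw [h1, ENNReal.ofReal_toReal h2]

theorem norm_dualLpNorm (hpq : p.HolderConjugate q) (L : 𝓔.Dual) :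
    ‖dualLpNorm hpq L‖ = 𝓔.dualOpNorm L := by
  rw [dualOpNorm_eq hpq, Lp.norm_def]
  congr 1
  refine eLpNorm_congr_enorm_ae ?_
  filter_upwards [coeFn_dualLpNorm hpq L, ofReal_dualLpNorm hpq L] with y h1 h2
  rw [enorm_eq_self, ← h2, Real.enorm_eq_ofReal]
  rw [h1]; exact ENNReal.toReal_nonneg

theorem eLpNorm_dual_apply_le_norm (hpq : p.HolderConjugate q) (L : 𝓔.Dual) (V : E) :
    eLpNorm (L.1 V) 1 μ ≤ ENNReal.ofReal (‖dualLpNorm hpq L‖ * ‖𝓔.ptNorm V‖) := by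
  rw [norm_dualLpNorm, dualOpNorm_eq hpq, ENNReal.ofReal_mul ENNReal.toReal_nonneg,
    ENNReal.ofReal_toReal (memLp_dualPtNorm hpq L).2.ne, ofReal_norm_ptNorm]
  exact eLpNorm_one_le_of_abs_le hpq (measurable_dualPtNorm L) (abs_dual_apply_le L V)

/-- The dual is complete: a Cauchy sequence of functionals converges in `L^1` at each element, and
the limit is an `L^∞`-linear functional. -/
theorem dual_complete (hpq : p.HolderConjugate q) (L : ℕ → 𝓔.Dual)
    (hL : ∀ ε : ℝ, 0 < ε → ∃ n₀, ∀ m ≥ n₀, ∀ n ≥ n₀, ‖dualLpNorm hpq (L m - L n)‖ < ε) :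
    ∃ K : 𝓔.Dual, Tendsto (fun n => ‖dualLpNorm hpq (L n - K)‖) atTop (𝓝 0) := by
  have hbound : ∀ (K : 𝓔.Dual) (V : E), eLpNorm (K.1 V) 1 μ < ∞ := fun K V =>
    (eLpNorm_dual_apply_le_norm hpq K V).trans_lt ENNReal.ofReal_lt_top
  have hsub : ∀ (V : E) (m n : ℕ), eLpNorm ⇑((L m).1 V - (L n).1 V) 1 μ ≤
      ENNReal.ofReal (‖dualLpNorm hpq (L m - L n)‖ * ‖𝓔.ptNorm V‖) := fun V m n =>
    eLpNorm_dual_apply_le_norm hpq (L m - L n) V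
  have hlim : ∀ V : E, ∃ a : Y →ₘ[μ] ℝ,
      Tendsto (fun n => eLpNorm ⇑((L n).1 V - a) 1 μ) atTop (𝓝 0) := by
    intro V
    set u : ℕ → Lp ℝ 1 μ := fun n => ⟨(L n).1 V, Lp.mem_Lp_iff_eLpNorm_lt_top.2 (hbound _ _)⟩
    have hu : CauchySeq u := by
      rw [Metric.cauchySeq_iff']
      intro ε hε
      obtain ⟨n₀, h0⟩ := hL (ε / (‖𝓔.ptNorm V‖ + 1)) (div_pos hε (add_pos_of_nonneg_of_pos
        ENNReal.toReal_nonneg one_pos))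
      refine ⟨n₀, fun n hn => ?_⟩
      have hV0 : (0 : ℝ) ≤ ‖𝓔.ptNorm V‖ := ENNReal.toReal_nonneg
      rw [dist_eq_norm, Lp.norm_def]
      calc (eLpNorm ⇑((L n).1 V - (L n₀).1 V) 1 μ).toReal
          ≤ ‖dualLpNorm hpq (L n - L n₀)‖ * ‖𝓔.ptNorm V‖ :=
            ENNReal.toReal_le_of_le_ofReal (mul_nonneg ENNReal.toReal_nonneg hV0) (hsub V n n₀)
        _ ≤ (ε / (‖𝓔.ptNorm V‖ + 1)) * ‖𝓔.ptNorm V‖ := by gcongr; exact (h0 n hn n₀ le_rfl).le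
        _ < ε := by rw [div_mul_eq_mul_div, div_lt_iff₀ (by positivity)]; nlinarith
    obtain ⟨a, ha⟩ := cauchySeq_tendsto_of_complete hu
    refine ⟨a, ?_⟩
    rw [Lp.tendsto_Lp_iff_tendsto_eLpNorm'] at ha
    refine ha.congr fun n => eLpNorm_congr_ae ?_
    exact (AEEqFun.coeFn_sub ((L n).1 V) (a : Y →ₘ[μ] ℝ)).symm
  choose K hK using hlim
  have hadd : ∀ V W, K (V + W) = K V + K W := fun V W => by
    refine aeEqFun_eq_of_tendsto (hK (V + W)) ?_
    have h := (hK V).add (hK W)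
    rw [add_zero] at h
    refine tendsto_of_tendsto_of_tendsto_of_le_of_le tendsto_const_nhds h (fun n => zero_le)
      fun n => ?_
    simp only
    rw [map_add, add_sub_add_comm]
    exact eLpNorm_coe_add_le le_rfl _ _
  have hsmul : ∀ (f : Linf μ) V, K (f • V) = f • K V := fun f V => by
    refine aeEqFun_eq_of_tendsto (hK (f • V)) ?_
    have h := ENNReal.Tendsto.const_mul (a := eLpNorm (f : Y →ₘ[μ] ℝ) ∞ μ) (hK V)
      (Or.inr (ne_of_lt f.2))
    rw [mul_zero] at h
    refine tendsto_of_tendsto_of_tendsto_of_le_of_le tendsto_const_nhds h (fun n => zero_le)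
      fun n => ?_
    simp only
    rw [map_smul, ← smul_sub]
    exact eLpNorm_linf_smul_le _ _
  set Kl : E →ₗ[Linf μ] (Y →ₘ[μ] ℝ) := { toFun := K, map_add' := hadd, map_smul' := hsmul }
  have happrox : ∀ ε : ℝ, 0 < ε → ∃ n₀, ∀ n ≥ n₀, ∀ V,
      eLpNorm ⇑((L n).1 V - K V) 1 μ ≤ ENNReal.ofReal (ε * ‖𝓔.ptNorm V‖) := by
    intro ε hε
    obtain ⟨n₀, h0⟩ := hL ε hε
    refine ⟨n₀, fun n hn V => ?_⟩
    have h := (hK V).const_add (ENNReal.ofReal (ε * ‖𝓔.ptNorm V‖))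
    rw [add_zero] at h
    refine ge_of_tendsto h ?_
    filter_upwards [eventually_ge_atTop n₀] with m hm
    refine (eLpNorm_coe_sub_le le_rfl _ ((L m).1 V) _).trans ?_
    gcongr
    refine (hsub V n m).trans (ENNReal.ofReal_le_ofReal ?_)
    gcongr
    · exact ENNReal.toReal_nonneg
    · exact (h0 n hn m hm).le
  have hKmem : Kl ∈ 𝓔.Dual := by
    obtain ⟨n, hn⟩ := happrox 1 one_pos
    refine ⟨1 + ‖dualLpNorm hpq (L n)‖, add_nonneg zero_le_one ENNReal.toReal_nonneg, fun V => ?_⟩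
    have hV0 : (0 : ℝ) ≤ ‖𝓔.ptNorm V‖ := ENNReal.toReal_nonneg
    have hN0 : (0 : ℝ) ≤ ‖dualLpNorm hpq (L n)‖ := ENNReal.toReal_nonneg
    have e : K V = (K V - (L n).1 V) + (L n).1 V := by abel
    change eLpNorm ⇑(K V) 1 μ ≤ _
    rw [e, add_mul, ENNReal.ofReal_add (by positivity) (by positivity)]
    refine (eLpNorm_coe_add_le le_rfl _ _).trans (add_le_add ?_
      (eLpNorm_dual_apply_le_norm hpq (L n) V))
    rw [eLpNorm_coe_sub_comm]
    exact hn n le_rfl V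
  refine ⟨⟨Kl, hKmem⟩, ?_⟩
  rw [Metric.tendsto_atTop]
  intro ε hε
  obtain ⟨n₀, h0⟩ := happrox (ε / 2) (half_pos hε)
  refine ⟨n₀, fun n hn => ?_⟩
  have hN0 : (0 : ℝ) ≤ ‖dualLpNorm hpq (L n - ⟨Kl, hKmem⟩)‖ := ENNReal.toReal_nonneg
  rw [Real.dist_eq, sub_zero, abs_of_nonneg hN0, norm_dualLpNorm]
  refine lt_of_le_of_lt ?_ (half_lt_self hε)
  exact csInf_le ⟨0, fun C hC => hC.1⟩ ⟨(half_pos hε).le, fun V => h0 n hn V⟩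

variable (𝓔) in
/-- The dual of an `L^p`-normed module is an `L^q`-normed module. -/
theorem exists_dualNormedModule (hpq : p.HolderConjugate q) :
    ∃ 𝓓 : LpNormedModule (ENNReal.ofReal q) μ 𝓔.Dual, ∀ L : 𝓔.Dual,
      (fun y => ENNReal.ofReal (𝓓.ptNorm L y)) =ᵐ[μ] 𝓔.dualPtNorm L ∧
        ‖𝓓.ptNorm L‖ = 𝓔.dualOpNorm L := by
  refine ⟨{
    ptNorm := dualLpNorm hpq
    ptNorm_nonneg L := by
      rw [← Lp.coeFn_le]
      filter_upwards [Lp.coeFn_zero ℝ (ENNReal.ofReal q) μ, coeFn_dualLpNorm hpq L] with y h1 h2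
      rw [h1, h2]; exact ENNReal.toReal_nonneg
    ptNorm_smul f L := by
      refine AEEqFun.ext ?_
      filter_upwards [AEEqFun.coeFn_mul |(f : Y →ₘ[μ] ℝ)| (dualLpNorm hpq L : Y →ₘ[μ] ℝ),
        AEEqFun.coeFn_abs (f : Y →ₘ[μ] ℝ), coeFn_dualLpNorm hpq L, coeFn_dualLpNorm hpq (f • L),
        dualPtNorm_smul f L] with y h1 h2 h3 h4 h5
      rw [h1, Pi.mul_apply, h2, h3]
      refine h4.trans ?_
      rw [h5, ENNReal.toReal_mul, ENNReal.toReal_ofReal (abs_nonneg _)]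
    norm_add_le L K := by
      have : Fact (1 ≤ ENNReal.ofReal q) := ⟨by simpa using hpq.symm.lt.le⟩
      refine le_trans (Lp.norm_le_norm_of_ae_le (g := dualLpNorm hpq L + dualLpNorm hpq K) ?_)
        (_root_.norm_add_le _ _)
      filter_upwards [Lp.coeFn_add (dualLpNorm hpq L) (dualLpNorm hpq K), coeFn_dualLpNorm hpq L,
        coeFn_dualLpNorm hpq K, coeFn_dualLpNorm hpq (L + K), dualPtNorm_add_le L K,
        ae_ne_top_of_memLp hpq.symm.pos (memLp_dualPtNorm hpq L),
        ae_ne_top_of_memLp hpq.symm.pos (memLp_dualPtNorm hpq K)] with y h1 h2 h3 h4 h5 h6 h7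
      rw [h1, Pi.add_apply, h2, h3, h4, ← ENNReal.toReal_add h6 h7,
        Real.norm_of_nonneg ENNReal.toReal_nonneg, Real.norm_of_nonneg ENNReal.toReal_nonneg]
      exact ENNReal.toReal_mono (ENNReal.add_ne_top.2 ⟨h6, h7⟩) h5
    eq_zero_of_norm L hL := by
      refine Subtype.ext (LinearMap.ext fun V => ?_)
      have h := eLpNorm_dual_apply_le_norm hpq L V
      rw [hL, zero_mul, ENNReal.ofReal_zero, nonpos_iff_eq_zero,
        eLpNorm_eq_zero_iff (L.1 V).aestronglyMeasurable one_ne_zero] at h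
      exact AEEqFun.ext (h.trans AEEqFun.coeFn_zero.symm)
    complete L hL := dual_complete hpq L hL },
    fun L => ⟨ofReal_dualLpNorm hpq L, norm_dualLpNorm hpq L⟩⟩

end DualNorm
end LpNormedModule

/-! ### Differentiation along the cells of a dense sequence of sets -/

section Levy
variable {Y W : Type*}

open Classical in
/-- The cell of `y` in the partition generated by `B 0, …, B (k - 1)`, recorded as a number: an
encoding of the set of the indices `i < k` with `y ∈ B i`. -/
noncomputable def cellCode (B : ℕ → Set Y) (k : ℕ) (y : Y) : ℕ :=
  Encodable.encode ((Finset.range k).filter fun i => y ∈ B i)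

theorem cellCode_eq_iff {B : ℕ → Set Y} {k : ℕ} {y z : Y} :
    cellCode B k z = cellCode B k y ↔ z ∈ cell B k y := by
  classical
  simp only [cellCode, Encodable.encode_inj, Finset.ext_iff, Finset.mem_filter, Finset.mem_range,
    cell, mem_ofPred_eq, and_congr_right_iff]

theorem preimage_cellCode (B : ℕ → Set Y) (k : ℕ) (y : Y) :
    cellCode B k ⁻¹' {cellCode B k y} = cell B k y := by
  ext z; exact cellCode_eq_iff

variable [MeasurableSpace Y] [MeasurableSpace W]

theorem measurableSet_cell {B : ℕ → Set Y} (hB : ∀ i, MeasurableSet (B i)) (k : ℕ) (y : Y) :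
    MeasurableSet (cell B k y) := by
  have : cell B k y = ⋂ i, ⋂ (_ : i < k), {z | z ∈ B i ↔ y ∈ B i} := by
    ext z; simp [cell]
  rw [this]
  exact .iInter fun i => .iInter fun _ => (measurable_mem.2 (hB i)).iff measurable_const |>.setOf

theorem measurable_cellCode {B : ℕ → Set Y} (hB : ∀ i, MeasurableSet (B i)) (k : ℕ) :
    Measurable (cellCode B k) :=
  measurable_to_countable fun y => by rw [preimage_cellCode]; exact measurableSet_cell hB k y

/-- The filtration generated by a map `ψ` together with the first sets of a sequence `B`. -/
noncomputable def cellFiltration {ψ : Y → W} (hψ : Measurable ψ) {B : ℕ → Set Y}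
    (hB : ∀ i, MeasurableSet (B i)) : Filtration ℕ (inferInstance : MeasurableSpace Y) where
  seq m := MeasurableSpace.comap (fun y => (ψ y, cellCode B m y)) inferInstance
  mono' := by
    classical
    intro m n hmn
    set g : ℕ → ℕ := fun c =>
      Encodable.encode ((((Encodable.decode c : Option (Finset ℕ)).getD ∅)).filter (· < m))
    have hg : ∀ y, cellCode B m y = g (cellCode B n y) := fun y => by
      simp only [g, cellCode, Encodable.encodek, Option.getD_some, Encodable.encode_inj]
      ext i
      simp only [Finset.mem_filter, Finset.mem_range]
      constructor
      · rintro ⟨h1, h2⟩; exact ⟨⟨h1.trans_le hmn, h2⟩, h1⟩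
      · rintro ⟨⟨_, h2⟩, h1⟩; exact ⟨h1, h2⟩
    have e : (fun y => (ψ y, cellCode B m y)) =
        (Prod.map id g) ∘ fun y => (ψ y, cellCode B n y) := by
      funext y; simp [hg y]
    simp only
    rw [e, ← MeasurableSpace.comap_comp]
    exact MeasurableSpace.comap_mono
      ((measurable_id.prodMap (measurable_of_countable g)).comap_le)
  le' m := (hψ.prodMk (measurable_cellCode hB m)).comap_le

theorem measurableSet_cellFiltration {ψ : Y → W} (hψ : Measurable ψ) {B : ℕ → Set Y}
    (hB : ∀ i, MeasurableSet (B i)) (i : ℕ) :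
    MeasurableSet[cellFiltration hψ hB (i + 1)] (B i) := by
  classical
  refine ⟨Prod.snd ⁻¹' {c | i ∈ (Encodable.decode c : Option (Finset ℕ)).getD ∅},
    measurable_snd (Set.to_countable _).measurableSet, ?_⟩
  ext y
  simp [cellCode]

/-- Lévy's upward theorem for the filtration generated by `ψ` and the sequence `B`, when the latter
generates all measurable sets up to null sets. -/
theorem tendsto_condExp_cellFiltration {ψ : Y → W} (hψ : Measurable ψ) {B : ℕ → Set Y}
    (hB : ∀ i, MeasurableSet (B i)) (ν : Measure Y) [IsFiniteMeasure ν]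
    (hgen : ∀ S, MeasurableSet S →
      ∃ S', MeasurableSet[MeasurableSpace.generateFrom (range B)] S' ∧ S =ᵐ[ν] S')
    {f : Y → ℝ} (hf : Integrable f ν) :
    ∀ᵐ y ∂ν, Tendsto (fun m => (ν[f | cellFiltration hψ hB m]) y) atTop (𝓝 (f y)) := by
  set ℱ := cellFiltration hψ hB
  have hle : (⨆ n, ℱ n) ≤ (inferInstance : MeasurableSpace Y) := iSup_le fun n => ℱ.le n
  have hlim : ν[f | ⨆ n, ℱ n] =ᵐ[ν] f := by
    refine Integrable.ae_eq_of_forall_setIntegral_eq _ _ integrable_condExp hf fun S hS _ => ?_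
    obtain ⟨S', hS', hSS⟩ := hgen S hS
    have hgle : MeasurableSpace.generateFrom (range B) ≤ ⨆ n, ℱ n := by
      refine MeasurableSpace.generateFrom_le ?_
      rintro _ ⟨i, rfl⟩
      exact (le_iSup (fun n => (ℱ n : MeasurableSpace Y)) (i + 1)) _
        (measurableSet_cellFiltration hψ hB i)
    rw [setIntegral_congr_set hSS, setIntegral_congr_set hSS]
    exact setIntegral_condExp hle hf (hgle _ hS')
  filter_upwards [tendsto_ae_condExp (ℱ := ℱ) f, hlim] with y h1 h2
  rwa [h2] at h1

end Levy

section Dense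
variable {X : Type*} [MeasurableSpace X] {μ : Measure X} {A : ℕ → Set X}

/-- A dense sequence of sets generates all measurable sets up to null sets. -/
theorem exists_generateFrom_ae_eq [SigmaFinite μ] (hA : μ.MeasureDense (range A)) {S : Set X}
    (hS : MeasurableSet S) :
    ∃ S', MeasurableSet[MeasurableSpace.generateFrom (range A)] S' ∧ S =ᵐ[μ] S' := by
  have key : ∀ T, MeasurableSet T → μ T ≠ ∞ →
      ∃ S', MeasurableSet[MeasurableSpace.generateFrom (range A)] S' ∧ T =ᵐ[μ] S' := by
    intro T hT hTμ
    choose t ht htμ using fun n : ℕ => hA.approx T hT hTμ ((1 / 2 : ℝ) ^ n) (by positivity)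
    refine ⟨liminf t atTop, ?_, ?_⟩
    · exact @MeasurableSet.measurableSet_liminf _ (MeasurableSpace.generateFrom (range A)) _ fun n =>
        MeasurableSpace.measurableSet_generateFrom (ht n)
    · have hsum : ∑' n, μ (symmDiff T (t n)) ≠ ∞ := by
        refine ne_top_of_le_ne_top ?_ (ENNReal.tsum_le_tsum fun n => (htμ n).le)
        have hs : Summable fun n : ℕ => ((1 / 2 : ℝ) ^ n) := summable_geometric_two
        rw [← ENNReal.ofReal_tsum_of_nonneg (fun n => by positivity) hs]
        exact ENNReal.ofReal_ne_top
      have h0 := measure_limsup_atTop_eq_zero hsum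
      refine Filter.eventuallyEq_set.2 ?_
      rw [measure_eq_zero_iff_ae_notMem] at h0
      filter_upwards [h0] with x hx
      rw [mem_limsup_iff_frequently_mem, not_frequently] at hx
      rw [mem_liminf_iff_eventually_mem]
      constructor
      · intro hxT
        filter_upwards [hx] with n hn
        by_contra hxt
        exact hn (Or.inl ⟨hxT, hxt⟩)
      · intro hev
        obtain ⟨n, h1, h2⟩ := (hx.and hev).exists
        by_contra hxT
        exact h1 (Or.inr ⟨h2, hxT⟩)
  choose U hU hUS using fun n : ℕ => key (S ∩ spanningSets μ n)
    (hS.inter (measurableSet_spanningSets μ n))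
    (ne_top_of_le_ne_top (measure_spanningSets_lt_top μ n).ne (measure_mono inter_subset_right))
  refine ⟨⋃ n, U n, MeasurableSet.iUnion hU, ?_⟩
  have h := Filter.EventuallyEq.countable_iUnion hUS
  rwa [← inter_iUnion, iUnion_spanningSets, inter_univ] at h

theorem ae_exists_mem_measure_ne_top [SigmaFinite μ] (hA : μ.MeasureDense (range A)) :
    ∀ᵐ x ∂μ, ∃ N, μ (A N) ≠ ∞ ∧ x ∈ A N := by
  set U : Set X := {x | ∃ N, μ (A N) ≠ ∞ ∧ x ∈ A N} with hU
  have hUm : MeasurableSet U := by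
    have : U = ⋃ N, ⋃ (_ : μ (A N) ≠ ∞), A N := by ext x; simp [hU]
    rw [this]
    exact .iUnion fun N => .iUnion fun _ => hA.measurable _ ⟨N, rfl⟩
  change μ Uᶜ = 0
  have h : ∀ n, μ (Uᶜ ∩ spanningSets μ n) = 0 := fun n => by
    have hfin : μ (Uᶜ ∩ spanningSets μ n) ≠ ∞ :=
      ne_top_of_le_ne_top (measure_spanningSets_lt_top μ n).ne (measure_mono inter_subset_right)
    refine le_antisymm (ENNReal.le_of_forall_pos_le_add fun ε hε _ => ?_) zero_le
    obtain ⟨_, ⟨N, rfl⟩, hN, hlt⟩ := hA.fin_meas_approx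
      (hUm.compl.inter (measurableSet_spanningSets μ n)) hfin ε hε
    rw [zero_add]
    refine le_trans (measure_mono fun x hx => Or.inl ⟨hx, fun hxN => hx.1 ⟨N, hN, hxN⟩⟩)
      (hlt.le.trans ?_)
    rw [ENNReal.ofReal_coe_nnreal]
  rw [← inter_univ Uᶜ, ← iUnion_spanningSets μ, inter_iUnion]
  exact measure_iUnion_null h

theorem ae_measure_cell_ne_zero (μ : Measure X) (A : ℕ → Set X) :
    ∀ᵐ x ∂μ, ∀ k, μ (cell A k x) ≠ 0 := by
  rw [ae_all_iff]
  intro k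
  have : ∀ᵐ x ∂μ, ∀ c, μ (cellCode A k ⁻¹' {c}) = 0 → cellCode A k x ≠ c := by
    rw [ae_all_iff]
    intro c
    by_cases h : μ (cellCode A k ⁻¹' {c}) = 0
    · filter_upwards [measure_eq_zero_iff_ae_notMem.1 h] with x hx _ using hx
    · exact Eventually.of_forall fun x h' => absurd h' h
  filter_upwards [this] with x hx h0
  rw [← preimage_cellCode] at h0
  exact hx _ h0 rfl

/-- The differentiation theorem: the means over the cells converge almost everywhere. On a set `A N`
of finite measure the means are conditional expectations, so that Lévy's theorem applies. -/
theorem ae_tendsto_cellAverage [SigmaFinite μ] (hA : μ.MeasureDense (range A)) {f : X → ℝ}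
    (hf : ∀ N, μ (A N) ≠ ∞ → IntegrableOn f (A N) μ) :
    ∀ᵐ x ∂μ, Tendsto (fun k => cellAverage μ A k f x) atTop (𝓝 (f x)) := by
  have hAm : ∀ i, MeasurableSet (A i) := fun i => hA.measurable _ ⟨i, rfl⟩
  have key : ∀ N, ∀ᵐ x ∂μ, μ (A N) ≠ ∞ → x ∈ A N →
      Tendsto (fun k => cellAverage μ A k f x) atTop (𝓝 (f x)) := by
    intro N
    by_cases hN : μ (A N) = ∞
    · exact Eventually.of_forall fun x h => absurd hN h
    set ν := μ.restrict (A N) with hν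
    have : IsFiniteMeasure ν := ⟨by rw [hν, Measure.restrict_apply_univ]; exact lt_top_iff_ne_top.2 hN⟩
    have hψ : Measurable fun _ : X => () := measurable_const
    have hlev := tendsto_condExp_cellFiltration hψ hAm ν (fun S hS => by
      obtain ⟨S', h1, h2⟩ := exists_generateFrom_ae_eq hA hS
      exact ⟨S', h1, ae_restrict_of_ae h2⟩) (hf N hN)
    have hcell := ae_measure_cell_ne_zero ν A
    rw [hν, ae_restrict_iff' (hAm N)] at hlev hcell
    filter_upwards [hlev, hcell] with x h1 h2 _ hx
    refine (h1 hx).congr' ?_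
    filter_upwards [eventually_gt_atTop N] with k hk
    have hsub : cell A k x ⊆ A N := fun z hz => (hz N hk).2 hx
    have hrest : ν.restrict (cell A k x) = μ.restrict (cell A k x) := by
      rw [hν, Measure.restrict_restrict (measurableSet_cell hAm k x), inter_eq_left.2 hsub]
    have hEm : MeasurableSet[cellFiltration hψ hAm k] (cell A k x) := by
      refine ⟨Prod.snd ⁻¹' {cellCode A k x}, measurable_snd (measurableSet_singleton _), ?_⟩
      rw [← preimage_cellCode]; rfl
    have hint := setIntegral_condExp ((cellFiltration hψ hAm).le k) (hf N hN) hEm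
    obtain ⟨H, -, hH⟩ := (stronglyMeasurable_condExp (f := f) (μ := ν)
      (m := cellFiltration hψ hAm k)).measurable.exists_eq_measurable_comp
    have hconst : ∀ z ∈ cell A k x, (ν[f | cellFiltration hψ hAm k]) z =
        (ν[f | cellFiltration hψ hAm k]) x := fun z hz => by
      rw [hH]; simp [cellCode_eq_iff.2 hz]
    rw [setIntegral_congr_fun (measurableSet_cell hAm k x) hconst, setIntegral_const] at hint
    have hne : ν.real (cell A k x) ≠ 0 := by
      rw [measureReal_def, ENNReal.toReal_ne_zero]
      exact ⟨h2 hx k, measure_ne_top _ _⟩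
    have hreal : μ.real (cell A k x) = ν.real (cell A k x) := by
      rw [measureReal_def, measureReal_def, ← Measure.restrict_apply_univ (μ := μ), ← hrest,
        Measure.restrict_apply_univ]
    rw [cellAverage, setAverage_eq, hreal, ← hrest, ← hint, smul_eq_mul, smul_eq_mul,
      inv_mul_cancel_left₀ hne]
  filter_upwards [ae_all_iff.2 key, ae_exists_mem_measure_ne_top hA] with x h1 h2
  obtain ⟨N, h3, h4⟩ := h2
  exact h1 N h3 h4

theorem ae_mem_Leb [SigmaFinite μ] (hA : μ.MeasureDense (range A)) {f : X → ℝ}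
    (hf : Integrable f μ) : ∀ᵐ x ∂μ, x ∈ Leb μ A f ∧ Rep μ A f x = f x := by
  filter_upwards [ae_tendsto_cellAverage hA fun N _ => hf.integrableOn] with x hx
  have h : x ∈ Leb μ A f := ⟨_, hx⟩
  exact ⟨h, tendsto_nhds_unique (tendsto_Rep h) hx⟩

end Dense

/-! ### Fibres -/

section HahnBanach
variable {V : Type*} [SeminormedAddCommGroup V] [NormedSpace ℝ V]

/-- The Hahn–Banach theorem for a functional given by its graph: a linear relation on which the
second coordinate is controlled by the first is contained in the graph of a bounded functional. -/
theorem exists_strongDual_of_graph (R : Submodule ℝ (V × ℝ)) {C : ℝ} (hC : 0 ≤ C)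
    (h : ∀ z ∈ R, |z.2| ≤ C * ‖z.1‖) :
    ∃ D : StrongDual ℝ V, ‖D‖ ≤ C ∧ ∀ z ∈ R, D z.1 = z.2 := by
  have hg : ∀ z ∈ R, z.1 = 0 → z.2 = 0 := fun z hz h0 => by
    have := h z hz
    rw [h0, norm_zero, mul_zero] at this
    exact abs_eq_zero.1 (le_antisymm this (abs_nonneg _))
  have hgraph : R.toLinearPMap.graph = R := R.toLinearPMap_graph_eq hg
  have hb : ∀ x : R.toLinearPMap.domain, ‖R.toLinearPMap x‖ ≤ C * ‖x‖ := fun x => by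
    exact h _ (hgraph.le (R.toLinearPMap.mem_graph x))
  obtain ⟨D, hD, hDn⟩ := exists_extension_norm_eq R.toLinearPMap.domain
    (R.toLinearPMap.toFun.mkContinuous C hb)
  refine ⟨D, hDn ▸ LinearMap.mkContinuous_norm_le _ hC _, fun z hz => ?_⟩
  rw [← hgraph, LinearPMap.mem_graph_iff] at hz
  obtain ⟨y, h1, h2⟩ := hz
  rw [← h1, hD, ← h2]
  rfl

end HahnBanach

section Fibers
variable {X : Type*} [MeasurableSpace X] {μ : Measure X} {M : Type*} [AddCommGroup M] [Module ℝ M]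
  [Module (Linf μ) M] [IsScalarTower ℝ (Linf μ) M] {p : ℝ}
  (𝓜 : LpNormedModule (ENNReal.ofReal p) μ M) {A : ℕ → Set X}

namespace LpNormedModule

theorem ptNorm_memLp (v : M) : MemLp (𝓜.ptNorm v) (ENNReal.ofReal p) μ := Lp.memLp _

theorem integrable_ptNormPow (hp : 0 < p) (v : M) : Integrable (𝓜.ptNormPow v) μ := by
  have h := (𝓜.ptNorm_memLp v).integrable_norm_rpow (by simpa using hp) ENNReal.ofReal_ne_top
  rw [ENNReal.toReal_ofReal hp.le] at h
  refine h.congr ?_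
  filter_upwards [𝓜.ptNorm_nonneg_ae v] with x hx
  rw [Real.norm_of_nonneg hx, ptNormPow]

/-- The `L^p`-means over a cell are, up to a factor, norms of restrictions to the cell. -/
theorem exists_cellAverage_rpow_eq (hp : 0 < p) (hA : ∀ i, MeasurableSet (A i)) (k : ℕ) (x : X) :
    ∃ (c : ℝ) (χ : Linf μ), 0 ≤ c ∧ ∀ v : M,
      cellAverage μ A k (𝓜.ptNormPow v) x ^ (1 / p) = c * ‖𝓜.ptNorm (χ • v)‖ := by
  have hE := measurableSet_cell hA k x
  obtain ⟨χ, hχ⟩ := exists_linf_indicator (μ := μ) hE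
  refine ⟨(μ.real (cell A k x))⁻¹ ^ (1 / p), χ, by positivity, fun v => ?_⟩
  have hint : (0 : ℝ) ≤ ∫ z in cell A k x, 𝓜.ptNormPow v z ∂μ :=
    integral_nonneg_of_ae (ae_restrict_of_ae (𝓜.ptNormPow_nonneg v))
  rw [cellAverage, setAverage_eq, smul_eq_mul, Real.mul_rpow (by positivity) hint]
  congr 1
  rw [norm_ptNorm, (𝓜.ptNorm_memLp _).eLpNorm_eq_integral_rpow_norm (by simpa using hp)
    ENNReal.ofReal_ne_top, ENNReal.toReal_ofReal (by positivity), ENNReal.toReal_ofReal hp.le,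
    one_div, ← integral_indicator hE]
  congr 1
  refine integral_congr_ae ?_
  filter_upwards [𝓜.ptNorm_smul_ae χ v, hχ, 𝓜.ptNorm_nonneg_ae v] with z h1 h2 h3
  rw [h1, h2]
  by_cases h : z ∈ cell A k x
  · simp [h, ptNormPow, abs_of_nonneg h3]
  · simp [h, Real.zero_rpow hp.ne']

/-- Minkowski's inequality for the `L^p`-means over a cell. -/
theorem cellAverage_rpow_sum_le (hp : 0 < p) (hA : ∀ i, MeasurableSet (A i)) (k : ℕ) (x : X)
    (l : List M) : cellAverage μ A k (𝓜.ptNormPow l.sum) x ^ (1 / p) ≤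
      (l.map fun u => cellAverage μ A k (𝓜.ptNormPow u) x ^ (1 / p)).sum := by
  obtain ⟨c, χ, hc, h⟩ := 𝓜.exists_cellAverage_rpow_eq hp hA k x
  simp only [h]
  induction l with
  | nil => simp only [List.sum_nil, smul_zero, norm_ptNorm_zero, List.map_nil]; simp
  | cons u l ih =>
    rw [List.sum_cons, List.map_cons, List.sum_cons, smul_add]
    refine le_trans (mul_le_mul_of_nonneg_left (𝓜.norm_add_le _ _) hc) ?_
    rw [mul_add]
    gcongr

theorem tendsto_repNorm (hp : 0 < p) {x : X} {v : M} (hv : v ∈ 𝓜.lebSet A x) :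
    Tendsto (fun k => cellAverage μ A k (𝓜.ptNormPow v) x ^ (1 / p)) atTop
      (𝓝 (𝓜.repNorm A x v)) :=
  (tendsto_Rep hv).rpow_const (Or.inr (by positivity))

/-- On `M_x` the seminorm of the fibre is `Rep(|v|^p)(x)^{1/p}`: the infimum over decompositions is
attained by the trivial one, by Minkowski's inequality on the cells. -/
theorem fiberNorm_eq_repNorm (hp : 0 < p) (hA : ∀ i, MeasurableSet (A i)) {x : X} {v : M}
    (hv : v ∈ 𝓜.lebSet A x) : 𝓜.fiberNorm A x v = 𝓜.repNorm A x v := by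
  refine le_antisymm ?_ (𝓜.le_fiberNorm A (Submodule.subset_span hv) fun l hl hs => ?_)
  · simpa using 𝓜.fiberNorm_le A [v] (by simpa using hv) (by simp)
  · refine le_of_tendsto_of_tendsto' (𝓜.tendsto_repNorm hp hv)
      (tendsto_list_sum l fun u hu => 𝓜.tendsto_repNorm hp (hl u hu)) fun k => ?_
    rw [← hs]
    exact 𝓜.cellAverage_rpow_sum_le hp hA k x l

theorem ae_mem_lebSet [SigmaFinite μ] (hp : 0 < p) (hA : μ.MeasureDense (range A)) (v : M) :
    ∀ᵐ x ∂μ, v ∈ 𝓜.lebSet A x ∧ 𝓜.repNorm A x v = 𝓜.ptNorm v x := by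
  filter_upwards [ae_mem_Leb hA (𝓜.integrable_ptNormPow hp v), 𝓜.ptNorm_nonneg_ae v] with x h1 h2
  refine ⟨h1.1, ?_⟩
  rw [repNorm, h1.2, ptNormPow, ← Real.rpow_mul h2, mul_one_div_cancel hp.ne', Real.rpow_one]

variable [hp1 : Fact (1 < p)]

variable (A) in
/-- The canonical map from the span of `M_x` to the fibre at `x`. -/
noncomputable def toFiber (x : X) : Submodule.span ℝ (𝓜.lebSet A x) →ₗ[ℝ] 𝓜.Fiber A x :=
  (UniformSpace.Completion.toComplL (𝕜 := ℝ) (E := 𝓜.PreFiber A x)).toLinearMap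

theorem norm_toFiber (x : X) (v : Submodule.span ℝ (𝓜.lebSet A x)) :
    ‖𝓜.toFiber A x v‖ = 𝓜.fiberNorm A x v.1 :=
  UniformSpace.Completion.norm_coe (E := 𝓜.PreFiber A x) v

theorem repSection_eq {x : X} {v : M} (hv : v ∈ 𝓜.lebSet A x) :
    𝓜.repSection A v x = 𝓜.toFiber A x ⟨v, Submodule.subset_span hv⟩ := by
  rw [repSection, dif_pos hv]; rfl

theorem ae_norm_repSection [SigmaFinite μ] (hA : μ.MeasureDense (range A)) (v : M) :
    ∀ᵐ x ∂μ, ‖𝓜.repSection A v x‖ = 𝓜.ptNorm v x := by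
  have hp : 0 < p := zero_lt_one.trans hp1.out
  filter_upwards [𝓜.ae_mem_lebSet hp hA v] with x h
  rw [𝓜.repSection_eq h.1, norm_toFiber,
    𝓜.fiberNorm_eq_repNorm hp (fun i => hA.measurable _ ⟨i, rfl⟩) h.1, h.2]

/-- Up to a null set, `Rep` is linear. -/
theorem ae_repSection_sum [SigmaFinite μ] (hA : μ.MeasureDense (range A)) {ι : Type*}
    (s : Finset ι) (c : ι → ℝ) (u : ι → M) :
    ∀ᵐ x ∂μ, 𝓜.repSection A (∑ i ∈ s, c i • u i) x = ∑ i ∈ s, c i • 𝓜.repSection A (u i) x := by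
  have hp : 0 < p := zero_lt_one.trans hp1.out
  have hu : ∀ᵐ x ∂μ, ∀ i ∈ s, u i ∈ 𝓜.lebSet A x := by
    refine (ae_ball_iff s.countable_toSet).2 fun i _ => ?_
    filter_upwards [𝓜.ae_mem_lebSet hp hA (u i)] with x hx using hx.1
  filter_upwards [hu, 𝓜.ae_mem_lebSet hp hA (∑ i ∈ s, c i • u i)] with x h1 h2
  rw [𝓜.repSection_eq h2.1]
  have e : (⟨_, Submodule.subset_span h2.1⟩ : Submodule.span ℝ (𝓜.lebSet A x)) =
      ∑ i ∈ s.attach, c i • ⟨u i, Submodule.subset_span (h1 i i.2)⟩ := by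
    refine Subtype.ext ?_
    rw [AddSubmonoidClass.coe_finsetSum]
    exact (Finset.sum_attach s fun i => c i • u i).symm
  rw [e, map_sum, ← Finset.sum_attach s]
  refine Finset.sum_congr rfl fun i _ => ?_
  rw [map_smul, 𝓜.repSection_eq (h1 i i.2)]

theorem cellAverage_abs_le (k : ℕ) (x : X) {g : X → ℝ} {C : ℝ}
    (hC : 0 ≤ C) {v : M} (hg : ∀ᵐ z ∂μ, |g z| ≤ C * 𝓜.ptNorm v z) :
    |cellAverage μ A k g x| ≤ C * cellAverage μ A k (𝓜.ptNormPow v) x ^ (1 / p) := by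
  have hp : 0 < p := zero_lt_one.trans hp1.out
  have hpow0 : 0 ≤ cellAverage μ A k (𝓜.ptNormPow v) x := by
    rw [cellAverage, setAverage_eq]
    exact smul_nonneg (by positivity)
      (integral_nonneg_of_ae (ae_restrict_of_ae (𝓜.ptNormPow_nonneg v)))
  by_cases h0 : μ.real (cell A k x) = 0
  · rw [cellAverage, setAverage_eq, h0, inv_zero, zero_smul, abs_zero]
    exact mul_nonneg hC (Real.rpow_nonneg hpow0 _)
  have hE0 : μ (cell A k x) ≠ 0 := fun h => h0 (by simp [measureReal_def, h])
  have hEt : μ (cell A k x) ≠ ∞ := fun h => h0 (by simp [measureReal_def, h])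
  have : IsFiniteMeasure (μ.restrict (cell A k x)) :=
    ⟨by rw [Measure.restrict_apply_univ]; exact lt_top_iff_ne_top.2 hEt⟩
  have hint : IntegrableOn (𝓜.ptNorm v) (cell A k x) μ :=
    ((𝓜.ptNorm_memLp v).restrict _).integrable (by simpa using hp1.out.le)
  have hnn := ae_restrict_of_ae (s := cell A k x) (𝓜.ptNorm_nonneg_ae v)
  have hjensen : cellAverage μ A k (𝓜.ptNorm v) x ^ p ≤ cellAverage μ A k (𝓜.ptNormPow v) x :=
    (convexOn_rpow hp1.out.le).map_set_average_le
      (Real.continuous_rpow_const hp.le).continuousOn isClosed_Ici hE0 hEt hnn hint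
      (𝓜.integrable_ptNormPow hp v).integrableOn
  have havg0 : 0 ≤ cellAverage μ A k (𝓜.ptNorm v) x := by
    rw [cellAverage, setAverage_eq]
    exact smul_nonneg (by positivity) (integral_nonneg_of_ae hnn)
  calc |cellAverage μ A k g x| ≤ C * cellAverage μ A k (𝓜.ptNorm v) x := by
        rw [← cellAverage_const_mul, cellAverage, setAverage_eq, cellAverage, setAverage_eq,
          smul_eq_mul, smul_eq_mul, abs_mul, abs_of_nonneg (by positivity)]
        gcongr
        exact norm_integral_le_of_norm_le (f := g) (hint.const_mul C) (ae_restrict_of_ae hg)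
    _ ≤ _ := by
        gcongr
        rw [one_div, Real.le_rpow_inv_iff_of_pos havg0 hpow0 hp]
        exact hjensen

theorem cellAverage_add_of_abs_le (k : ℕ) (x : X) {g₁ g₂ : X →ₘ[μ] ℝ} {C : ℝ}
    {v₁ v₂ : M} (h₁ : ∀ᵐ z ∂μ, |g₁ z| ≤ C * 𝓜.ptNorm v₁ z)
    (h₂ : ∀ᵐ z ∂μ, |g₂ z| ≤ C * 𝓜.ptNorm v₂ z) :
    cellAverage μ A k ⇑(g₁ + g₂) x = cellAverage μ A k g₁ x + cellAverage μ A k g₂ x := by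
  rw [cellAverage_congr A k (AEEqFun.coeFn_add g₁ g₂)]
  by_cases h0 : μ.real (cell A k x) = 0
  · simp [cellAverage, setAverage_eq, h0]
  have hEt : μ (cell A k x) ≠ ∞ := fun h => h0 (by simp [measureReal_def, h])
  have : IsFiniteMeasure (μ.restrict (cell A k x)) :=
    ⟨by rw [Measure.restrict_apply_univ]; exact lt_top_iff_ne_top.2 hEt⟩
  have hint : ∀ (g : X →ₘ[μ] ℝ) (v : M), (∀ᵐ z ∂μ, |g z| ≤ C * 𝓜.ptNorm v z) →
      IntegrableOn g (cell A k x) μ := fun g v h =>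
    ((((𝓜.ptNorm_memLp v).restrict _).integrable (by simpa using hp1.out.le)).const_mul C).mono'
      g.aestronglyMeasurable.restrict (ae_restrict_of_ae h)
  rw [cellAverage, cellAverage, cellAverage, setAverage_eq, setAverage_eq, setAverage_eq,
    ← smul_add, ← integral_add (hint g₁ v₁ h₁) (hint g₂ v₂ h₂)]
  rfl

theorem cellAverage_real_smul (k : ℕ) (x : X) (c : ℝ) (g : X →ₘ[μ] ℝ) :
    cellAverage μ A k ⇑(c • g) x = c * cellAverage μ A k g x := by
  rw [cellAverage_congr A k (AEEqFun.coeFn_smul c g), ← cellAverage_const_mul]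
  rfl

/-- A bounded operator from `M` to functions on `X` decomposes into functionals on the
fibres. At `x` the functional is the limit of the means of `Γ v` over the cells of `x`, where this
exists; it is bounded for the fibre seminorm and hence extends by the Hahn–Banach theorem. -/
theorem exists_fiber_functional [SigmaFinite μ] (hA : μ.MeasureDense (range A))
    (Γ : M →ₗ[ℝ] (X →ₘ[μ] ℝ)) {C : ℝ} (hC : 0 ≤ C)
    (hΓ : ∀ v, ∀ᵐ x ∂μ, |Γ v x| ≤ C * 𝓜.ptNorm v x) :
    ∃ D : ∀ x, StrongDual ℝ (𝓜.Fiber A x), (∀ x, ‖D x‖ ≤ C) ∧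
      ∀ v, ∀ᵐ x ∂μ, D x (𝓜.repSection A v x) = Γ v x := by
  have hp : 0 < p := zero_lt_one.trans hp1.out
  have hAm : ∀ i, MeasurableSet (A i) := fun i => hA.measurable _ ⟨i, rfl⟩
  have hex : ∀ x, ∃ D : StrongDual ℝ (𝓜.Fiber A x), ‖D‖ ≤ C ∧
      ∀ (v : Submodule.span ℝ (𝓜.lebSet A x)) (l : ℝ),
        Tendsto (fun k => cellAverage μ A k (Γ v.1) x) atTop (𝓝 l) →
          D (𝓜.toFiber A x v) = l := by
    intro x
    let R : Submodule ℝ (𝓜.Fiber A x × ℝ) :=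
      { carrier := {z | ∃ v : Submodule.span ℝ (𝓜.lebSet A x), 𝓜.toFiber A x v = z.1 ∧
          Tendsto (fun k => cellAverage μ A k (Γ v.1) x) atTop (𝓝 z.2)}
        add_mem' := by
          rintro z₁ z₂ ⟨v₁, h1, h2⟩ ⟨v₂, h3, h4⟩
          refine ⟨v₁ + v₂, by rw [map_add, h1, h3]; rfl, (h2.add h4).congr fun k => ?_⟩
          rw [Submodule.coe_add, map_add]
          exact (𝓜.cellAverage_add_of_abs_le k x (hΓ v₁.1) (hΓ v₂.1)).symm
        zero_mem' := ⟨0, by simp, by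
          have : ∀ k, cellAverage μ A k (Γ 0) x = 0 := fun k => by
            rw [map_zero, cellAverage_congr A k AEEqFun.coeFn_zero]
            simp [cellAverage]
          exact tendsto_const_nhds.congr fun k => (this k).symm⟩
        smul_mem' := by
          rintro c z ⟨v, h1, h2⟩
          refine ⟨c • v, by rw [map_smul, h1]; rfl, (h2.const_mul c).congr fun k => ?_⟩
          rw [Submodule.coe_smul, map_smul]
          exact (cellAverage_real_smul k x c (Γ v.1)).symm }
    obtain ⟨D, hD, hDR⟩ := exists_strongDual_of_graph R hC (by
      rintro z ⟨v, h1, h2⟩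
      have key : ∀ l : List M, (∀ u ∈ l, u ∈ 𝓜.lebSet A x) → l.sum = v.1 →
          |z.2| ≤ C * (l.map (𝓜.repNorm A x)).sum := fun l hl hs => by
        refine le_of_tendsto_of_tendsto' h2.abs ((tendsto_list_sum l fun u hu =>
          𝓜.tendsto_repNorm hp (hl u hu)).const_mul C) fun k => ?_
        refine (𝓜.cellAverage_abs_le k x hC (hΓ v.1)).trans ?_
        gcongr
        rw [← hs]
        exact 𝓜.cellAverage_rpow_sum_le hp hAm k x l
      rw [← h1, norm_toFiber]
      rcases hC.eq_or_lt with h0 | h0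
      · obtain ⟨l, hl, hs⟩ := 𝓜.exists_list A v.2
        simpa [← h0] using key l hl hs
      · rw [← div_le_iff₀' h0]
        exact 𝓜.le_fiberNorm A v.2 fun l hl hs => (div_le_iff₀' h0).2 (key l hl hs))
    exact ⟨D, hD, fun v l hl => hDR (𝓜.toFiber A x v, l) ⟨v, rfl, hl⟩⟩
  choose D hD hDv using hex
  refine ⟨D, hD, fun v => ?_⟩
  have hint : ∀ N, μ (A N) ≠ ∞ → IntegrableOn (Γ v) (A N) μ := fun N hN => by
    have : IsFiniteMeasure (μ.restrict (A N)) :=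
      ⟨by rw [Measure.restrict_apply_univ]; exact lt_top_iff_ne_top.2 hN⟩
    exact ((((𝓜.ptNorm_memLp v).restrict _).integrable
      (by simpa using hp1.out.le)).const_mul C).mono'
      (Γ v).aestronglyMeasurable.restrict (ae_restrict_of_ae (hΓ v))
  filter_upwards [𝓜.ae_mem_lebSet hp hA v, ae_tendsto_cellAverage hA hint] with x h1 h2
  rw [𝓜.repSection_eq h1.1]
  exact hDv x _ _ h2

end LpNormedModule
end Fibers

/-! ### Extension of functionals from a dense set of generators -/

section Extension
variable {Y : Type*} [MeasurableSpace Y] {μ : Measure Y} {E : Type*} [AddCommGroup E] [Module ℝ E]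
  [Module (Linf μ) E] [IsScalarTower ℝ (Linf μ) E]

theorem coeFn_sum_smul {ι : Type*} (s : Finset ι) (f : ι → Linf μ) (a : ι → Y →ₘ[μ] ℝ) :
    ∀ᵐ y ∂μ, (∑ i ∈ s, f i • a i : Y →ₘ[μ] ℝ) y = ∑ i ∈ s, (f i : Y →ₘ[μ] ℝ) y * a i y := by
  classical
  induction s using Finset.induction_on with
  | empty =>
    filter_upwards [AEEqFun.coeFn_zero (α := Y) (β := ℝ) (μ := μ)] with y hy
    simpa using hy
  | insert i s hi ih =>
    rw [Finset.sum_insert hi]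
    filter_upwards [AEEqFun.coeFn_add (f i • a i) (∑ j ∈ s, f j • a j), Linf.coeFn_smul (f i) (a i),
      ih] with y h1 h2 h3
    rw [h1, Pi.add_apply, h2, h3, Finset.sum_insert hi]

namespace LpNormedModule
variable {p : ℝ≥0∞} (𝓔 : LpNormedModule p μ E)

theorem norm_ptNorm_neg (v : E) : ‖𝓔.ptNorm (-v)‖ = ‖𝓔.ptNorm v‖ := by
  simpa using 𝓔.norm_ptNorm_real_smul (-1) v

theorem norm_ptNorm_sub_rev (v w : E) : ‖𝓔.ptNorm (v - w)‖ = ‖𝓔.ptNorm (w - v)‖ := by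
  rw [← 𝓔.norm_ptNorm_neg, neg_sub]

theorem norm_ptNorm_nonneg (v : E) : 0 ≤ ‖𝓔.ptNorm v‖ := ENNReal.toReal_nonneg

theorem norm_ptNorm_sub_le (u v w : E) :
    ‖𝓔.ptNorm (u - w)‖ ≤ ‖𝓔.ptNorm (u - v)‖ + ‖𝓔.ptNorm (v - w)‖ := by
  rw [← sub_add_sub_cancel u v w]; exact 𝓔.norm_add_le _ _

theorem exists_norm_ptNorm_smul_le (f : Linf μ) :
    ∃ C : ℝ, 0 ≤ C ∧ ∀ v, ‖𝓔.ptNorm (f • v)‖ ≤ C * ‖𝓔.ptNorm v‖ := by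
  obtain ⟨C, -, hC⟩ := Linf_bound μ f
  refine ⟨C, C.2, fun v => Lp.norm_le_mul_norm_of_ae_le_mul ?_⟩
  filter_upwards [hC, 𝓔.ptNorm_smul_ae f v] with y h1 h2
  rw [h2, norm_mul, Real.norm_eq_abs, abs_abs]
  gcongr

variable {G : Type*} [AddCommGroup G] [Module (Linf μ) G]

/-- A bounded `L^∞`-linear operator into `L^1` defined on generators of a dense submodule extends
to an element of the dual. -/
theorem exists_dual_extension (S : G →ₗ[Linf μ] E) (P : G →ₗ[Linf μ] (Y →ₘ[μ] ℝ))
    (hS : ∀ V : E, ∀ ε : ℝ, 0 < ε → ∃ c, ‖𝓔.ptNorm (V - S c)‖ < ε) {C : ℝ} (hC : 0 ≤ C)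
    (hP : ∀ c, eLpNorm (P c) 1 μ ≤ ENNReal.ofReal (C * ‖𝓔.ptNorm (S c)‖)) :
    ∃ L : 𝓔.Dual, ∀ c, L.1 (S c) = P c := by
  have hPsub : ∀ c d V, eLpNorm ⇑(P c - P d) 1 μ ≤
      ENNReal.ofReal (C * (‖𝓔.ptNorm (V - S c)‖ + ‖𝓔.ptNorm (V - S d)‖)) := fun c d V => by
    rw [← map_sub]
    refine (hP _).trans (ENNReal.ofReal_le_ofReal ?_)
    rw [map_sub]
    gcongr
    rw [𝓔.norm_ptNorm_sub_rev V (S c)]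
    exact 𝓔.norm_ptNorm_sub_le _ _ _
  choose d hd using fun (V : E) (n : ℕ) => hS V (1 / ((n : ℝ) + 1)) (by positivity)
  have hd0 : ∀ V, Tendsto (fun n => ‖𝓔.ptNorm (V - S (d V n))‖) atTop (𝓝 0) := fun V =>
    squeeze_zero (fun n => 𝓔.norm_ptNorm_nonneg _) (fun n => (hd V n).le)
      tendsto_one_div_add_atTop_nhds_zero_nat
  have hlim : ∀ V, ∃ a : Y →ₘ[μ] ℝ, ∀ c : ℕ → G,
      Tendsto (fun n => ‖𝓔.ptNorm (V - S (c n))‖) atTop (𝓝 0) →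
        Tendsto (fun n => eLpNorm ⇑(P (c n) - a) 1 μ) atTop (𝓝 0) := by
    intro V
    set u : ℕ → Lp ℝ 1 μ := fun n => ⟨P (d V n), Lp.mem_Lp_iff_eLpNorm_lt_top.2
      ((hP _).trans_lt ENNReal.ofReal_lt_top)⟩
    have hu : CauchySeq u := by
      refine cauchySeq_of_le_tendsto_0' (fun n => C * (1 / ((n : ℝ) + 1) + 1 / ((n : ℝ) + 1)))
        (fun n m hnm => ?_) ?_
      · rw [dist_eq_norm, Lp.norm_def]
        refine ENNReal.toReal_le_of_le_ofReal (by positivity) ((hPsub _ _ V).trans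
          (ENNReal.ofReal_le_ofReal ?_))
        gcongr
        · exact (hd V n).le
        · exact (hd V m).le.trans (one_div_le_one_div_of_le (by positivity) (by gcongr))
      · have h := (tendsto_one_div_add_atTop_nhds_zero_nat (𝕜 := ℝ))
        simpa using (h.add h).const_mul C
    obtain ⟨a, ha⟩ := cauchySeq_tendsto_of_complete hu
    rw [Lp.tendsto_Lp_iff_tendsto_eLpNorm'] at ha
    refine ⟨a, fun c hc => ?_⟩
    have h1 := (ENNReal.tendsto_ofReal (((hc.add (hd0 V)).const_mul C))).add ha
    rw [add_zero, add_zero, mul_zero, ENNReal.ofReal_zero] at h1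
    refine tendsto_of_tendsto_of_tendsto_of_le_of_le tendsto_const_nhds h1 (fun n => zero_le)
      fun n => (eLpNorm_coe_sub_le le_rfl _ (P (d V n)) _).trans (add_le_add (hPsub _ _ V) ?_)
    exact (eLpNorm_congr_ae (AEEqFun.coeFn_sub _ _)).le
  choose K hK using hlim
  have hadd : ∀ V W, K (V + W) = K V + K W := fun V W => by
    refine aeEqFun_eq_of_tendsto (hK (V + W) (fun n => d V n + d W n) ?_) ?_
    · have h := (hd0 V).add (hd0 W)
      rw [add_zero] at h
      refine squeeze_zero (fun n => 𝓔.norm_ptNorm_nonneg _) (fun n => ?_) h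
      rw [map_add, add_sub_add_comm]
      exact 𝓔.norm_add_le _ _
    · have h := (hK V _ (hd0 V)).add (hK W _ (hd0 W))
      rw [add_zero] at h
      refine tendsto_of_tendsto_of_tendsto_of_le_of_le tendsto_const_nhds h (fun n => zero_le)
        fun n => ?_
      simp only
      rw [map_add, add_sub_add_comm]
      exact eLpNorm_coe_add_le le_rfl _ _
  have hsmul : ∀ (f : Linf μ) V, K (f • V) = f • K V := fun f V => by
    refine aeEqFun_eq_of_tendsto (hK (f • V) (fun n => f • d V n) ?_) ?_
    · obtain ⟨B, -, hB⟩ := 𝓔.exists_norm_ptNorm_smul_le f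
      have h := (hd0 V).const_mul B
      rw [mul_zero] at h
      refine squeeze_zero (fun n => 𝓔.norm_ptNorm_nonneg _) (fun n => ?_) h
      rw [map_smul, ← smul_sub]
      exact hB _
    · have h := ENNReal.Tendsto.const_mul (a := eLpNorm (f : Y →ₘ[μ] ℝ) ∞ μ) (hK V _ (hd0 V))
        (Or.inr (ne_of_lt f.2))
      rw [mul_zero] at h
      refine tendsto_of_tendsto_of_tendsto_of_le_of_le tendsto_const_nhds h (fun n => zero_le)
        fun n => ?_
      simp only
      rw [map_smul, ← smul_sub]
      exact eLpNorm_linf_smul_le _ _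
  set Kl : E →ₗ[Linf μ] (Y →ₘ[μ] ℝ) := { toFun := K, map_add' := hadd, map_smul' := hsmul }
  have hmem : Kl ∈ 𝓔.Dual := by
    refine ⟨C, hC, fun V => ?_⟩
    change eLpNorm ⇑(K V) 1 μ ≤ _
    have h := (hK V _ (hd0 V)).add (ENNReal.tendsto_ofReal
      (((hd0 V).const_add ‖𝓔.ptNorm V‖).const_mul C))
    rw [add_zero, zero_add] at h
    refine ge_of_tendsto' h fun n => ?_
    have e : K V = (K V - P (d V n)) + P (d V n) := by abel
    conv_lhs => rw [e]
    refine (eLpNorm_coe_add_le le_rfl _ _).trans (add_le_add (eLpNorm_coe_sub_comm _ _).le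
      ((hP _).trans (ENNReal.ofReal_le_ofReal ?_)))
    gcongr
    have e2 : S (d V n) = V + -(V - S (d V n)) := by abel
    conv_lhs => rw [e2]
    exact (𝓔.norm_add_le _ _).trans (by rw [𝓔.norm_ptNorm_neg])
  refine ⟨⟨Kl, hmem⟩, fun c => ?_⟩
  refine aeEqFun_eq_of_tendsto (u := fun _ => P c) (hK (S c) (fun _ => c) ?_) ?_
  · simp only [sub_self, norm_ptNorm_zero]; exact tendsto_const_nhds
  · have : eLpNorm ⇑(P c - P c) 1 μ = 0 := by
      rw [sub_self, eLpNorm_congr_ae AEEqFun.coeFn_zero, eLpNorm_zero]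
    simp only [this]; exact tendsto_const_nhds

variable {𝓔}

/-- A pointwise bound `|L V| ≤ N |V|` extends from a dense set: along a subsequence both sides
converge almost everywhere. -/
theorem abs_dual_le_of_dense [SigmaFinite μ] [hp1 : Fact (1 ≤ p)] (hp : p ≠ ∞) (L : 𝓔.Dual)
    {N : Y → ℝ≥0∞} (hN : ∀ᵐ y ∂μ, N y ≠ ∞) {D : Set E}
    (hD : ∀ V : E, ∀ ε : ℝ, 0 < ε → ∃ W ∈ D, ‖𝓔.ptNorm (V - W)‖ < ε)
    (h : ∀ W ∈ D, ∀ᵐ y ∂μ, ENNReal.ofReal |L.1 W y| ≤ N y * ENNReal.ofReal (𝓔.ptNorm W y))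
    (V : E) : ∀ᵐ y ∂μ, ENNReal.ofReal |L.1 V y| ≤ N y * ENNReal.ofReal (𝓔.ptNorm V y) := by
  have hp0 : p ≠ 0 := (zero_lt_one.trans_le hp1.out).ne'
  obtain ⟨C, hC, hL⟩ := L.2
  choose W hWD hW using fun n : ℕ => hD V (1 / ((n : ℝ) + 1)) (by positivity)
  have hW0 : Tendsto (fun n => ‖𝓔.ptNorm (V - W n)‖) atTop (𝓝 0) :=
    squeeze_zero (fun n => 𝓔.norm_ptNorm_nonneg _) (fun n => (hW n).le)
      tendsto_one_div_add_atTop_nhds_zero_nat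
  have h1 : Tendsto (fun n => eLpNorm (⇑(L.1 (W n)) - ⇑(L.1 V)) 1 μ) atTop (𝓝 0) := by
    have h := ENNReal.tendsto_ofReal (hW0.const_mul C)
    rw [mul_zero, ENNReal.ofReal_zero] at h
    refine tendsto_of_tendsto_of_tendsto_of_le_of_le tendsto_const_nhds h (fun n => zero_le)
      fun n => ?_
    simp only
    rw [← eLpNorm_congr_ae (AEEqFun.coeFn_sub (L.1 (W n)) (L.1 V)), ← map_sub,
      𝓔.norm_ptNorm_sub_rev]
    exact hL _
  have h2 : Tendsto (fun n => eLpNorm (⇑(𝓔.ptNorm (W n)) - ⇑(𝓔.ptNorm V)) p μ) atTop (𝓝 0) := by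
    have h := ENNReal.tendsto_ofReal hW0
    rw [ENNReal.ofReal_zero] at h
    refine tendsto_of_tendsto_of_tendsto_of_le_of_le tendsto_const_nhds h (fun n => zero_le)
      fun n => ?_
    simp only
    rw [ofReal_norm_ptNorm]
    refine eLpNorm_mono_ae ?_
    filter_upwards [𝓔.abs_ptNorm_sub_le_ae hp0 hp V (W n)] with y hy
    rw [Pi.sub_apply, norm_sub_rev]
    exact hy.trans (le_abs_self _)
  obtain ⟨a, ha, hlim1⟩ := (tendstoInMeasure_of_tendsto_eLpNorm one_ne_zero
    (fun n => (L.1 (W n)).aestronglyMeasurable) (L.1 V).aestronglyMeasurable h1).exists_seq_tendsto_ae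
  obtain ⟨b, hb, hlim2⟩ := (tendstoInMeasure_of_tendsto_eLpNorm hp0
    (fun n => Lp.aestronglyMeasurable (𝓔.ptNorm (W (a n)))) (Lp.aestronglyMeasurable _)
    (h2.comp ha.tendsto_atTop)).exists_seq_tendsto_ae
  filter_upwards [hlim1, hlim2, ae_all_iff.2 fun n => h (W n) (hWD n), hN] with y h3 h4 h5 h6
  refine le_of_tendsto_of_tendsto'
    (ENNReal.tendsto_ofReal (h3.comp hb.tendsto_atTop).abs)
    (ENNReal.Tendsto.const_mul (ENNReal.tendsto_ofReal h4) (Or.inr h6)) fun n => h5 (a (b n))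

/-- Elements of the dual that agree on generators of a dense submodule are equal. -/
theorem dual_ext_of_dense {L K : 𝓔.Dual} {D : Set E}
    (hD : ∀ V : E, ∀ ε : ℝ, 0 < ε → ∃ W ∈ Submodule.span (Linf μ) D, ‖𝓔.ptNorm (V - W)‖ < ε)
    (h : ∀ v ∈ D, L.1 v = K.1 v) : L = K := by
  refine Subtype.ext (LinearMap.ext fun V => sub_eq_zero.1 ?_)
  obtain ⟨C, hC, hLK⟩ := (L - K).2
  have hspan : ∀ W ∈ Submodule.span (Linf μ) D, (L - K).1 W = 0 := fun W hW => by
    have := LinearMap.eqOn_span (f := L.1) (g := K.1) h hW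
    exact sub_eq_zero.2 this
  have h0 : eLpNorm ⇑((L - K).1 V) 1 μ = 0 := by
    have hlim : Tendsto (fun ε : ℝ => ENNReal.ofReal (C * ε)) (𝓝[>] 0) (𝓝 0) := by
      have : Tendsto (fun ε : ℝ => ENNReal.ofReal (C * ε)) (𝓝 0) (𝓝 (ENNReal.ofReal (C * 0))) :=
        ENNReal.tendsto_ofReal (tendsto_id.const_mul C)
      rw [mul_zero, ENNReal.ofReal_zero] at this
      exact this.mono_left nhdsWithin_le_nhds
    refine le_antisymm (ge_of_tendsto hlim ?_) zero_le
    filter_upwards [self_mem_nhdsWithin] with ε hε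
    obtain ⟨W, hW, hlt⟩ := hD V ε hε
    have e : (L - K).1 V = (L - K).1 (V - W) := by rw [map_sub, hspan W hW, sub_zero]
    rw [e]
    exact (hLK _).trans (ENNReal.ofReal_le_ofReal (by gcongr))
  rw [eLpNorm_eq_zero_iff (AEEqFun.aestronglyMeasurable _) one_ne_zero] at h0
  exact AEEqFun.ext (h0.trans AEEqFun.coeFn_zero.symm)

end LpNormedModule
end Extension

/-! ### Weakly measurable sections and functionals on the pullback -/

section Pullback
variable {X Y M E : Type*} [MeasurableSpace X] [MeasurableSpace Y] {μX : Measure X} {μY : Measure Y}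
  [SigmaFinite μX] {A : ℕ → Set X} {φ : Y → X} {p q : ℝ} [hp1 : Fact (1 < p)]
  [AddCommGroup M] [Module ℝ M] [Module (Linf μX) M] [IsScalarTower ℝ (Linf μX) M]
  {𝓜 : LpNormedModule (ENNReal.ofReal p) μX M}
  [AddCommGroup E] [Module ℝ E] [Module (Linf μY) E] [IsScalarTower ℝ (Linf μY) E]
  {𝓔 : LpNormedModule (ENNReal.ofReal p) μY E} {T : M →ₗ[ℝ] E}

theorem isWeakBanachBundle_pullbackTest (hA : μX.MeasureDense (range A))
    (hφ : MeasurePreserving φ μY μX) : IsWeakBanachBundle μY (pullbackTest 𝓜 A φ) where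
  complete y := inferInstance
  combination := by
    rintro _ ⟨v, rfl⟩ _ ⟨w, rfl⟩ a b
    refine ⟨_, ⟨a • v + b • w, rfl⟩, ?_⟩
    have h := hφ.quasiMeasurePreserving.ae
      (𝓜.ae_repSection_sum hA Finset.univ ![a, b] ![v, w])
    filter_upwards [h] with y hy
    simpa using hy.symm

variable [SigmaFinite μY]

/-- The pointwise norm on the pullback is the fibre norm: `|∑ fᵢ T uᵢ| = ‖∑ fᵢ Rep(uᵢ) ∘ φ‖`.
For rational constants `fᵢ` this is the isometry of `T` and of `Rep`, simultaneously for all such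
constants off one null set; both sides are Lipschitz in the values of the coefficients. -/
theorem ae_norm_sum_repSection (hA : μX.MeasureDense (range A)) (hφ : MeasurePreserving φ μY μX)
    (hT : IsPullback φ 𝓜 𝓔 T) {ι : Type*} [Fintype ι] (f : ι → Linf μY) (u : ι → M) :
    ∀ᵐ y ∂μY, ‖∑ i, (f i : Y →ₘ[μY] ℝ) y • 𝓜.repSection A (u i) (φ y)‖ =
      𝓔.ptNorm (∑ i, f i • T (u i)) y := by
  have hp0 : ENNReal.ofReal p ≠ 0 := by simpa using zero_lt_one.trans hp1.out
  have hpt : ENNReal.ofReal p ≠ ∞ := ENNReal.ofReal_ne_top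
  have hrat : ∀ᵐ y ∂μY, ∀ c : ι → ℚ,
      ‖∑ i, (c i : ℝ) • 𝓜.repSection A (u i) (φ y)‖ = 𝓔.ptNorm (∑ i, (c i : ℝ) • T (u i)) y := by
    rw [ae_all_iff]
    intro c
    filter_upwards [hφ.quasiMeasurePreserving.ae
        (𝓜.ae_repSection_sum hA Finset.univ (fun i => (c i : ℝ)) u),
      hφ.quasiMeasurePreserving.ae (𝓜.ae_norm_repSection hA (∑ i, (c i : ℝ) • u i)),
      hT.ptNorm_map (∑ i, (c i : ℝ) • u i)] with y h1 h2 h3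
    rw [← h1, h2, ← h3, map_sum]
    simp only [map_smul]
  have hu : ∀ᵐ y ∂μY, ∀ i, ‖𝓜.repSection A (u i) (φ y)‖ = 𝓔.ptNorm (T (u i)) y := by
    rw [ae_all_iff]
    intro i
    filter_upwards [hφ.quasiMeasurePreserving.ae (𝓜.ae_norm_repSection hA (u i)),
      hT.ptNorm_map (u i)] with y h1 h2
    rw [h1, h2]
  have hlip : ∀ᵐ y ∂μY, ∀ c : ι → ℚ,
      |𝓔.ptNorm (∑ i, f i • T (u i)) y - 𝓔.ptNorm (∑ i, (c i : ℝ) • T (u i)) y| ≤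
        ∑ i, |(f i : Y →ₘ[μY] ℝ) y - c i| * 𝓔.ptNorm (T (u i)) y := by
    rw [ae_all_iff]
    intro c
    have hsm : ∀ i, ∀ᵐ y ∂μY, 𝓔.ptNorm ((f i - algebraMap ℝ (Linf μY) (c i)) • T (u i)) y =
        |(f i : Y →ₘ[μY] ℝ) y - c i| * 𝓔.ptNorm (T (u i)) y := by
      intro i
      have e : (((f i - algebraMap ℝ (Linf μY) (c i) : Linf μY)) : Y →ₘ[μY] ℝ) =
          (f i : Y →ₘ[μY] ℝ) - (c i : ℝ) • (1 : Y →ₘ[μY] ℝ) := by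
        rw [Algebra.algebraMap_eq_smul_one]; rfl
      have h := 𝓔.ptNorm_smul_ae (f i - algebraMap ℝ (Linf μY) (c i)) (T (u i))
      rw [e] at h
      filter_upwards [h, AEEqFun.coeFn_sub (f i : Y →ₘ[μY] ℝ) ((c i : ℝ) • (1 : Y →ₘ[μY] ℝ)),
        AEEqFun.coeFn_smul (c i : ℝ) (1 : Y →ₘ[μY] ℝ),
        AEEqFun.coeFn_one (α := Y) (β := ℝ) (μ := μY)] with y h1 h2 h3 h4
      rw [h1, h2, Pi.sub_apply, h3, Pi.smul_apply, h4]
      simp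
    have e : ∑ i, f i • T (u i) - ∑ i, (c i : ℝ) • T (u i) =
        ∑ i, (f i - algebraMap ℝ (Linf μY) (c i)) • T (u i) := by
      rw [← Finset.sum_sub_distrib]
      refine Finset.sum_congr rfl fun i _ => ?_
      rw [sub_smul, algebraMap_smul]
    have h1 := 𝓔.abs_ptNorm_sub_le_ae hp0 hpt (∑ i, f i • T (u i)) (∑ i, (c i : ℝ) • T (u i))
    rw [e] at h1
    filter_upwards [h1, 𝓔.ptNorm_sum_le_ae hp0 hpt Finset.univ
      (fun i => (f i - algebraMap ℝ (Linf μY) (c i)) • T (u i)), ae_all_iff.2 hsm] with y h2 h3 h4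
    refine h2.trans (h3.trans (le_of_eq ?_))
    exact Finset.sum_congr rfl fun i _ => h4 i
  filter_upwards [hrat, hu, hlip, ae_all_iff.2 fun i => 𝓔.ptNorm_nonneg_ae (T (u i))]
    with y h1 h2 h3 h4
  set K : ℝ := ∑ i, 𝓔.ptNorm (T (u i)) y with hK
  have hK0 : 0 ≤ K := Finset.sum_nonneg fun i _ => h4 i
  have key : ∀ ε : ℝ, 0 < ε →
      |‖∑ i, (f i : Y →ₘ[μY] ℝ) y • 𝓜.repSection A (u i) (φ y)‖ -
        𝓔.ptNorm (∑ i, f i • T (u i)) y| ≤ 2 * K * ε := by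
    intro ε hε
    choose c hc1 hc2 using fun i => exists_rat_btwn
      (show (f i : Y →ₘ[μY] ℝ) y < (f i : Y →ₘ[μY] ℝ) y + ε by linarith)
    have hc : ∀ i, |(f i : Y →ₘ[μY] ℝ) y - c i| ≤ ε := fun i => by
      rw [abs_le]; constructor <;> linarith [hc1 i, hc2 i]
    have hsum : ∑ i, |(f i : Y →ₘ[μY] ℝ) y - c i| * 𝓔.ptNorm (T (u i)) y ≤ K * ε := by
      rw [hK, Finset.sum_mul]
      refine Finset.sum_le_sum fun i _ => ?_
      rw [mul_comm]
      exact mul_le_mul_of_nonneg_left (hc i) (h4 i)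
    have hfib : |‖∑ i, (f i : Y →ₘ[μY] ℝ) y • 𝓜.repSection A (u i) (φ y)‖ -
        ‖∑ i, (c i : ℝ) • 𝓜.repSection A (u i) (φ y)‖| ≤ K * ε := by
      refine (abs_norm_sub_norm_le _ _).trans (le_trans ?_ hsum)
      rw [← Finset.sum_sub_distrib]
      refine (norm_sum_le _ _).trans (Finset.sum_le_sum fun i _ => ?_)
      rw [← sub_smul, norm_smul, h2, Real.norm_eq_abs]
    have h5 := (h3 c).trans hsum
    rw [h1 c] at hfib
    rw [abs_le] at *
    constructor <;> linarith [hfib.1, hfib.2, h5.1, h5.2]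
  have h0 : |‖∑ i, (f i : Y →ₘ[μY] ℝ) y • 𝓜.repSection A (u i) (φ y)‖ -
      𝓔.ptNorm (∑ i, f i • T (u i)) y| ≤ 0 := by
    refine le_of_forall_pos_le_add fun δ hδ => ?_
    refine (key (δ / (2 * K + 1)) (by positivity)).trans ?_
    rw [zero_add, mul_div_assoc', div_le_iff₀ (by positivity)]
    nlinarith
  exact sub_eq_zero.1 (abs_nonpos_iff.1 h0)

/-- The pointwise bound `|⟨w, s⟩| ≤ |w| ‖s‖` for a combination `s` of test vectors, from the
definition of `|w|` applied to `s / ‖s‖`, redefined to be zero on a null set. -/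
theorem abs_pairing_le (hA : μX.MeasureDense (range A)) (hφ : MeasurePreserving φ μY μX)
    (hT : IsPullback φ 𝓜 𝓔 T) (w : DualSection fun y => 𝓜.Fiber A (φ y)) {ι : Type*} [Fintype ι]
    (f : ι → Linf μY) (u : ι → M) :
    ∀ᵐ y ∂μY, ENNReal.ofReal
        |w y (∑ i, (f i : Y →ₘ[μY] ℝ) y • 𝓜.repSection A (u i) (φ y))| ≤
      weakPtNorm μY (pullbackTest 𝓜 A φ) w y *
        ENNReal.ofReal (𝓔.ptNorm (∑ i, f i • T (u i)) y) := by
  set s : ∀ y, 𝓜.Fiber A (φ y) := fun y =>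
    ∑ i, (f i : Y →ₘ[μY] ℝ) y • 𝓜.repSection A (u i) (φ y) with hs
  have hmem : s ∈ testSpan (pullbackTest 𝓜 A φ) := by
    refine ⟨Fintype.card ι, fun j => (f ((Fintype.equivFin ι).symm j) : Y →ₘ[μY] ℝ),
      fun j y => 𝓜.repSection A (u ((Fintype.equivFin ι).symm j)) (φ y),
      fun j => AEEqFun.measurable _, fun j => ⟨_, rfl⟩, ?_⟩
    funext y
    exact ((Fintype.equivFin ι).symm.sum_comp
      fun i => (f i : Y →ₘ[μY] ℝ) y • 𝓜.repSection A (u i) (φ y)).symm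
  set N : Y → ℝ := ⇑(𝓔.ptNorm (∑ i, f i • T (u i))) with hN
  have hNm : Measurable N := (Lp.stronglyMeasurable _).measurable
  have hsN : ∀ᵐ y ∂μY, ‖s y‖ = N y := ae_norm_sum_repSection hA hφ hT f u
  set Z := toMeasurable μY {y | ¬ ‖s y‖ = N y} with hZ
  have hZ0 : μY Z = 0 := by rw [hZ, measure_toMeasurable]; exact hsN
  have hess := isEssSup_familyEssSup μY {g | ∃ v ∈ testSpan (pullbackTest 𝓜 A φ),
    (∀ y, ‖v y‖ ≤ 1) ∧ g = fun y => ENNReal.ofReal (w y (v y))}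
  have hle : ∀ σ : ℝ, |σ| = 1 → ∀ᵐ y ∂μY,
      ENNReal.ofReal (σ * w y (s y)) ≤ weakPtNorm μY (pullbackTest 𝓜 A φ) w y *
        ENNReal.ofReal (N y) := by
    intro σ hσ
    have hg : Measurable (Zᶜ.indicator fun y => σ * (N y)⁻¹) :=
      (measurable_const.mul hNm.inv).indicator (measurableSet_toMeasurable _ _).compl
    have h := hess.le _ ⟨_, smul_mem_testSpan hmem hg, fun y => ?_, rfl⟩
    · filter_upwards [h, measure_eq_zero_iff_ae_notMem.1 hZ0, hsN] with y h1 h2 h3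
      rw [indicator_of_mem (by exact h2), map_smul, smul_eq_mul] at h1
      rcases (norm_nonneg (s y)).eq_or_lt with h0 | h0
      · rw [norm_eq_zero.1 h0.symm]; simp
      · rw [h3] at h0
        calc ENNReal.ofReal (σ * w y (s y))
            = ENNReal.ofReal (σ * (N y)⁻¹ * w y (s y)) * ENNReal.ofReal (N y) := by
              rw [mul_comm (ENNReal.ofReal _), ← ENNReal.ofReal_mul h0.le]
              congr 1
              field_simp
          _ ≤ _ := by gcongr; exact h1
    · by_cases hy : y ∈ Z
      · simp [hy]
      · have h3 : ‖s y‖ = N y := by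
          by_contra h; exact hy (subset_toMeasurable _ _ h)
        rw [indicator_of_mem (by exact hy), norm_smul, h3, norm_mul, Real.norm_eq_abs σ, hσ, one_mul,
          norm_inv, Real.norm_eq_abs, ← h3, abs_norm]
        exact inv_mul_le_one
  filter_upwards [hle 1 (by simp), hle (-1) (by simp)] with y h1 h2
  rcases abs_choice (w y (s y)) with h | h
  · rw [h]; simpa using h1
  · rw [h]; simpa using h2

/-- If `L` represents the section `w`, then `|w| ≤ |L|`. -/
theorem weakPtNorm_le_dualPtNorm (hA : μX.MeasureDense (range A)) (hφ : MeasurePreserving φ μY μX)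
    (hT : IsPullback φ 𝓜 𝓔 T) (w : DualSection fun y => 𝓜.Fiber A (φ y)) (L : 𝓔.Dual)
    (hL : ∀ v : M, (L.1 (T v) : Y → ℝ) =ᵐ[μY] fun y => w y (𝓜.repSection A v (φ y))) :
    weakPtNorm μY (pullbackTest 𝓜 A φ) w ≤ᵐ[μY] 𝓔.dualPtNorm L := by
  refine (isEssSup_familyEssSup μY _).least _ (LpNormedModule.measurable_dualPtNorm L) ?_
  rintro _ ⟨_, ⟨n, f, u, hf, hu, rfl⟩, hv, rfl⟩
  choose v hvu using hu
  obtain rfl : (fun i => fun y => 𝓜.repSection A (v i) (φ y)) = u := funext hvu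
  -- The coefficients are unbounded, so the bound is proved on the sets where they are at most `j`.
  have key : ∀ᵐ y ∂μY, ∀ j : ℕ, (∀ i, |f i y| ≤ j) → ENNReal.ofReal
      (w y (∑ i, f i y • 𝓜.repSection A (v i) (φ y))) ≤ 𝓔.dualPtNorm L y := by
    rw [ae_all_iff]
    intro j
    have hB : MeasurableSet {y | ∀ i, |f i y| ≤ (j : ℝ)} := by
      rw [ofPred_forall]
      exact .iInter fun i => measurableSet_le (hf i).abs measurable_const
    choose g hg using fun i => exists_linf_ae_eq (μ := μY)
      (g := {y | ∀ i, |f i y| ≤ (j : ℝ)}.indicator (f i))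
      ((hf i).indicator hB).aestronglyMeasurable j (Eventually.of_forall fun y => by
        by_cases h : y ∈ {y | ∀ i, |f i y| ≤ (j : ℝ)}
        · rw [indicator_of_mem h]; exact h i
        · rw [indicator_of_notMem h, abs_zero]; exact Nat.cast_nonneg _)
    have hsum := coeFn_sum_smul Finset.univ g fun i => L.1 (T (v i))
    simp only [← map_smul, ← map_sum] at hsum
    filter_upwards [hsum, LpNormedModule.abs_dual_apply_le L (∑ i, g i • T (v i)),
      ae_norm_sum_repSection hA hφ hT g v, ae_all_iff.2 hg, ae_all_iff.2 fun i => hL (v i)]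
      with y h1 h2 h3 h4 h5 hy
    have h6 : ∀ i, (g i : Y →ₘ[μY] ℝ) y = f i y := fun i => by
      rw [h4 i, indicator_of_mem (by exact hy)]
    simp only [h6, h5] at h1 h3
    rw [h1, ← h3] at h2
    rw [map_sum]
    simp only [map_smul, smul_eq_mul]
    calc ENNReal.ofReal (∑ i, f i y * w y (𝓜.repSection A (v i) (φ y)))
        ≤ ENNReal.ofReal |∑ i, f i y * w y (𝓜.repSection A (v i) (φ y))| :=
          ENNReal.ofReal_le_ofReal (le_abs_self _)
      _ ≤ _ := h2
      _ ≤ 𝓔.dualPtNorm L y * 1 := by gcongr; exact ENNReal.ofReal_le_one.2 (hv y)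
      _ = _ := mul_one _
  filter_upwards [key] with y hy
  obtain ⟨j, hj⟩ := exists_nat_ge (∑ i, |f i y|)
  exact hy j fun i => (Finset.single_le_sum (f := fun i => |f i y|) (fun i _ => abs_nonneg _)
    (Finset.mem_univ i)).trans hj

/-- Each section in `L^q_weak` is represented by a functional on the pullback with the same
pointwise norm. -/
theorem exists_dual_of_section (hpq : p.HolderConjugate q) (hA : μX.MeasureDense (range A))
    (hφ : MeasurePreserving φ μY μX) (hT : IsPullback φ 𝓜 𝓔 T)
    (w : weakLpSections μY (pullbackTest 𝓜 A φ) (ENNReal.ofReal q)) :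
    ∃ L : 𝓔.Dual,
      (∀ v : M, (L.1 (T v) : Y → ℝ) =ᵐ[μY] fun y => w.1 y (𝓜.repSection A v (φ y))) ∧
      𝓔.dualPtNorm L =ᵐ[μY] weakPtNorm μY (pullbackTest 𝓜 A φ) w.1 := by
  have hmeas : ∀ v : M, AEStronglyMeasurable (fun y => w.1 y (𝓜.repSection A v (φ y))) μY :=
    fun v => (w.2.1 _ ⟨v, rfl⟩).aestronglyMeasurable
  set a : M → Y →ₘ[μY] ℝ := fun v => AEEqFun.mk _ (hmeas v) with ha
  set S := Finsupp.linearCombination (Linf μY) (fun v : M => T v)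
  set P := Finsupp.linearCombination (Linf μY) a
  set N := weakPtNorm μY (pullbackTest 𝓜 A φ) w.1
  have hNm : Measurable N := (isEssSup_familyEssSup μY _).measurable
  have hNt : ∀ᵐ y ∂μY, N y ≠ ∞ := LpNormedModule.ae_ne_top_of_memLp hpq.symm.pos w.2.2
  have hbound : ∀ c : M →₀ Linf μY, ∀ᵐ y ∂μY,
      ENNReal.ofReal |P c y| ≤ N y * ENNReal.ofReal (𝓔.ptNorm (S c) y) := by
    intro c
    have hS : S c = ∑ i : c.support, c i • T i := by
      rw [Finset.sum_coe_sort c.support fun i => c i • T i]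
      exact Finsupp.linearCombination_apply _ _
    have hP : P c = ∑ i : c.support, c i • a i := by
      rw [Finset.sum_coe_sort c.support fun i => c i • a i]
      exact Finsupp.linearCombination_apply _ _
    rw [hS, hP]
    filter_upwards [abs_pairing_le hA hφ hT w.1 (fun i : c.support => c i) (fun i => i),
      coeFn_sum_smul Finset.univ (fun i : c.support => c i) (fun i => a i),
      ae_all_iff.2 fun i : c.support => AEEqFun.coeFn_mk _ (hmeas i)] with y h1 h2 h3
    refine le_trans (le_of_eq ?_) h1
    rw [h2, map_sum]
    congr 2
    refine Finset.sum_congr rfl fun i _ => ?_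
    rw [map_smul, smul_eq_mul]
    exact congrArg _ (h3 i)
  have hrange : ∀ W ∈ Submodule.span (Linf μY) (range T), ∃ c, S c = W := fun W hW => by
    rw [← Finsupp.range_linearCombination] at hW
    exact hW
  obtain ⟨L, hL⟩ := 𝓔.exists_dual_extension S P (fun V ε hε => by
      obtain ⟨W, hW, h⟩ := hT.generates V ε hε
      obtain ⟨c, rfl⟩ := hrange W hW
      exact ⟨c, h⟩) (C := (eLpNorm N (ENNReal.ofReal q) μY).toReal) ENNReal.toReal_nonneg
    (fun c => by
      rw [ENNReal.ofReal_mul ENNReal.toReal_nonneg, ENNReal.ofReal_toReal w.2.2.2.ne,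
        𝓔.ofReal_norm_ptNorm]
      exact LpNormedModule.eLpNorm_one_le_of_abs_le hpq hNm (hbound c))
  have hLT : ∀ v : M, (L.1 (T v) : Y → ℝ) =ᵐ[μY] fun y => w.1 y (𝓜.repSection A v (φ y)) := by
    intro v
    have h := hL (Finsupp.single v 1)
    simp only [S, P, Finsupp.linearCombination_single, one_smul] at h
    rw [h]
    exact AEEqFun.coeFn_mk _ (hmeas v)
  refine ⟨L, hLT, ?_⟩
  have hle : 𝓔.dualPtNorm L ≤ᵐ[μY] N := by
    have : Fact (1 ≤ ENNReal.ofReal p) := ⟨by simpa using hp1.out.le⟩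
    refine LpNormedModule.dualPtNorm_le_of_forall L hNm
      (LpNormedModule.abs_dual_le_of_dense ENNReal.ofReal_ne_top L hNt hT.generates fun W hW => ?_)
    obtain ⟨c, rfl⟩ := hrange W hW
    rw [hL]
    exact hbound c
  filter_upwards [hle, weakPtNorm_le_dualPtNorm hA hφ hT w.1 L hLT] with y h1 h2
  exact le_antisymm h1 h2

end Pullback

/-! ### Functionals on the pullback come from sections -/

section Descent
variable {X Y M : Type*} [MeasurableSpace X] [MeasurableSpace Y] {μ : Measure X} [SigmaFinite μ]

theorem exists_support_of_absolutelyContinuous {ρ : Measure X} [SigmaFinite ρ] (h : ρ ≪ μ) :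
    ∃ Z, MeasurableSet Z ∧ ρ Zᶜ = 0 ∧ μ.restrict Z ≪ ρ := by
  have hm := Measure.measurable_rnDeriv ρ μ
  have hZ : MeasurableSet {x | ρ.rnDeriv μ x ≠ 0} := (hm (measurableSet_singleton 0)).compl
  have hρ := Measure.withDensity_rnDeriv_eq ρ μ h
  refine ⟨_, hZ, ?_, ?_⟩
  · rw [← hρ, withDensity_apply_eq_zero hm, hρ, inter_compl_self, measure_empty]
  · refine Measure.AbsolutelyContinuous.mk fun N hN h0 => ?_
    rw [← hρ, withDensity_apply_eq_zero hm] at h0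
    rwa [Measure.restrict_apply hN, inter_comm]

/-- A bounded linear family of functions on `Y` that factor through `φ` descends to a bounded linear
family of functions on `X`, supported where the image measure lives. -/
theorem exists_linear_descent [AddCommGroup M] [Module ℝ M] {φ : Y → X} (hφ : Measurable φ)
    {ρ : Measure Y} [IsFiniteMeasure ρ] (hρ : ρ.map φ ≪ μ) {e : M → Y → ℝ}
    (he : ∀ v, ∃ G : X → ℝ, Measurable G ∧ ∀ᵐ y ∂ρ, e v y = G (φ y))
    (hadd : ∀ v w, ∀ᵐ y ∂ρ, e (v + w) y = e v y + e w y)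
    (hsmul : ∀ (c : ℝ) v, ∀ᵐ y ∂ρ, e (c • v) y = c * e v y)
    {n : M → X → ℝ} (hnm : ∀ v, Measurable (n v)) (hn : ∀ v, ∀ᵐ x ∂μ, 0 ≤ n v x)
    (hb : ∀ v, ∀ᵐ y ∂ρ, |e v y| ≤ n v (φ y)) :
    ∃ Γ : M →ₗ[ℝ] (X →ₘ[μ] ℝ), (∀ v, ∀ᵐ x ∂μ, |Γ v x| ≤ n v x) ∧
      ∀ v, ∀ᵐ y ∂ρ, Γ v (φ y) = e v y := by
  obtain ⟨Z, hZ, hZ0, hZρ⟩ := exists_support_of_absolutelyContinuous hρ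
  have hup : ∀ P : X → Prop, MeasurableSet {x | P x} → (∀ᵐ y ∂ρ, P (φ y)) →
      ∀ᵐ x ∂μ, x ∈ Z → P x := fun P hP h => by
    rw [← ae_restrict_iff' hZ]
    exact hZρ.ae_le ((ae_map_iff hφ.aemeasurable hP).2 h)
  have hlow : ∀ᵐ y ∂ρ, φ y ∈ Z := by
    refine ae_of_ae_map hφ.aemeasurable ?_
    rw [ae_iff]; exact hZ0
  choose G hG hGe using he
  have hZG : ∀ v, Measurable (Z.indicator (G v)) := fun v => (hG v).indicator hZ
  set Γ : M → X →ₘ[μ] ℝ := fun v => AEEqFun.mk _ (hZG v).aestronglyMeasurable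
  have hΓ : ∀ v, Γ v =ᵐ[μ] Z.indicator (G v) := fun v => AEEqFun.coeFn_mk _ _
  refine ⟨{ toFun := Γ, map_add' := fun v w => ?_, map_smul' := fun c v => ?_ }, fun v => ?_,
    fun v => ?_⟩
  · refine AEEqFun.ext ?_
    have h := hup (fun x => G (v + w) x = G v x + G w x)
      (measurableSet_eq_fun (hG _) ((hG v).add (hG w))) (by
        filter_upwards [hadd v w, hGe v, hGe w, hGe (v + w)] with y h1 h2 h3 h4
        rw [← h2, ← h3, ← h4, h1])
    filter_upwards [AEEqFun.coeFn_add (Γ v) (Γ w), hΓ v, hΓ w, hΓ (v + w), h] with x h1 h2 h3 h4 h5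
    rw [h1, Pi.add_apply, h2, h3, h4]
    by_cases hx : x ∈ Z
    · simp [hx, h5 hx]
    · simp [hx]
  · refine AEEqFun.ext ?_
    have h := hup (fun x => G (c • v) x = c * G v x)
      (measurableSet_eq_fun (hG _) ((hG v).const_mul c)) (by
        filter_upwards [hsmul c v, hGe v, hGe (c • v)] with y h1 h2 h3
        rw [← h2, ← h3, h1])
    filter_upwards [AEEqFun.coeFn_smul c (Γ v), hΓ v, hΓ (c • v), h] with x h1 h2 h3 h4
    rw [RingHom.id_apply, h1, Pi.smul_apply, h2, h3]
    by_cases hx : x ∈ Z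
    · simp [hx, h4 hx]
    · simp [hx]
  · have h := hup (fun x => |G v x| ≤ n v x) (measurableSet_le (hG v).abs (hnm v)) (by
      filter_upwards [hb v, hGe v] with y h1 h2
      rwa [← h2])
    filter_upwards [hΓ v, h, hn v] with x h1 h2 h3
    refine (congrArg abs h1).trans_le ?_
    by_cases hx : x ∈ Z
    · simpa [hx] using h2 hx
    · simpa [hx] using h3
  · filter_upwards [ae_of_ae_map hφ.aemeasurable (hρ.ae_le (hΓ v)), hlow, hGe v] with y h1 h2 h3
    rw [h3]
    refine h1.trans ?_
    rw [indicator_of_mem h2]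

/-- A measure with finite total mass below a given σ-finite measure and with the same null sets. -/
theorem exists_isFiniteMeasure_le (ρ : Measure Y) [SigmaFinite ρ] :
    ∃ ν : Measure Y, IsFiniteMeasure ν ∧ ν ≤ ρ ∧ ρ ≪ ν := by
  obtain ⟨g, hg0, hgm, hg⟩ := exists_pos_lintegral_lt_of_sigmaFinite ρ one_ne_zero
  have hm : Measurable fun y => min (g y : ℝ≥0∞) 1 := hgm.coe_nnreal_ennreal.min measurable_const
  refine ⟨ρ.withDensity fun y => min (g y : ℝ≥0∞) 1, ?_, ?_, ?_⟩
  · refine isFiniteMeasure_withDensity (ne_top_of_le_ne_top hg.ne_top ?_)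
    exact lintegral_mono fun y => min_le_left _ _
  · calc ρ.withDensity (fun y => min (g y : ℝ≥0∞) 1) ≤ ρ.withDensity 1 :=
          withDensity_mono (Eventually.of_forall fun y => min_le_right _ _)
      _ = ρ := withDensity_one
  · refine withDensity_absolutelyContinuous' hm.aemeasurable (Eventually.of_forall fun y => ?_)
    simp [(hg0 y).ne']

/-- A bounded sequence of functionals has a functional that agrees with its limit at each point
where the sequence converges. -/
theorem exists_strongDual_limit {V : Type*} [SeminormedAddCommGroup V] [NormedSpace ℝ V]
    (D : ℕ → StrongDual ℝ V) {C : ℝ} (hD : ∀ m, ‖D m‖ ≤ C) :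
    ∃ w : StrongDual ℝ V, ∀ s l, Tendsto (fun m => D m s) atTop (𝓝 l) → w s = l := by
  let R : Submodule ℝ (V × ℝ) :=
    { carrier := {z | Tendsto (fun m => D m z.1) atTop (𝓝 z.2)}
      add_mem' := fun {z₁ z₂} h1 h2 => by
        have h1' : Tendsto (fun m => D m z₁.1) atTop (𝓝 z₁.2) := h1
        have h2' : Tendsto (fun m => D m z₂.1) atTop (𝓝 z₂.2) := h2
        simpa using h1'.add h2'
      zero_mem' := by simp
      smul_mem' := fun c z h => by
        have h' : Tendsto (fun m => D m z.1) atTop (𝓝 z.2) := h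
        simpa using h'.const_mul c }
  obtain ⟨w, -, hw⟩ := exists_strongDual_of_graph R ((norm_nonneg _).trans (hD 0)) fun z hz =>
    le_of_tendsto' (Tendsto.norm (show Tendsto (fun m => D m z.1) atTop (𝓝 z.2) from hz)) fun m =>
      (D m).le_of_opNorm_le (hD m) z.1
  exact ⟨w, fun s l h => hw (s, l) h⟩

end Descent

section Surjectivity
variable {X Y M E : Type*} [MeasurableSpace X] [MeasurableSpace Y] {μX : Measure X} {μY : Measure Y}
  [SigmaFinite μX] [SigmaFinite μY] {A : ℕ → Set X} {φ : Y → X} {p q : ℝ} [hp1 : Fact (1 < p)]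
  [AddCommGroup M] [Module ℝ M] [Module (Linf μX) M] [IsScalarTower ℝ (Linf μX) M]
  {𝓜 : LpNormedModule (ENNReal.ofReal p) μX M}
  [AddCommGroup E] [Module ℝ E] [Module (Linf μY) E] [IsScalarTower ℝ (Linf μY) E]
  {𝓔 : LpNormedModule (ENNReal.ofReal p) μY E} {T : M →ₗ[ℝ] E}

open LpNormedModule

/-- Each functional on the pullback is represented by a section. Conditioning on `φ` and on the
first `m` sets of a dense sequence in `Y` turns `v ↦ L (T v)`, on a cell, into an operator from `M`
to functions on `X`, bounded by the conditional expectation of `|L|`; its fibre functionals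
converge, as `m → ∞`, to the section sought. -/
theorem exists_section_of_dual (hpq : p.HolderConjugate q) [MeasureTheory.IsSeparable μY]
    (hA : μX.MeasureDense (range A)) (hφ : MeasurePreserving φ μY μX) (hT : IsPullback φ 𝓜 𝓔 T)
    (L : 𝓔.Dual) :
    ∃ w : DualSection fun y => 𝓜.Fiber A (φ y),
      ∀ v : M, (L.1 (T v) : Y → ℝ) =ᵐ[μY] fun y => w y (𝓜.repSection A v (φ y)) := by
  obtain ⟨𝒜, h𝒜c, h𝒜⟩ := MeasureTheory.IsSeparable.exists_countable_measureDense (μ := μY)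
  obtain ⟨B, rfl⟩ := h𝒜c.exists_eq_range h𝒜.nonempty
  have hBm : ∀ i, MeasurableSet (B i) := fun i => h𝒜.measurable _ ⟨i, rfl⟩
  obtain ⟨ν, hνfin, hνle, hν⟩ := exists_isFiniteMeasure_le μY
  have hνY : ν ≪ μY := Measure.absolutelyContinuous_of_le hνle
  set ℱ := cellFiltration hφ.measurable hBm with hℱ
  set ℓ : Y → ℝ := ⇑(dualLpNorm hpq L) with hℓ
  have hℓint : Integrable ℓ ν := ((Lp.memLp (dualLpNorm hpq L)).mono_measure hνle).integrable
    (by simpa using hpq.symm.lt.le)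
  have hℓ0 : ∀ᵐ y ∂ν, 0 ≤ ℓ y := hνY.ae_le (by
    filter_upwards [coeFn_dualLpNorm hpq L] with y hy
    rw [hℓ, hy]; exact ENNReal.toReal_nonneg)
  have hfint : ∀ V : E, Integrable (L.1 V) ν := fun V => by
    obtain ⟨C, _, hC⟩ := L.2
    have h : Integrable (L.1 V) μY := memLp_one_iff_integrable.1
      ⟨AEEqFun.aestronglyMeasurable _, (hC V).trans_lt ENNReal.ofReal_lt_top⟩
    exact h.mono_measure hνle
  have hnmeas : ∀ v, Measurable (𝓜.ptNorm v) := fun v => (Lp.stronglyMeasurable _).measurable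
  have hprod : ∀ v, Integrable ((fun y => 𝓜.ptNorm v (φ y)) * ℓ) ν := fun v => by
    have h1 : MemLp (fun y => 𝓜.ptNorm v (φ y)) (ENNReal.ofReal p) μY :=
      (𝓜.ptNorm_memLp v).comp_measurePreserving hφ
    have := hpq.ennrealOfReal
    exact (h1.integrable_mul (Lp.memLp (dualLpNorm hpq L))).mono_measure hνle
  have hle : ∀ v, ∀ᵐ y ∂ν, |L.1 (T v) y| ≤ 𝓜.ptNorm v (φ y) * ℓ y := fun v => hνY.ae_le (by
    filter_upwards [abs_dual_apply_le L (T v), hT.ptNorm_map v, ofReal_dualLpNorm hpq L,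
      𝓔.ptNorm_nonneg_ae (T v), coeFn_dualLpNorm hpq L] with y h1 h2 h3 h4 h5
    have h6 : 0 ≤ ℓ y := by rw [hℓ, h5]; exact ENNReal.toReal_nonneg
    rw [← h3, ← ENNReal.ofReal_mul h6, ENNReal.ofReal_le_ofReal_iff (mul_nonneg h6 h4), h2] at h1
    rwa [mul_comm])
  -- Conditional expectations are controlled by that of `|L|`, since `|v| ∘ φ` can be pulled out.
  have hcond : ∀ m v, ∀ᵐ y ∂ν,
      |(ν[L.1 (T v) | ℱ m]) y| ≤ 𝓜.ptNorm v (φ y) * (ν[ℓ | ℱ m]) y := by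
    intro m v
    have hsm : StronglyMeasurable[ℱ m] fun y => 𝓜.ptNorm v (φ y) := by
      refine Measurable.stronglyMeasurable ?_
      have h : @Measurable Y (X × ℕ) (ℱ m) _ fun y => (φ y, cellCode B m y) := comap_measurable _
      exact (hnmeas v).comp (measurable_fst.comp h)
    have h1 := condExp_mul_of_stronglyMeasurable_left hsm (hprod v) hℓint
    have h2 : ν[L.1 (T v) | ℱ m] ≤ᵐ[ν] ν[(fun y => 𝓜.ptNorm v (φ y)) * ℓ | ℱ m] :=
      condExp_mono (hfint _) (hprod v) (by
        filter_upwards [hle v] with y hy using (le_abs_self _).trans hy)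
    have h3 : ν[-⇑(L.1 (T v)) | ℱ m] ≤ᵐ[ν] ν[(fun y => 𝓜.ptNorm v (φ y)) * ℓ | ℱ m] :=
      condExp_mono (hfint _).neg (hprod v) (by
        filter_upwards [hle v] with y hy using (neg_le_abs _).trans hy)
    filter_upwards [h1, h2, h3, condExp_neg (μ := ν) (⇑(L.1 (T v))) (ℱ m)] with y h4 h5 h6 h7
    rw [h7] at h6
    rw [h4] at h5 h6
    exact abs_le'.2 ⟨h5, h6⟩
  have hopset : ∀ m (c j : ℕ),
      MeasurableSet {y | cellCode B m y = c ∧ (ν[ℓ | ℱ m]) y ≤ j} := fun m c j => by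
    have h1 : Measurable (ν[ℓ | ℱ m]) := (stronglyMeasurable_condExp.mono (ℱ.le m)).measurable
    exact (measurable_cellCode hBm m (measurableSet_singleton c)).inter
      (measurableSet_le h1 measurable_const)
  -- On the part of a cell where the conditional expectation of `|L|` is at most `j`, the
  -- conditional expectations of the `L (T v)` descend to an operator on `M` bounded by `j`.
  have hop : ∀ m c j : ℕ, ∃ D : ∀ x, StrongDual ℝ (𝓜.Fiber A x), (∀ x, ‖D x‖ ≤ j) ∧
      ∀ v, ∀ᵐ y ∂ν, (cellCode B m y = c ∧ (ν[ℓ | ℱ m]) y ≤ j) →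
        D (φ y) (𝓜.repSection A v (φ y)) = (ν[L.1 (T v) | ℱ m]) y := by
    intro m c j
    set S := {y | cellCode B m y = c ∧ (ν[ℓ | ℱ m]) y ≤ j} with hS
    have hSm : MeasurableSet S := hopset m c j
    have hac : (ν.restrict S).map φ ≪ μX := by
      refine Measure.AbsolutelyContinuous.trans ?_ hφ.quasiMeasurePreserving.absolutelyContinuous
      exact (Measure.absolutelyContinuous_of_le
        (Measure.restrict_le_self.trans hνle)).map hφ.measurable
    obtain ⟨Γ, hΓ, hΓe⟩ := exists_linear_descent hφ.measurable hac
      (e := fun v => ν[L.1 (T v) | ℱ m]) (n := fun v x => j * 𝓜.ptNorm v x)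
      (fun v => by
        obtain ⟨H, hH, hHe⟩ := (stronglyMeasurable_condExp (f := L.1 (T v)) (μ := ν)
          (m := ℱ m)).measurable.exists_eq_measurable_comp
        refine ⟨fun x => H (x, c), hH.comp (measurable_id.prodMk measurable_const), ?_⟩
        rw [ae_restrict_iff' hSm]
        refine Eventually.of_forall fun y hy => ?_
        rw [hHe, Function.comp_apply, hy.1])
      (fun v w => ae_restrict_of_ae (by
        have h1 : ν[L.1 (T (v + w)) | ℱ m] =ᵐ[ν] ν[⇑(L.1 (T v)) + ⇑(L.1 (T w)) | ℱ m] :=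
          condExp_congr_ae (by
            rw [map_add, map_add]; exact hνY.ae_le (AEEqFun.coeFn_add _ _))
        filter_upwards [h1, condExp_add (hfint (T v)) (hfint (T w)) (ℱ m)] with y h2 h3
        rw [h2, h3, Pi.add_apply]))
      (fun c v => ae_restrict_of_ae (by
        have h1 : ν[L.1 (T (c • v)) | ℱ m] =ᵐ[ν] ν[c • ⇑(L.1 (T v)) | ℱ m] :=
          condExp_congr_ae (by
            have e : L.1 (T (c • v)) = c • L.1 (T v) := by
              rw [map_smul]; exact LinearMap.map_smul_of_tower _ _ _
            rw [e]; exact hνY.ae_le (AEEqFun.coeFn_smul _ _))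
        filter_upwards [h1, condExp_smul c (⇑(L.1 (T v))) (ℱ m) (μ := ν)] with y h2 h3
        rw [h2, h3, Pi.smul_apply, smul_eq_mul]))
      (fun v => (hnmeas v).const_mul _)
      (fun v => by
        filter_upwards [𝓜.ptNorm_nonneg_ae v] with x hx
        positivity)
      (fun v => by
        rw [ae_restrict_iff' hSm]
        filter_upwards [hcond m v, hνY.ae_le (hφ.quasiMeasurePreserving.ae (𝓜.ptNorm_nonneg_ae v))]
          with y h1 h2 hy
        rw [mul_comm]
        exact h1.trans (mul_le_mul_of_nonneg_left hy.2 h2))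
    obtain ⟨D, hD, hDv⟩ := 𝓜.exists_fiber_functional hA Γ (Nat.cast_nonneg j) hΓ
    refine ⟨D, hD, fun v => ?_⟩
    have h := hΓe v
    rw [ae_restrict_iff' hSm] at h
    filter_upwards [h, hνY.ae_le (hφ.quasiMeasurePreserving.ae (hDv v))] with y h1 h2 hy
    rw [h2, h1 hy]
  choose D hD hDv using hop
  -- At `y` the bound `j` is the least admissible one; for almost every `y` it stays bounded as
  -- `m → ∞`.
  set F : ∀ y, ℕ → StrongDual ℝ (𝓜.Fiber A (φ y)) := fun y m =>
    D m (cellCode B m y) ⌈(ν[ℓ | ℱ m]) y⌉₊ (φ y) with hF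
  have hlimit : ∀ y, ∃ w : StrongDual ℝ (𝓜.Fiber A (φ y)), (∃ C : ℝ, ∀ m, ‖F y m‖ ≤ C) →
      ∀ s l, Tendsto (fun m => F y m s) atTop (𝓝 l) → w s = l := fun y => by
    by_cases h : ∃ C : ℝ, ∀ m, ‖F y m‖ ≤ C
    · obtain ⟨C, hC⟩ := h
      obtain ⟨w, hw⟩ := exists_strongDual_limit (F y) hC
      exact ⟨w, fun _ => hw⟩
    · exact ⟨0, fun h' => absurd h' h⟩
  choose w hw using hlimit
  have hgen : ∀ S, MeasurableSet S →
      ∃ S', MeasurableSet[MeasurableSpace.generateFrom (range B)] S' ∧ S =ᵐ[ν] S' := fun S hS => by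
    obtain ⟨S', h1, h2⟩ := exists_generateFrom_ae_eq h𝒜 hS
    exact ⟨S', h1, hνY.ae_le h2⟩
  refine ⟨w, fun v => hν.ae_le ?_⟩
  have hall : ∀ᵐ y ∂ν, ∀ m c j : ℕ, (cellCode B m y = c ∧ (ν[ℓ | ℱ m]) y ≤ j) →
      D m c j (φ y) (𝓜.repSection A v (φ y)) = (ν[L.1 (T v) | ℱ m]) y := by
    simp only [ae_all_iff]
    exact fun m c j => hDv m c j v
  filter_upwards [hall, tendsto_condExp_cellFiltration hφ.measurable hBm ν hgen hℓint,
    tendsto_condExp_cellFiltration hφ.measurable hBm ν hgen (hfint (T v))] with y h1 h2 h3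
  obtain ⟨C, hC⟩ := h2.bddAbove_range
  refine (hw y ⟨(⌈C⌉₊ : ℝ), fun m => (hD _ _ _ _).trans ?_⟩ _ _ (h3.congr fun m => ?_)).symm
  · exact_mod_cast Nat.ceil_mono (hC ⟨m, rfl⟩)
  · exact (h1 m _ _ ⟨rfl, Nat.le_ceil _⟩).symm

end Surjectivity

/-! ### The isomorphism -/

section Transport
variable {Y : Type*} [MeasurableSpace Y] {μ : Measure Y} {p : ℝ≥0∞}
  {E F : Type*} [AddCommGroup E] [Module ℝ E] [Module (Linf μ) E] [IsScalarTower ℝ (Linf μ) E]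
  [AddCommGroup F] [Module ℝ F] [Module (Linf μ) F] [IsScalarTower ℝ (Linf μ) F]

/-- The structure of a normed module transported along an `L^∞`-linear equivalence. -/
noncomputable def LpNormedModule.comap (𝓕 : LpNormedModule p μ F) (I : E ≃ₗ[Linf μ] F) :
    LpNormedModule p μ E where
  ptNorm v := 𝓕.ptNorm (I v)
  ptNorm_nonneg v := 𝓕.ptNorm_nonneg _
  ptNorm_smul f v := by rw [map_smul]; exact 𝓕.ptNorm_smul _ _
  norm_add_le v w := by rw [map_add]; exact 𝓕.norm_add_le _ _
  eq_zero_of_norm v h := I.map_eq_zero_iff.1 (𝓕.eq_zero_of_norm _ h)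
  complete u hu := by
    obtain ⟨v, hv⟩ := 𝓕.complete (fun n => I (u n)) (by simpa only [map_sub] using hu)
    refine ⟨I.symm v, ?_⟩
    simpa only [map_sub, I.apply_symm_apply] using hv

theorem LpNormedModule.comap_ptNorm (𝓕 : LpNormedModule p μ F) (I : E ≃ₗ[Linf μ] F) (v : E) :
    (𝓕.comap I).ptNorm v = 𝓕.ptNorm (I v) := rfl

end Transport

section Isomorphism
variable {X Y M E : Type*} [MeasurableSpace X] [MeasurableSpace Y] {μX : Measure X} {μY : Measure Y}
  [SigmaFinite μY] {A : ℕ → Set X} {φ : Y → X} {p q : ℝ} [hp1 : Fact (1 < p)]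
  [AddCommGroup M] [Module ℝ M] [Module (Linf μX) M] [IsScalarTower ℝ (Linf μX) M]
  {𝓜 : LpNormedModule (ENNReal.ofReal p) μX M}
  [AddCommGroup E] [Module ℝ E] [Module (Linf μY) E] [IsScalarTower ℝ (Linf μY) E]
  {𝓔 : LpNormedModule (ENNReal.ofReal p) μY E} {T : M →ₗ[ℝ] E}

theorem mk_eq_mk_iff_of_represents
    {w₁ w₂ : weakLpSections μY (pullbackTest 𝓜 A φ) (ENNReal.ofReal q)} {a : M → Y → ℝ} (h₁ : ∀ v, a v =ᵐ[μY] fun y => w₁.1 y (𝓜.repSection A v (φ y))) :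
    (Submodule.Quotient.mk w₁ : WeakLp μY (pullbackTest 𝓜 A φ) (ENNReal.ofReal q)) =
        Submodule.Quotient.mk w₂ ↔
      ∀ v, a v =ᵐ[μY] fun y => w₂.1 y (𝓜.repSection A v (φ y)) := by
  rw [Submodule.Quotient.eq]
  constructor
  · intro h v
    filter_upwards [h₁ v, h _ ⟨v, rfl⟩] with y h2 h3
    rw [h2]
    exact sub_eq_zero.1 h3
  · rintro h _ ⟨v, rfl⟩
    filter_upwards [h₁ v, h v] with y h2 h3
    exact sub_eq_zero.2 (h2.symm.trans h3)

variable [SigmaFinite μX]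

attribute [local instance] LpNormedModule.dualSMul

/-- The isomorphism between `L^q_weak` and the dual of the pullback. -/
theorem exists_weakLp_equiv_dual (hpq : p.HolderConjugate q) [MeasureTheory.IsSeparable μY]
    (hA : μX.MeasureDense (range A)) (hφ : MeasurePreserving φ μY μX) (hT : IsPullback φ 𝓜 𝓔 T) :
    ∃ I : WeakLp μY (pullbackTest 𝓜 A φ) (ENNReal.ofReal q) ≃ₗ[Linf μY] 𝓔.Dual,
      (∀ (w : weakLpSections μY (pullbackTest 𝓜 A φ) (ENNReal.ofReal q)) (L : 𝓔.Dual),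
        (∀ v : M, (L.1 (T v) : Y → ℝ) =ᵐ[μY] fun y => w.1 y (𝓜.repSection A v (φ y))) ↔
          L = I (Submodule.Quotient.mk w)) ∧
      ∀ w : weakLpSections μY (pullbackTest 𝓜 A φ) (ENNReal.ofReal q),
        𝓔.dualPtNorm (I (Submodule.Quotient.mk w)) =ᵐ[μY]
          weakPtNorm μY (pullbackTest 𝓜 A φ) w.1 := by
  have huniq : ∀ (w : weakLpSections μY (pullbackTest 𝓜 A φ) (ENNReal.ofReal q)) (L K : 𝓔.Dual),
      (∀ v : M, (L.1 (T v) : Y → ℝ) =ᵐ[μY] fun y => w.1 y (𝓜.repSection A v (φ y))) →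
      (∀ v : M, (K.1 (T v) : Y → ℝ) =ᵐ[μY] fun y => w.1 y (𝓜.repSection A v (φ y))) → L = K := by
    intro w L K h1 h2
    refine LpNormedModule.dual_ext_of_dense hT.generates ?_
    rintro _ ⟨v, rfl⟩
    exact AEEqFun.ext ((h1 v).trans (h2 v).symm)
  choose J hJ hJn using fun w : weakLpSections μY (pullbackTest 𝓜 A φ) (ENNReal.ofReal q) =>
    exists_dual_of_section hpq hA hφ hT w
  have hwell : ∀ w₁ w₂, (Submodule.Quotient.mk w₁ : WeakLp μY (pullbackTest 𝓜 A φ) (ENNReal.ofReal q))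
      = Submodule.Quotient.mk w₂ → J w₁ = J w₂ := fun w₁ w₂ h =>
    huniq w₂ _ _ ((mk_eq_mk_iff_of_represents (hJ w₁)).1 h) (hJ w₂)
  set I : WeakLp μY (pullbackTest 𝓜 A φ) (ENNReal.ofReal q) → 𝓔.Dual :=
    fun ω => J (Quotient.out ω) with hI
  have hImk : ∀ w, I (Submodule.Quotient.mk w) = J w := fun w =>
    hwell _ _ (Quotient.out_eq (Submodule.Quotient.mk w :
      WeakLp μY (pullbackTest 𝓜 A φ) (ENNReal.ofReal q)))
  have hadd : ∀ ω₁ ω₂, I (ω₁ + ω₂) = I ω₁ + I ω₂ := by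
    intro ω₁ ω₂
    obtain ⟨w₁, rfl⟩ := Submodule.Quotient.mk_surjective _ ω₁
    obtain ⟨w₂, rfl⟩ := Submodule.Quotient.mk_surjective _ ω₂
    rw [← Submodule.Quotient.mk_add, hImk, hImk, hImk]
    refine huniq (w₁ + w₂) _ _ (hJ _) fun v => ?_
    filter_upwards [hJ w₁ v, hJ w₂ v, AEEqFun.coeFn_add ((J w₁).1 (T v)) ((J w₂).1 (T v))]
      with y h1 h2 h3
    refine h3.trans ?_
    rw [Pi.add_apply, h1, h2]
    rfl
  have hsmul : ∀ (f : Linf μY) ω, I (f • ω) = f • I ω := by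
    intro f ω
    obtain ⟨w, rfl⟩ := Submodule.Quotient.mk_surjective _ ω
    rw [smul_mk, hImk, hImk]
    refine huniq (weakMul μY _ _ f w) _ _ (hJ _) fun v => ?_
    filter_upwards [hJ w v, Linf.coeFn_smul f ((J w).1 (T v))] with y h1 h2
    refine h2.trans ?_
    rw [h1]
    rfl
  have hinj : Function.Injective I := by
    intro ω₁ ω₂ h
    obtain ⟨w₁, rfl⟩ := Submodule.Quotient.mk_surjective _ ω₁
    obtain ⟨w₂, rfl⟩ := Submodule.Quotient.mk_surjective _ ω₂
    rw [hImk, hImk] at h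
    exact (mk_eq_mk_iff_of_represents (hJ w₁)).2 (h ▸ hJ w₂)
  have hsurj : Function.Surjective I := by
    intro L
    obtain ⟨w, hw⟩ := exists_section_of_dual hpq hA hφ hT L
    have hmem : w ∈ weakLpSections μY (pullbackTest 𝓜 A φ) (ENNReal.ofReal q) := by
      refine ⟨?_, (LpNormedModule.memLp_dualPtNorm hpq L).of_le_enorm
        (isEssSup_familyEssSup μY _).measurable.aestronglyMeasurable
        (weakPtNorm_le_dualPtNorm hA hφ hT w L hw)⟩
      rintro _ ⟨v, rfl⟩
      exact (L.1 (T v)).measurable.aemeasurable.congr (hw v)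
    exact ⟨Submodule.Quotient.mk ⟨w, hmem⟩, (hImk _).trans (huniq ⟨w, hmem⟩ _ _ (hJ _) hw)⟩
  refine ⟨LinearEquiv.ofBijective { toFun := I, map_add' := hadd, map_smul' := hsmul }
    ⟨hinj, hsurj⟩, fun w L => ?_, fun w => ?_⟩
  · change _ ↔ L = I (Submodule.Quotient.mk w)
    rw [hImk]
    exact ⟨fun h => huniq w _ _ h (hJ w), fun h => h ▸ hJ w⟩
  · change 𝓔.dualPtNorm (I (Submodule.Quotient.mk w)) =ᵐ[μY] _
    rw [hImk]
    exact hJn w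

end Isomorphism

end NormedModules

theorem mainTheorem1 {X Y M E : Type*} [MeasurableSpace X] [MeasurableSpace Y]
    (μX : Measure X) (μY : Measure Y) [SigmaFinite μX] [SigmaFinite μY]
    [MeasureTheory.IsSeparable μY]
    (A : ℕ → Set X) (hA : μX.MeasureDense (range A))
    (φ : Y → X) (hφ : MeasurePreserving φ μY μX)
    (p q : ℝ) [Fact (1 < p)] (hpq : p.HolderConjugate q)
    [AddCommGroup M] [Module ℝ M] [Module (Linf μX) M] [IsScalarTower ℝ (Linf μX) M]
    (𝓜 : LpNormedModule (ENNReal.ofReal p) μX M)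
    [AddCommGroup E] [Module ℝ E] [Module (Linf μY) E] [IsScalarTower ℝ (Linf μY) E]
    (𝓔 : LpNormedModule (ENNReal.ofReal p) μY E)
    (T : M →ₗ[ℝ] E) (hT : IsPullback φ 𝓜 𝓔 T) :
    IsWeakBanachBundle μY (pullbackTest 𝓜 A φ) ∧
    ∃ (𝓦 : LpNormedModule (ENNReal.ofReal q) μY
        (WeakLp μY (pullbackTest 𝓜 A φ) (ENNReal.ofReal q)))
      (𝓓 : LpNormedModule (ENNReal.ofReal q) μY 𝓔.Dual)
      (I : WeakLp μY (pullbackTest 𝓜 A φ) (ENNReal.ofReal q) ≃ₗ[Linf μY] 𝓔.Dual),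
      (∀ w : weakLpSections μY (pullbackTest 𝓜 A φ) (ENNReal.ofReal q),
        (fun y => ENNReal.ofReal (𝓦.ptNorm (Submodule.Quotient.mk w) y)) =ᵐ[μY]
          weakPtNorm μY (pullbackTest 𝓜 A φ) w.1) ∧
      (∀ L : 𝓔.Dual,
        (fun y => ENNReal.ofReal (𝓓.ptNorm L y)) =ᵐ[μY] 𝓔.dualPtNorm L ∧
        ‖𝓓.ptNorm L‖ = 𝓔.dualOpNorm L) ∧
      (∀ (w : weakLpSections μY (pullbackTest 𝓜 A φ) (ENNReal.ofReal q)) (L : 𝓔.Dual),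
        (∀ v : M, (L.1 (T v) : Y → ℝ) =ᵐ[μY] fun y => w.1 y (𝓜.repSection A v (φ y))) ↔
          L = I (Submodule.Quotient.mk w)) ∧
      (∀ ω, 𝓓.ptNorm (I ω) = 𝓦.ptNorm ω) := by
  refine ⟨isWeakBanachBundle_pullbackTest hA hφ, ?_⟩
  obtain ⟨I, hI, hIn⟩ := exists_weakLp_equiv_dual hpq hA hφ hT
  obtain ⟨𝓓, h𝓓⟩ := 𝓔.exists_dualNormedModule hpq
  refine ⟨𝓓.comap I, 𝓓, I, fun w => ?_, h𝓓, hI, fun ω => (𝓓.comap_ptNorm I ω).symm⟩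
  rw [𝓓.comap_ptNorm]
  exact (h𝓓 _).1.trans (hIn w)
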